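/- Let $d,m\in\mathbb N$ with $d\ge 2$ and $m\ge 1$. Let $\mathrm{Lie}(\mathbb R^d)$ be the smallest vector subspace of $\mathbb R\langle x_1,\dots,x_d\rangle=\bigoplus_{k}(\mathbb R^d)^{\otimes k}$ that contains $x_1,\dots,x_d$ and is closed under $[T,S]=TS-ST$, and let $\mathrm{Lie}^m(\mathbb R^d)$ be the set of its elements whose components of order $>m$ vanish. For $k\in\mathbb N$ let the rough Veronese variety $\mathcal R_{d,k,m}\subseteq\mathbb P^{d^k-1}_{\mathbb C}$ be the Zariski closure of the image of the (partially defined) map $L\mapsto[p_k(\exp L)]$, $L\in\mathrm{Lie}^m(\mathbb R^d)$, where $\exp L=\sum_{n\ge 0}L^{\otimes n}/n!$ is computed in the algebra of formal power series $T((\mathbb R^d))=\prod_k(\mathbb R^d)^{\otimes k}$, $p_k$ is the projection to $(\mathbb R^d)^{\otimes k}\subseteq(\mathbb C^d)^{\otimes k}$, and $[\,\cdot\,]$ is the class in projective space (where $p_k(\exp L)\neq0$). A nonempty word $w$ in the ordered alphabet $\{1,\dots,d\}$ is Lyndon if $w<q$ lexicographically whenever $w=pq$ with $p,q$ nonempty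 words. Let $W_{d,m}$ be the set of Lyndon words of length at most $m$, let $\ell(w)$ be the length of $w$, let $l=\mathrm{lcm}(1,2,\dots,m)$, and let $\Delta\subset\mathbb R^{W_{d,m}}$ be the convex hull of the points $\frac{l}{\ell(w)}e_w$, $w\in W_{d,m}$. For a polytope $P\subset\mathbb R^{N}$ of dimension $n$, let $\mathrm{vol}(P)$ be its normalized volume: $n!$ times its Lebesgue measure in its affine span, scaled so that a fundamental parallelepiped of the lattice of integral vectors parallel to the affine span has measure $1$. The degree of a projective variety is $n!$ times the leading coefficient of its Hilbert polynomial, where $n$ is the degree of this polynomial. Then: (1) For every $k\ge m$, $\dim\mathcal R_{d,k,m}=\#W_{d,m}-1$. (2) For every $k\ge m$, the Hilbert polynomial of $\mathcal R_{d,k,m}$ exists and $$\deg\mathcal R_{d,k,m}\le\mathrm{vol}\left(\tfrac{k}{l}\Delta\right),$$ with equality if and only if $l\mid k$. Moreover, for fixed $d$ and $m$, $$\lim_{k\to\infty}\frac{\deg\mathcal R_{d,k,m}}{\mathrm{vol}\left(\frac kl\Delta\right)}=1.$$ -/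

import Mathlib

open scoped BigOperators Pointwise Topology LinearAlgebra.Projectivization

noncomputable section

/-! ### Lyndon words -/

/-- A nonempty word `w` is Lyndon if `w < q` lexicographically (a proper prefix being smaller)
for every factorization `w = p q` into nonempty words. -/
def IsLyndon {d : ℕ} (w : List (Fin d)) : Prop :=
  w ≠ [] ∧ ∀ p q : List (Fin d), p ≠ [] → q ≠ [] → w = p ++ q → w < q

/-- The set `W_{d,m}` of Lyndon words of length at most `m` in an alphabet with `d` letters. -/
def LyndonWord (d m : ℕ) : Type :=
  {w : List (Fin d) // IsLyndon w ∧ w.length ≤ m}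

instance LyndonWord.instFinite (d m : ℕ) : Finite (LyndonWord d m) :=
  ((List.finite_length_le (Fin d) m).subset (fun _ hw => hw.2) :
    {w : List (Fin d) | IsLyndon w ∧ w.length ≤ m}.Finite).to_subtype

instance LyndonWord.instFintype (d m : ℕ) : Fintype (LyndonWord d m) :=
  Fintype.ofFinite _

instance LyndonWord.instDecidableEq (d m : ℕ) : DecidableEq (LyndonWord d m) :=
  Classical.decEq _

/-- The length of a Lyndon word. -/
def LyndonWord.length {d m : ℕ} (w : LyndonWord d m) : ℕ := w.1.length

/-! ### The tensor algebra, Lie polynomials and the exponential -/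

/-- The algebra `ℝ⟨x₁, …, x_d⟩ = ⨁ₖ (ℝ^d)^{⊗ k}` of noncommutative polynomials; the words (the
elements of the free monoid) are its monomial basis, and `T.coeff w` is the entry of `T` at the
word `w`. -/
abbrev TensorPoly (d : ℕ) : Type := MonoidAlgebra ℝ (FreeMonoid (Fin d))

attribute [local instance] LieRing.ofAssociativeRing

/-- The free Lie algebra `Lie(ℝ^d)`: the smallest vector subspace that contains `x₁, …, x_d` and is
closed under `[T, S] = T S - S T`. -/
def freeLie (d : ℕ) : LieSubalgebra ℝ (TensorPoly d) :=
  LieSubalgebra.lieSpan ℝ (TensorPoly d)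
    (Set.range fun i : Fin d => MonoidAlgebra.of ℝ (FreeMonoid (Fin d)) (FreeMonoid.of i))

/-- `Lie^m(ℝ^d)`: the Lie polynomials all of whose components of order greater than `m` vanish. -/
def truncatedLie (d m : ℕ) : Set (TensorPoly d) :=
  {L | L ∈ freeLie d ∧ ∀ w : FreeMonoid (Fin d), m < w.length → L.coeff w = 0}

/-- The entry at the word `w` of the formal power series `exp(L) = ∑ₙ L^{⊗ n} / n!`, for `L` with
zero constant term. The terms with `n > ℓ(w)` have entry `0` at `w`
(see `coeff_pow_eq_zero`), so the series is a finite sum. -/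
def expEntry {d : ℕ} (L : TensorPoly d) (w : FreeMonoid (Fin d)) : ℝ :=
  ∑ n ∈ Finset.range (w.length + 1), ((n.factorial : ℝ))⁻¹ * (L ^ n).coeff w

/-- Powers of a noncommutative polynomial without constant term have no terms of small order. -/
theorem coeff_pow_eq_zero {d : ℕ} (L : TensorPoly d) (hL : L.coeff 1 = 0) (n : ℕ)
    (w : FreeMonoid (Fin d)) (hw : w.length < n) : (L ^ n).coeff w = 0 := by
  classical
  induction n generalizing w with
  | zero => omega
  | succ n ih =>
    rw [pow_succ, MonoidAlgebra.coeff_mul]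
    refine Finset.sum_eq_zero fun a _ => Finset.sum_eq_zero fun b _ => ?_
    dsimp only
    split_ifs with hab
    · have hlen : a.length + b.length = w.length := by rw [← hab, FreeMonoid.length_mul]
      by_cases ha : a.length < n
      · rw [ih a ha, zero_mul]
      · have hb : b = 1 := FreeMonoid.length_eq_zero.1 (by omega)
        rw [hb, hL, mul_zero]
    · rfl

/-- A Lie polynomial has no constant term. -/
theorem coeff_one_of_mem_freeLie {d : ℕ} {L : TensorPoly d} (hL : L ∈ freeLie d) :
    L.coeff 1 = 0 := by
  classical
  have hmul : ∀ x y : TensorPoly d, (x * y).coeff 1 = x.coeff 1 * y.coeff 1 := by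
    intro x y
    let φ : TensorPoly d →ₐ[ℝ] ℝ := MonoidAlgebra.lift ℝ ℝ (FreeMonoid (Fin d))
      (FreeMonoid.lift fun _ => 0)
    have hφ : ∀ z : TensorPoly d, φ z = z.coeff 1 := by
      intro z
      have h0 : ∀ w : FreeMonoid (Fin d), (FreeMonoid.lift fun _ : Fin d => (0 : ℝ)) w =
          if w = 1 then 1 else 0 := by
        intro w
        induction w using FreeMonoid.inductionOn' with
        | one => simp
        | of_mul x w _ =>
          have hne : FreeMonoid.of x * w ≠ 1 := fun h => by
            have := congrArg FreeMonoid.length h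
            simp [FreeMonoid.length_mul] at this
          simp [hne]
      simp only [φ, MonoidAlgebra.lift_apply, h0, Finsupp.sum, smul_eq_mul, mul_ite, mul_one,
        mul_zero, Finset.sum_ite_eq', Finsupp.mem_support_iff]
      split_ifs with h
      · rfl
      · exact (not_not.1 h).symm
    rw [← hφ, ← hφ, ← hφ, map_mul]
  induction hL using LieSubalgebra.lieSpan_induction with
  | mem x hx => obtain ⟨i, rfl⟩ := hx; simp [MonoidAlgebra.of_apply, MonoidAlgebra.coeff_single]
  | zero => simp
  | add x y _ _ hx hy => simp [hx, hy]
  | smul a x _ hx => simp [hx]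
  | lie x y _ _ hx hy => simp [Ring.lie_def, hmul, hx, hy]

/-- The order `k` component of `exp(L)`, as a tensor in `(ℂ^d)^{⊗ k}` written in coordinates. -/
def expTensor {d : ℕ} (k : ℕ) (L : TensorPoly d) : (Fin k → Fin d) → ℂ :=
  fun w => ((expEntry L (FreeMonoid.ofList (List.ofFn w)) : ℝ) : ℂ)

/-! ### Complex projective space: Zariski topology, Hilbert function, degree -/

/-- The basic open set of the projective space given by a form `f`. For a homogeneous `f` the
condition does not depend on the representative of the point. -/
def projBasicOpen {σ : Type*} (f : MvPolynomial σ ℂ) : Set (ℙ ℂ (σ → ℂ)) :=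
  {p | MvPolynomial.eval p.rep f ≠ 0}

/-- The Zariski topology on the projective space: the open sets are the unions of sets
`{f ≠ 0}` with `f` homogeneous. -/
instance zariskiTopology (σ : Type*) : TopologicalSpace (ℙ ℂ (σ → ℂ)) :=
  TopologicalSpace.generateFrom
    {U | ∃ (f : MvPolynomial σ ℂ) (t : ℕ), f.IsHomogeneous t ∧ U = projBasicOpen f}

/-- The forms of degree `t` that vanish on `X`: the degree `t` part of the homogeneous ideal. -/
def vanishingForms {σ : Type*} (X : Set (ℙ ℂ (σ → ℂ))) (t : ℕ) :
    Submodule ℂ (MvPolynomial.homogeneousSubmodule σ ℂ t) where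
  carrier := {f | ∀ p ∈ X, MvPolynomial.eval p.rep (f : MvPolynomial σ ℂ) = 0}
  zero_mem' := fun p _ => by simp
  add_mem' := fun {f g} hf hg p hp => by simp [hf p hp, hg p hp]
  smul_mem' := fun c f hf p hp => by simp [MvPolynomial.smul_eval, hf p hp]

/-- The Hilbert function of `X`: the dimension of the degree `t` part of the homogeneous coordinate
ring `ℂ[y] / I(X)`. -/
def hilbertFunction {σ : Type*} (X : Set (ℙ ℂ (σ → ℂ))) (t : ℕ) : ℕ :=
  Module.finrank ℂ (MvPolynomial.homogeneousSubmodule σ ℂ t ⧸ vanishingForms X t)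

/-- `P` is the Hilbert polynomial of `X`. -/
def IsHilbertPolynomial {σ : Type*} (X : Set (ℙ ℂ (σ → ℂ))) (P : Polynomial ℚ) : Prop :=
  ∀ᶠ t : ℕ in Filter.atTop, P.eval (t : ℚ) = (hilbertFunction X t : ℚ)

open Classical in
/-- The degree of a projective variety: `n!` times the leading coefficient of its Hilbert
polynomial, `n` being the degree of that polynomial. -/
def projDegree {σ : Type*} (X : Set (ℙ ℂ (σ → ℂ))) : ℚ :=
  if h : ∃ P : Polynomial ℚ, IsHilbertPolynomial X P then
    (h.choose.natDegree.factorial : ℚ) * h.choose.leadingCoeff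
  else 0

/-! ### The rough Veronese variety -/

/-- The rough Veronese variety `R_{d,k,m}`: the Zariski closure in `ℙ^{d^k - 1}` of the image of the
rational map sending `L ∈ Lie^m(ℝ^d)` to the class of the order `k` component of `exp(L)`. -/
def roughVeronese (d k m : ℕ) : Set (ℙ ℂ ((Fin k → Fin d) → ℂ)) :=
  closure {p | ∃ L ∈ truncatedLie d m, ∃ h : expTensor k L ≠ 0,
    p = Projectivization.mk ℂ (expTensor k L) h}

/-! ### Normalized volume and the simplex -/

/-- The lattice of integral points of a linear subspace `V` of `ℝ^ι`. -/
def integralPoints {ι : Type*} (V : Submodule ℝ (ι → ℝ)) : Submodule ℤ V where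
  carrier := {v | ∀ i, ∃ n : ℤ, (v : ι → ℝ) i = n}
  zero_mem' := fun i => ⟨0, by simp⟩
  add_mem' := fun {v w} hv hw i => by
    obtain ⟨a, ha⟩ := hv i
    obtain ⟨b, hb⟩ := hw i
    exact ⟨a + b, by simp [ha, hb]⟩
  smul_mem' := fun c v hv i => by
    obtain ⟨a, ha⟩ := hv i
    exact ⟨c * a, by simp [ha]⟩

open Classical in
/-- The normalized volume of a polytope `P ⊆ ℝ^ι` of dimension `n`, relative to the lattice `ℤ^ι`:
`n!` times its Lebesgue measure inside its affine span, where the measure is scaled so that a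
fundamental parallelepiped of the lattice of integral points in the direction space of the
affine span has measure `1`. -/
def normalizedVolume {ι : Type*} [Fintype ι] (P : Set (ι → ℝ)) : ℝ :=
  if h : P.Nonempty then
    ((Module.finrank ℝ (vectorSpan ℝ P)).factorial : ℝ) *
      ((MeasureTheory.Measure.addHaar {v : vectorSpan ℝ P | (v : ι → ℝ) + h.some ∈ P}).toReal /
        ZLattice.covolume (integralPoints (vectorSpan ℝ P)) MeasureTheory.Measure.addHaar)
  else 0

/-- `lcm(1, …, m)`. -/
def lcmUpTo (m : ℕ) : ℕ := (Finset.Icc 1 m).lcm id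

/-- The simplex `Δ`: the convex hull of the points `(l / ℓ(w)) e_w`, for `w` a Lyndon word of length
`ℓ(w) ≤ m` and `l = lcm(1, …, m)`. -/
def lyndonSimplex (d m : ℕ) : Set (LyndonWord d m → ℝ) :=
  convexHull ℝ (Set.range fun w : LyndonWord d m =>
    Pi.single (M := fun _ => ℝ) w ((lcmUpTo m : ℝ) / (w.length : ℝ)))

end

/-!
The proof identifies the rough Veronese variety with a weighted Veronese variety
and reads off its dimension and degree from counts of lattice points.

*Coordinates on `Lie^m`.* The standard bracketing of a Lyndon word `w` is a Lie polynomial `B_w`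
whose smallest word is `w`, so the `B_w` are linearly independent. They span as well
(`mem_truncatedLie_iff`), by a count that avoids the Poincaré–Birkhoff–Witt theorem: if `b` is an
independent family of homogeneous Lie polynomials, the order `k` entries of `exp(∑ aᵢ bᵢ)` span
all polynomials in `a` of weighted degree `k` (`entrySpan_eq_weightedFunctions`), so there are at
most `d ^ k` monomials of weighted degree `k` (`card_weight_le_pow`). Every word is a nonincreasing
product of Lyndon words, so the Lyndon brackets already give `d ^ k` monomials, and no independent
Lie polynomial of order `k` can be added.

*The entries span everything.* The exponential of a Lie polynomial is group-like, so products of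
entries are linear combinations of entries (`expEntry_mul`). An entry of order `k` is its linear part
plus products of terms of lower order; by induction the linear parts, hence the coordinates, hence
all monomials, lie in the span. So the order `k` component of `exp` parametrizes, up to a linear
embedding of projective spaces, the closure of the image of all monomials of weighted degree `k` in variables
`a_w` of weight `ℓ(w)`.

*Hilbert function.* In degree `t > 0` it counts the sums of `t` exponents of weighted degree `k`
(`hilbertFunction_eq_ncard_iterSum`), which is eventually polynomial in `t` by Khovanskii's theorem
(`eventuallyPolynomial_ncard_iterSum`). A one-letter word has weight `1`; forgetting its exponent
turns the exponents of weighted degree `k` into those of weighted degree at most `k` in the other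
`n = #W_{d,m} - 1` variables.

*Degree.* Let `v` be the volume of the simplex `{x ≥ 0, ∑ ℓ(w) x_w ≤ 1}` in these `n` variables.
Sums of `t` exponents lie in the simplex dilated by `t k`, so the leading coefficient is at most
`v k ^ n`. If all lengths divide `k`, every lattice point of the dilation by `(t - n) k` is such a
sum, and equality holds. If some `ℓ(w)` does not divide `k`, the sums miss a corner whose volume is
of order `t ^ n`, and the inequality is strict (`leadingCoeff_of_ncard_iterSum`). Comparing `k` with
the largest multiple of `lcm(1, …, m)` up to `k` gives the limit. Finally `n! v k ^ n` is the
normalized volume of `(k / lcm(1, …, m)) Δ` (`normalizedVolume_weightFace`), because dropping the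
coordinate of the one-letter word maps the lattice of the affine span onto `ℤ ^ n`.

*Dimension.* The growth order of the Hilbert function drops along strict inclusions of irreducible
closed sets, which bounds the dimension by `n`; images of coordinate subspaces give a chain of
length `n` (`topologicalKrullDim_closure_realParamSet`).
-/

/-! ### Lyndon words: standard factorization and nonincreasing factorizations -/

section Lyndon

variable {d : ℕ}

theorem List.append_lt_append_of_lt_of_not_prefix {α : Type*} [LinearOrder α] {a b : List α}
    (h : a < b) (hab : ¬ a <+: b) (c e : List α) : a ++ c < b ++ e := by
  induction a generalizing b with
  | nil => exact absurd (List.nil_prefix) hab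
  | cons x a ih =>
    cases b with
    | nil => simp at h
    | cons y b =>
      rw [List.cons_append, List.cons_append, List.cons_lt_cons_iff]
      rcases List.cons_lt_cons_iff.1 h with h1 | ⟨rfl, h1⟩
      · exact Or.inl h1
      · exact Or.inr ⟨rfl, ih h1 fun hp => hab (by simpa using hp)⟩

theorem List.append_lt_append_of_lt_of_length_le {α : Type*} [LinearOrder α] {a b : List α}
    (h : a < b) (hl : b.length ≤ a.length) (c e : List α) : a ++ c < b ++ e :=
  List.append_lt_append_of_lt_of_not_prefix h
    (fun hp => h.ne (hp.eq_of_length (le_antisymm hp.length_le hl))) c e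

theorem List.append_le_append_left_of_le {α : Type*} [LinearOrder α] {a b : List α} (h : a ≤ b)
    (s : List α) : s ++ a ≤ s ++ b := by
  rcases h.lt_or_eq with h | rfl
  · exact le_of_lt (List.append_left_lt h)
  · exact le_rfl

theorem List.append_le_append_of_length_eq {α : Type*} [LinearOrder α] {a b c e : List α}
    (h : a ≤ b) (hl : a.length = b.length) (h' : c ≤ e) : a ++ c ≤ b ++ e := by
  rcases h.lt_or_eq with h | rfl
  · exact (List.append_lt_append_of_lt_of_length_le h hl.ge c e).le
  · exact List.append_le_append_left_of_le h' a

theorem isLyndon_singleton (i : Fin d) : IsLyndon [i] := by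
  refine ⟨by simp, fun p q hp hq h => ?_⟩
  have := congrArg List.length h
  have := List.length_pos_iff.2 hp
  have := List.length_pos_iff.2 hq
  simp at *
  omega

/-- The words `x … x y` with `x < y` are Lyndon, so there are Lyndon words of every positive
length. -/
theorem isLyndon_replicate_append {x y : Fin d} (hxy : x < y) (n : ℕ) :
    IsLyndon (List.replicate n x ++ [y]) := by
  refine ⟨by simp, fun p q hp hq h => ?_⟩
  rcases List.append_eq_append_iff.1 h with ⟨a, rfl, ha⟩ | ⟨c, hc, rfl⟩
  · have hl := congrArg List.length ha
    have := List.length_pos_iff.2 hq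
    simp only [List.length_append, List.length_singleton] at hl
    have ha0 : a = [] := List.length_eq_zero_iff.1 (by omega)
    subst ha0
    obtain rfl : q = [y] := by simpa using ha.symm
    cases n with
    | zero => simp at hp
    | succ n => exact List.cons_lt_cons_iff.2 (Or.inl hxy)
  · obtain ⟨hn, -, h2⟩ := List.append_eq_replicate_iff.1 hc.symm
    rw [h2, ← hn]
    have hp0 := List.length_pos_iff.2 hp
    obtain ⟨j, hj⟩ : ∃ j, p.length = j + 1 := ⟨p.length - 1, by omega⟩
    generalize c.length = i
    rw [hj]
    rw [show j + 1 + i = i + (j + 1) by ring, List.replicate_add, List.append_assoc]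
    exact List.append_left_lt (List.cons_lt_cons_iff.2 (Or.inl hxy))

theorem IsLyndon.append {u v : List (Fin d)} (hu : IsLyndon u) (hv : IsLyndon v) (h : u < v) :
    IsLyndon (u ++ v) := by
  have huv : u ++ v < v := by
    by_cases hp : u <+: v
    · obtain ⟨c, rfl⟩ := hp
      have hc : c ≠ [] := by rintro rfl; simp at h
      exact List.append_left_lt (hv.2 u c hu.1 hc rfl)
    · simpa using List.append_lt_append_of_lt_of_not_prefix h hp v []
  refine ⟨by simp [hu.1], fun p q hp hq hpq => ?_⟩
  rcases List.append_eq_append_iff.1 hpq with ⟨a, rfl, rfl⟩ | ⟨c, rfl, rfl⟩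
  · by_cases ha : a = []
    · simpa [ha] using huv
    · exact huv.trans (hv.2 a q ha hq rfl)
  · by_cases hc : c = []
    · simpa [hc] using huv
    · exact List.append_lt_append_of_lt_of_length_le (hu.2 p c hp hc rfl)
        (by simp) v v

/-- Standard factorization: the second factor is the lexicographically smallest proper suffix. -/
theorem IsLyndon.exists_factorization {w : List (Fin d)} (hw : IsLyndon w) (hl : 2 ≤ w.length) :
    ∃ u v, IsLyndon u ∧ IsLyndon v ∧ w = u ++ v := by
  classical
  let S : Finset (List (Fin d)) := w.tails.toFinset.filter fun v => v ≠ [] ∧ v ≠ w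
  have hS : ∀ v, v ∈ S ↔ v ≠ [] ∧ ∃ u, u ≠ [] ∧ w = u ++ v := by
    intro v
    simp only [S, Finset.mem_filter, List.mem_toFinset, List.mem_tails]
    constructor
    · rintro ⟨⟨u, rfl⟩, h1, h2⟩
      exact ⟨h1, u, by rintro rfl; simp at h2, rfl⟩
    · rintro ⟨h1, u, hu, rfl⟩
      exact ⟨⟨u, rfl⟩, h1, by simpa using hu⟩
  have hne : S.Nonempty := by
    match w, hl with
    | x :: y :: l, _ => exact ⟨y :: l, (hS _).2 ⟨by simp, [x], by simp, rfl⟩⟩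
  obtain ⟨v, hvS, hmin⟩ := S.exists_min_image id hne
  obtain ⟨hv0, u, hu0, rfl⟩ := (hS v).1 hvS
  refine ⟨u, v, ⟨hu0, fun p q hp hq h => ?_⟩, ⟨hv0, fun p q hp hq h => ?_⟩, rfl⟩
  · subst h
    have h1 : (p ++ q) ++ v < q ++ v := hw.2 p (q ++ v) hp (by simp [hq]) (by simp)
    by_contra hcon
    have hlt : q < p ++ q := lt_of_le_of_ne (not_lt.1 hcon) (by simpa using hp)
    by_cases hpre : q <+: p ++ q
    · -- if `q` is a prefix of `p ++ q = q ++ r`, then `r ++ v` is a suffix smaller than `v`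
      obtain ⟨r, hr⟩ := hpre
      have hlen := congrArg List.length hr
      simp only [List.length_append] at hlen
      have hr0 : r ≠ [] := by
        rintro rfl
        exact hp (List.length_eq_zero_iff.1 (by rw [List.length_nil] at hlen; omega))
      rw [← hr, List.append_assoc] at h1
      have h2 : v ≤ r ++ v := hmin (r ++ v)
        ((hS _).2 ⟨by simp [hv0], q, hq, by rw [← hr, List.append_assoc]⟩)
      exact absurd h1 (not_lt.2 (List.append_le_append_left_of_le h2 q))
    · exact absurd (List.append_lt_append_of_lt_of_not_prefix hlt hpre v v) h1.not_gt
  · subst h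
    refine lt_of_le_of_ne (hmin q ((hS q).2 ⟨hq, u ++ p, by simp [hu0], by simp⟩)) ?_
    simpa using hp

/-- Every word is a concatenation of a nonincreasing sequence of Lyndon words. -/
theorem exists_nonincreasing_lyndon_factorization (w : List (Fin d)) :
    ∃ l : List (List (Fin d)), (∀ u ∈ l, IsLyndon u) ∧ l.Pairwise (· ≥ ·) ∧ l.flatten = w := by
  have key : ∀ (l : List (List (Fin d))) (u : List (Fin d)), IsLyndon u →
      (∀ v ∈ l, IsLyndon v) → l.Pairwise (· ≥ ·) →
      ∃ l' : List (List (Fin d)), (∀ v ∈ l', IsLyndon v) ∧ l'.Pairwise (· ≥ ·) ∧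
        l'.flatten = u ++ l.flatten := by
    intro l
    induction l with
    | nil => exact fun u hu _ _ => ⟨[u], by simpa using hu, by simp, by simp⟩
    | cons v l ih =>
      intro u hu hl hs
      by_cases huv : u < v
      · obtain ⟨l', h1, h2, h3⟩ := ih (u ++ v) (hu.append (hl v (by simp)) huv)
          (fun x hx => hl x (by simp [hx])) (List.pairwise_cons.1 hs).2
        exact ⟨l', h1, h2, by simpa using h3⟩
      · refine ⟨u :: v :: l, ?_, ?_, by simp⟩
        · simpa [hu] using hl
        · refine List.pairwise_cons.2 ⟨fun x hx => ?_, hs⟩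
          rcases List.mem_cons.1 hx with rfl | hx
          · exact not_lt.1 huv
          · exact ((List.pairwise_cons.1 hs).1 x hx).trans (not_lt.1 huv)
  induction w with
  | nil => exact ⟨[], by simp, by simp, rfl⟩
  | cons x w ih =>
    obtain ⟨l, h1, h2, h3⟩ := ih
    obtain ⟨l', h1, h2, h4⟩ := key l [x] (isLyndon_singleton x) h1 h2
    exact ⟨l', h1, h2, by simp [h4, h3]⟩

theorem LyndonWord.length_pos {m : ℕ} (w : LyndonWord d m) : 0 < w.length :=
  List.length_pos_iff.2 w.2.1.1

theorem LyndonWord.length_le {m : ℕ} (w : LyndonWord d m) : w.length ≤ m := w.2.2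

theorem LyndonWord.ext {m : ℕ} {u v : LyndonWord d m} (h : u.1 = v.1) : u = v := Subtype.ext h

theorem finite_weight_eq {ι : Type*} [Finite ι] {l : ι → ℕ} (hl : ∀ i, 0 < l i) (k : ℕ) :
    Finite {α : ι →₀ ℕ // Finsupp.weight l α = k} :=
  (Finsupp.finite_of_nat_weight_eq l (fun i => (hl i).ne') k).to_subtype

/-- There are at least as many multisets of Lyndon words of total length `k` as words of length
`k`. -/
theorem pow_le_card_lyndon_weight (d k : ℕ) :
    d ^ k ≤ Nat.card {α : LyndonWord d k →₀ ℕ // Finsupp.weight LyndonWord.length α = k} := by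
  classical
  have := finite_weight_eq (l := LyndonWord.length (d := d) (m := k))
    LyndonWord.length_pos k
  choose F hF1 hF2 hF3 using exists_nonincreasing_lyndon_factorization (d := d)
  have hlen : ∀ w : List (Fin d), w.length = k → ∀ u ∈ F w, IsLyndon u ∧ u.length ≤ k := by
    intro w hw u hu
    refine ⟨hF1 w u hu, ?_⟩
    rw [← hw, ← hF3 w]
    exact (List.sublist_flatten_of_mem hu).length_le
  -- the sorted factor list with its factors bundled as Lyndon words
  let G : (w : List (Fin d)) → w.length = k → List (LyndonWord d k) := fun w hw =>
    (F w).pmap (fun u hu => ⟨u, hu⟩) (hlen w hw)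
  have hG : ∀ w hw, (G w hw).map (fun u => u.1) = F w := by
    intro w hw
    exact (List.map_pmap ..).trans (by simp)
  have hGw : ∀ w hw, Finsupp.weight LyndonWord.length
      (Multiset.toFinsupp (G w hw : Multiset (LyndonWord d k))) = k := by
    intro w hw
    have h1 : ∀ L : List (LyndonWord d k), Finsupp.weight LyndonWord.length
        (Multiset.toFinsupp (L : Multiset (LyndonWord d k))) =
          ((L.map fun u => u.1).flatten).length := by
      intro L
      induction L with
      | nil => simp
      | cons u L ih =>
        rw [← Multiset.cons_coe, ← Multiset.singleton_add, map_add, map_add, ih,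
          Multiset.toFinsupp_singleton, Finsupp.weight_single]
        simp [LyndonWord.length]
    rw [h1, hG w hw, hF3, hw]
  have hcard : Nat.card (List.Vector (Fin d) k) = d ^ k := by simp
  rw [← hcard]
  refine Nat.card_le_card_of_injective
    (fun w : List.Vector (Fin d) k => (⟨_, hGw w.1 w.2⟩ :
      {α : LyndonWord d k →₀ ℕ // Finsupp.weight LyndonWord.length α = k})) ?_
  intro w w' h
  have h1 : (G w.1 w.2 : Multiset (LyndonWord d k)) = G w'.1 w'.2 :=
    Multiset.toFinsupp.injective (Subtype.ext_iff.1 h)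
  have h2 : (F w.1).Perm (F w'.1) := by
    rw [← hG w.1 w.2, ← hG w'.1 w'.2]
    exact (Multiset.coe_eq_coe.1 h1).map _
  have h3 : F w.1 = F w'.1 :=
    h2.eq_of_pairwise (fun a b _ _ hab hba => le_antisymm hba hab) (hF2 _) (hF2 _)
  exact Subtype.ext (by rw [← hF3 w.1, h3, hF3])

end Lyndon

noncomputable section

attribute [local instance] LieRing.ofAssociativeRing

/-! ### Coefficients of noncommutative polynomials -/

section Words

variable {d : ℕ}

open Classical in
/-- The words of length `k`. -/
def wordsOfLength (d k : ℕ) : Finset (FreeMonoid (Fin d)) :=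
  Finset.univ.image fun w : Fin k → Fin d => FreeMonoid.ofList (List.ofFn w)

theorem mem_wordsOfLength {k : ℕ} {w : FreeMonoid (Fin d)} :
    w ∈ wordsOfLength d k ↔ w.length = k := by
  simp only [wordsOfLength, Finset.mem_image, Finset.mem_univ, true_and]
  constructor
  · rintro ⟨f, rfl⟩
    exact List.length_ofFn
  · rintro rfl
    exact ⟨fun i => w.toList.get i, congrArg FreeMonoid.ofList (List.ofFn_get w.toList)⟩

open Classical in
/-- The ways to write a word as a product of two words. -/
def wordSplits (w : FreeMonoid (Fin d)) : Finset (FreeMonoid (Fin d) × FreeMonoid (Fin d)) :=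
  (Finset.range (w.length + 1)).image fun i =>
    (FreeMonoid.ofList (w.toList.take i), FreeMonoid.ofList (w.toList.drop i))

theorem mem_wordSplits {w : FreeMonoid (Fin d)} {p : FreeMonoid (Fin d) × FreeMonoid (Fin d)} :
    p ∈ wordSplits w ↔ p.1 * p.2 = w := by
  simp only [wordSplits, Finset.mem_image, Finset.mem_range]
  constructor
  · rintro ⟨i, -, rfl⟩
    exact congrArg FreeMonoid.ofList (List.take_append_drop i w.toList)
  · rintro rfl
    refine ⟨p.1.length, by rw [FreeMonoid.length_mul]; omega, ?_⟩
    refine Prod.ext ?_ ?_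
    · exact congrArg FreeMonoid.ofList (List.take_left (l₁ := p.1.toList) (l₂ := p.2.toList))
    · exact congrArg FreeMonoid.ofList (List.drop_left (l₁ := p.1.toList) (l₂ := p.2.toList))

theorem coeff_mul_wordSplits (x y : TensorPoly d) (w : FreeMonoid (Fin d)) :
    (x * y).coeff w = ∑ p ∈ wordSplits w, x.coeff p.1 * y.coeff p.2 :=
  MonoidAlgebra.coeff_mul_antidiag x y w _ mem_wordSplits

theorem exists_coeff_ne_zero_of_mul {x y : TensorPoly d} {w : FreeMonoid (Fin d)}
    (h : (x * y).coeff w ≠ 0) : ∃ u v, u * v = w ∧ x.coeff u ≠ 0 ∧ y.coeff v ≠ 0 := by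
  rw [coeff_mul_wordSplits] at h
  obtain ⟨p, hp, h⟩ := Finset.exists_ne_zero_of_sum_ne_zero h
  exact ⟨p.1, p.2, mem_wordSplits.1 hp, left_ne_zero_of_mul h, right_ne_zero_of_mul h⟩

/-- A noncommutative polynomial is homogeneous of order `k` if only words of length `k` occur
in it. -/
def IsTensorOfOrder (k : ℕ) (x : TensorPoly d) : Prop :=
  ∀ w : FreeMonoid (Fin d), x.coeff w ≠ 0 → w.length = k

theorem IsTensorOfOrder.mul {i j : ℕ} {x y : TensorPoly d} (hx : IsTensorOfOrder i x)
    (hy : IsTensorOfOrder j y) : IsTensorOfOrder (i + j) (x * y) := by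
  intro w hw
  obtain ⟨u, v, rfl, hu, hv⟩ := exists_coeff_ne_zero_of_mul hw
  rw [FreeMonoid.length_mul, hx u hu, hy v hv]

theorem IsTensorOfOrder.coeff_mul {x : TensorPoly d} {u : FreeMonoid (Fin d)}
    (hx : IsTensorOfOrder u.length x) (y : TensorPoly d) (v : FreeMonoid (Fin d)) :
    (x * y).coeff (u * v) = x.coeff u * y.coeff v := by
  rw [coeff_mul_wordSplits, Finset.sum_eq_single (u, v)]
  · intro p hp hne
    by_contra h
    have hl : p.1.length = u.length := hx p.1 (left_ne_zero_of_mul h)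
    have hpe : p.1.toList ++ p.2.toList = u.toList ++ v.toList := mem_wordSplits.1 hp
    obtain ⟨h3, h4⟩ := List.append_inj hpe hl
    exact hne (Prod.ext (FreeMonoid.toList.injective h3) (FreeMonoid.toList.injective h4))
  · intro h
    exact (h (mem_wordSplits (p := (u, v)).2 rfl)).elim

theorem IsTensorOfOrder.sub {i : ℕ} {x y : TensorPoly d} (hx : IsTensorOfOrder i x)
    (hy : IsTensorOfOrder i y) : IsTensorOfOrder i (x - y) := by
  intro w hw
  by_contra hcon
  have h1 : x.coeff w = 0 := not_not.1 fun h => hcon (hx w h)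
  have h2 : y.coeff w = 0 := not_not.1 fun h => hcon (hy w h)
  exact hw (by simp [h1, h2])

theorem IsTensorOfOrder.lie {i j : ℕ} {x y : TensorPoly d} (hx : IsTensorOfOrder i x)
    (hy : IsTensorOfOrder j y) : IsTensorOfOrder (i + j) ⁅x, y⁆ := by
  rw [Ring.lie_def]
  exact (hx.mul hy).sub (add_comm j i ▸ hy.mul hx)

theorem letter_mem_freeLie (i : Fin d) :
    (MonoidAlgebra.of ℝ (FreeMonoid (Fin d)) (FreeMonoid.of i) : TensorPoly d) ∈ freeLie d :=
  LieSubalgebra.subset_lieSpan ⟨i, rfl⟩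

open Classical in
theorem coeff_letter (i : Fin d) (w : FreeMonoid (Fin d)) :
    (MonoidAlgebra.of ℝ (FreeMonoid (Fin d)) (FreeMonoid.of i) : TensorPoly d).coeff w =
      if FreeMonoid.of i = w then 1 else 0 := by
  rw [MonoidAlgebra.of_apply, MonoidAlgebra.coeff_single, Finsupp.single_apply]

end Words

/-! ### Lie brackets attached to Lyndon words -/

section Bracket

variable {d : ℕ}

/-- The standard bracketing of a Lyndon word: `w` is its smallest word, by induction along the
standard factorization. -/
theorem exists_lyndonBracket (w : List (Fin d)) (hw : IsLyndon w) :
    ∃ P ∈ freeLie d, P.coeff (FreeMonoid.ofList w) = 1 ∧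
      ∀ v : FreeMonoid (Fin d), P.coeff v ≠ 0 → v.length = w.length ∧ w ≤ v.toList := by
  induction hn : w.length using Nat.strong_induction_on generalizing w with
  | _ n ih =>
  subst hn
  by_cases hl : 2 ≤ w.length
  · obtain ⟨u, v, hu, hv, rfl⟩ := hw.exists_factorization hl
    have hu0 := List.length_pos_iff.2 hu.1
    have hv0 := List.length_pos_iff.2 hv.1
    obtain ⟨P, hP, hP1, hP2⟩ := ih u.length (by rw [List.length_append]; omega) u hu rfl
    obtain ⟨Q, hQ, hQ1, hQ2⟩ := ih v.length (by rw [List.length_append]; omega) v hv rfl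
    have hPQ : ∀ x : FreeMonoid (Fin d), (P * Q).coeff x ≠ 0 →
        x.length = (u ++ v).length ∧ u ++ v ≤ x.toList := by
      intro x hx
      obtain ⟨a, b, rfl, ha, hb⟩ := exists_coeff_ne_zero_of_mul hx
      obtain ⟨h1, h2⟩ := hP2 a ha
      obtain ⟨h3, h4⟩ := hQ2 b hb
      exact ⟨by rw [FreeMonoid.length_mul, h1, h3, List.length_append],
        List.append_le_append_of_length_eq h2 h1.symm h4⟩
    have hQP : ∀ x : FreeMonoid (Fin d), (Q * P).coeff x ≠ 0 →
        x.length = (u ++ v).length ∧ u ++ v < x.toList := by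
      intro x hx
      obtain ⟨b, a, rfl, hb, ha⟩ := exists_coeff_ne_zero_of_mul hx
      obtain ⟨h1, h2⟩ := hP2 a ha
      obtain ⟨h3, h4⟩ := hQ2 b hb
      refine ⟨by rw [FreeMonoid.length_mul, h1, h3, List.length_append, add_comm], ?_⟩
      have h5 : u ++ v < v := hw.2 u v hu.1 hv.1 rfl
      refine h5.trans_le ?_
      have h6 : v ++ u ≤ b.toList ++ a.toList :=
        List.append_le_append_of_length_eq h4 h3.symm h2
      exact (by simpa using List.append_le_append_left_of_le (not_lt.1 (List.not_lt_nil u)) v :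
        v ≤ v ++ u).trans h6
    refine ⟨⁅P, Q⁆, LieSubalgebra.lie_mem _ hP hQ, ?_, fun x hx => ?_⟩
    · have h1 : (Q * P).coeff (FreeMonoid.ofList (u ++ v)) = 0 := by
        by_contra h
        exact absurd (hQP _ h).2 (lt_irrefl _)
      have h2 : (P * Q).coeff (FreeMonoid.ofList (u ++ v)) = 1 := by
        have h3 : IsTensorOfOrder (FreeMonoid.ofList u).length P := fun a ha => (hP2 a ha).1
        rw [FreeMonoid.ofList_append, h3.coeff_mul, hP1, hQ1, one_mul]
      rw [Ring.lie_def, MonoidAlgebra.coeff_sub, Finsupp.sub_apply, h1, h2, sub_zero]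
    · rw [Ring.lie_def, MonoidAlgebra.coeff_sub, Finsupp.sub_apply] at hx
      by_cases h : (P * Q).coeff x = 0
      · rw [h, zero_sub, neg_ne_zero] at hx
        exact ⟨(hQP x hx).1, (hQP x hx).2.le⟩
      · exact hPQ x h
  · have hw0 := List.length_pos_iff.2 hw.1
    obtain ⟨i, rfl⟩ := List.length_eq_one_iff.1 (by omega : w.length = 1)
    refine ⟨_, letter_mem_freeLie i, ?_, fun v hv => ?_⟩
    · rw [coeff_letter]
      exact if_pos rfl
    · rw [coeff_letter] at hv
      have : FreeMonoid.of i = v := by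
        by_contra h
        exact hv (if_neg h)
      subst this
      exact ⟨rfl, le_rfl⟩

/-- A Lie polynomial whose smallest word is the given Lyndon word, with coefficient `1`. -/
def lyndonBracket {m : ℕ} (w : LyndonWord d m) : TensorPoly d :=
  (exists_lyndonBracket w.1 w.2.1).choose

theorem lyndonBracket_mem {m : ℕ} (w : LyndonWord d m) : lyndonBracket w ∈ freeLie d :=
  (exists_lyndonBracket w.1 w.2.1).choose_spec.1

theorem coeff_lyndonBracket_self {m : ℕ} (w : LyndonWord d m) :
    (lyndonBracket w).coeff (FreeMonoid.ofList w.1) = 1 :=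
  (exists_lyndonBracket w.1 w.2.1).choose_spec.2.1

theorem le_of_coeff_lyndonBracket_ne_zero {m : ℕ} (w : LyndonWord d m) {v : FreeMonoid (Fin d)}
    (h : (lyndonBracket w).coeff v ≠ 0) : w.1 ≤ v.toList :=
  ((exists_lyndonBracket w.1 w.2.1).choose_spec.2.2 v h).2

theorem isTensorOfOrder_lyndonBracket {m : ℕ} (w : LyndonWord d m) :
    IsTensorOfOrder w.length (lyndonBracket w) := fun v h =>
  ((exists_lyndonBracket w.1 w.2.1).choose_spec.2.2 v h).1

theorem linearIndependent_lyndonBracket (d m : ℕ) :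
    LinearIndependent ℝ (lyndonBracket : LyndonWord d m → TensorPoly d) := by
  classical
  rw [Fintype.linearIndependent_iff]
  intro g hg
  by_contra! hcon
  obtain ⟨i, hi⟩ := hcon
  obtain ⟨w, hw, hmin⟩ := (Finset.univ.filter fun w => g w ≠ 0).exists_min_image
    (fun w : LyndonWord d m => w.1) ⟨i, by simpa using hi⟩
  have h := congrArg (fun x : TensorPoly d => x.coeff (FreeMonoid.ofList w.1)) hg
  simp only [MonoidAlgebra.coeff_sum, MonoidAlgebra.coeff_smul, Finsupp.coe_finsetSum,
    Finset.sum_apply, Finsupp.smul_apply, smul_eq_mul, MonoidAlgebra.coeff_zero,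
    Finsupp.coe_zero, Pi.zero_apply] at h
  rw [Finset.sum_eq_single w, coeff_lyndonBracket_self, mul_one] at h
  · exact (Finset.mem_filter.1 hw).2 h
  · intro v _ hvw
    by_contra hne
    have h1 : w.1 ≤ v.1 := hmin v (by simpa using left_ne_zero_of_mul hne)
    have h2 : v.1 ≤ w.1 := le_of_coeff_lyndonBracket_ne_zero v (right_ne_zero_of_mul hne)
    exact hvw (LyndonWord.ext (le_antisymm h2 h1))
  · simp

end Bracket

/-! ### The exponential of a Lie polynomial is group-like -/

section GroupLike

variable {d : ℕ}

/-- The algebra morphism `ℝ⟨x⟩ → ℝ⟨x⟩ ⊗ ℝ⟨x⟩` with `x_i ↦ x_i ⊗ 1 + 1 ⊗ x_i`. The tensor square is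
encoded as the algebra of the monoid of pairs of words. -/
def unshuffle (d : ℕ) :
    TensorPoly d →ₐ[ℝ] MonoidAlgebra ℝ (FreeMonoid (Fin d) × FreeMonoid (Fin d)) :=
  MonoidAlgebra.lift ℝ _ (FreeMonoid (Fin d)) (FreeMonoid.lift fun i =>
    MonoidAlgebra.single (FreeMonoid.of i, 1) 1 + MonoidAlgebra.single (1, FreeMonoid.of i) 1)

/-- The embedding `x ↦ x ⊗ 1`. -/
def tensorInl (d : ℕ) :
    TensorPoly d →ₐ[ℝ] MonoidAlgebra ℝ (FreeMonoid (Fin d) × FreeMonoid (Fin d)) :=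
  MonoidAlgebra.mapDomainAlgHom ℝ ℝ (MonoidHom.inl _ _)

/-- The embedding `x ↦ 1 ⊗ x`. -/
def tensorInr (d : ℕ) :
    TensorPoly d →ₐ[ℝ] MonoidAlgebra ℝ (FreeMonoid (Fin d) × FreeMonoid (Fin d)) :=
  MonoidAlgebra.mapDomainAlgHom ℝ ℝ (MonoidHom.inr _ _)

theorem tensorInl_single (u : FreeMonoid (Fin d)) (a : ℝ) :
    tensorInl d (MonoidAlgebra.single u a) = MonoidAlgebra.single (u, 1) a := by
  simp [tensorInl]

theorem tensorInr_single (u : FreeMonoid (Fin d)) (a : ℝ) :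
    tensorInr d (MonoidAlgebra.single u a) = MonoidAlgebra.single (1, u) a := by
  simp [tensorInr]

theorem commute_tensorInl_tensorInr (x y : TensorPoly d) :
    Commute (tensorInl d x) (tensorInr d y) := by
  induction x using MonoidAlgebra.induction_linear with
  | zero => simp
  | add x x' h h' => rw [map_add]; exact h.add_left h'
  | single u a =>
    induction y using MonoidAlgebra.induction_linear with
    | zero => simp
    | add y y' h h' => rw [map_add]; exact h.add_right h'
    | single v b =>
      rw [tensorInl_single, tensorInr_single, commute_iff_eq, MonoidAlgebra.single_mul_single,
        MonoidAlgebra.single_mul_single]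
      simp [mul_comm]

theorem coeff_tensorInl_mul_tensorInr (x y : TensorPoly d) (u v : FreeMonoid (Fin d)) :
    (tensorInl d x * tensorInr d y).coeff (u, v) = x.coeff u * y.coeff v := by
  classical
  induction x using MonoidAlgebra.induction_linear with
  | zero => simp
  | add x x' h h' => simp [add_mul, h, h']
  | single u' a =>
    induction y using MonoidAlgebra.induction_linear with
    | zero => simp
    | add y y' h h' => simp [mul_add, h, h']
    | single v' b =>
      rw [tensorInl_single, tensorInr_single, MonoidAlgebra.single_mul_single]
      simp only [Prod.mk_mul_mk, mul_one, one_mul, MonoidAlgebra.coeff_single, Finsupp.single_apply,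
        Prod.mk.injEq]
      split_ifs <;> simp_all

/-- Lie polynomials are primitive. -/
theorem unshuffle_of_mem_freeLie {L : TensorPoly d} (hL : L ∈ freeLie d) :
    unshuffle d L = tensorInl d L + tensorInr d L := by
  induction hL using LieSubalgebra.lieSpan_induction with
  | mem x hx =>
    obtain ⟨i, rfl⟩ := hx
    simp only [MonoidAlgebra.of_apply]
    rw [tensorInl_single, tensorInr_single]
    simp [unshuffle, MonoidAlgebra.lift_single]
  | zero => simp
  | add x y _ _ hx hy => simp only [map_add, hx, hy]; abel
  | smul a x _ hx => simp only [map_smul, hx, smul_add]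
  | lie x y _ _ hx hy =>
    have h1 := (commute_tensorInl_tensorInr x y).eq
    have h2 := (commute_tensorInl_tensorInr y x).eq
    simp only [Ring.lie_def, map_sub, map_mul, hx, hy, add_mul, mul_add, h1, h2]
    abel

theorem coeff_unshuffle_word_eq_zero (w u v : FreeMonoid (Fin d))
    (h : u.length + v.length ≠ w.length) :
    (unshuffle d (MonoidAlgebra.single w 1)).coeff (u, v) = 0 := by
  classical
  induction w using FreeMonoid.inductionOn' generalizing u v with
  | one =>
    rw [← MonoidAlgebra.one_def, map_one, MonoidAlgebra.one_def, MonoidAlgebra.coeff_single,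
      Finsupp.single_apply]
    refine if_neg fun he => h ?_
    obtain ⟨rfl, rfl⟩ := Prod.mk.inj he
    rfl
  | of_mul i w ih =>
    by_contra hne
    have h1 : (MonoidAlgebra.single (FreeMonoid.of i * w) 1 : TensorPoly d) =
        MonoidAlgebra.single (FreeMonoid.of i) 1 * MonoidAlgebra.single w 1 := by
      rw [MonoidAlgebra.single_mul_single, one_mul]
    have h2 : unshuffle d (MonoidAlgebra.single (FreeMonoid.of i) 1) =
        MonoidAlgebra.single (FreeMonoid.of i, 1) 1 +
          MonoidAlgebra.single (1, FreeMonoid.of i) 1 := by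
      simp [unshuffle, MonoidAlgebra.lift_single]
    rw [h1, map_mul, h2, add_mul, MonoidAlgebra.coeff_add, Finsupp.add_apply] at hne
    rw [FreeMonoid.length_mul, FreeMonoid.length_of] at h
    refine hne ?_
    rw [MonoidAlgebra.coeff_mul, MonoidAlgebra.coeff_mul,
      MonoidAlgebra.coeff_single, MonoidAlgebra.coeff_single,
      Finsupp.sum_single_index (by simp [Finsupp.sum]),
      Finsupp.sum_single_index (by simp [Finsupp.sum])]
    have h3 : ∀ p : FreeMonoid (Fin d) × FreeMonoid (Fin d), p.1.length + p.2.length = 1 →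
        ((unshuffle d (MonoidAlgebra.single w 1)).coeff.sum fun q b =>
          if p * q = (u, v) then 1 * b else 0) = 0 := by
      intro p hp
      refine Finset.sum_eq_zero fun q _ => ?_
      dsimp only
      split_ifs with he
      · obtain ⟨rfl, rfl⟩ := Prod.mk.inj he
        rw [one_mul]
        refine ih q.1 q.2 fun hq => h ?_
        rw [FreeMonoid.length_mul, FreeMonoid.length_mul]
        omega
      · rfl
    rw [h3 _ (by simp), h3 _ (by simp), add_zero]

theorem coeff_unshuffle (x : TensorPoly d) (u v : FreeMonoid (Fin d)) :
    (unshuffle d x).coeff (u, v) = ∑ w ∈ wordsOfLength d (u.length + v.length),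
      (unshuffle d (MonoidAlgebra.single w 1)).coeff (u, v) * x.coeff w := by
  classical
  induction x using MonoidAlgebra.induction_linear with
  | zero => simp
  | add x y hx hy => simp [hx, hy, mul_add, Finset.sum_add_distrib]
  | single w a =>
    have h1 : (MonoidAlgebra.single w a : TensorPoly d) = a • MonoidAlgebra.single w 1 := by simp
    have h2 : (unshuffle d (MonoidAlgebra.single w a)).coeff (u, v) =
        a * (unshuffle d (MonoidAlgebra.single w 1)).coeff (u, v) := by
      rw [h1, map_smul]; rfl
    simp only [MonoidAlgebra.coeff_single, Finsupp.single_apply, mul_ite, mul_zero]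
    rw [Finset.sum_ite_eq, h2]
    split_ifs with h
    · ring
    · rw [coeff_unshuffle_word_eq_zero, mul_zero]
      exact fun h' => h (mem_wordsOfLength.2 h'.symm)

/-- The exponential of a Lie polynomial is group-like: a product of two of its entries is a fixed
linear combination of entries of the added order. -/
theorem expEntry_mul {L : TensorPoly d} (hL : L ∈ freeLie d) (u v : FreeMonoid (Fin d)) :
    expEntry L u * expEntry L v = ∑ w ∈ wordsOfLength d (u.length + v.length),
      (unshuffle d (MonoidAlgebra.single w 1)).coeff (u, v) * expEntry L w := by
  -- the generating polynomials of the sequences `(L ^ i)_u / i!` and `(L ^ j)_v / j!`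
  let p : FreeMonoid (Fin d) → Polynomial ℝ := fun u =>
    ∑ i ∈ Finset.range (u.length + 1),
      Polynomial.monomial i (((i.factorial : ℝ))⁻¹ * (L ^ i).coeff u)
  have hL0 := coeff_one_of_mem_freeLie hL
  have hp : ∀ u i, (p u).coeff i = ((i.factorial : ℝ))⁻¹ * (L ^ i).coeff u := by
    intro u i
    simp only [p, Polynomial.finsetSum_coeff, Polynomial.coeff_monomial]
    rw [Finset.sum_ite_eq' (Finset.range (u.length + 1)) i]
    split_ifs with h
    · rfl
    · rw [coeff_pow_eq_zero L hL0 i u (by simpa using h), mul_zero]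
  have hdeg : ∀ u, (p u).natDegree ≤ u.length := fun u =>
    Polynomial.natDegree_sum_le_of_forall_le _ _ fun i hi =>
      (Polynomial.natDegree_monomial_le _).trans (Nat.lt_succ_iff.1 (Finset.mem_range.1 hi))
  have heval : ∀ u, (p u).eval 1 = expEntry L u := by
    intro u
    simp [p, expEntry, Polynomial.eval_finsetSum, Polynomial.eval_monomial]
  have h1 : ∀ n, (p u * p v).coeff n =
      ((n.factorial : ℝ))⁻¹ * (unshuffle d (L ^ n)).coeff (u, v) := by
    intro n
    rw [Polynomial.coeff_mul, map_pow, unshuffle_of_mem_freeLie hL,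
      (commute_tensorInl_tensorInr L L).add_pow']
    simp only [MonoidAlgebra.coeff_sum, MonoidAlgebra.coeff_smul, Finsupp.coe_finsetSum,
      Finset.sum_apply, Finsupp.smul_apply, Finset.mul_sum, hp, ← map_pow,
      coeff_tensorInl_mul_tensorInr]
    refine Finset.sum_congr rfl fun ij hij => ?_
    obtain rfl := Finset.HasAntidiagonal.mem_antidiagonal.1 hij
    have hc : ((ij.1 + ij.2).choose ij.1 : ℝ) * (ij.1.factorial * ij.2.factorial) =
        (ij.1 + ij.2).factorial := by
      rw [← mul_assoc]
      have := Nat.choose_mul_factorial_mul_factorial (Nat.le_add_right ij.1 ij.2)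
      rw [Nat.add_sub_cancel_left] at this
      exact_mod_cast this
    have f1 : (ij.1.factorial : ℝ) ≠ 0 := Nat.cast_ne_zero.2 (Nat.factorial_ne_zero _)
    have f2 : (ij.2.factorial : ℝ) ≠ 0 := Nat.cast_ne_zero.2 (Nat.factorial_ne_zero _)
    have f3 : ((ij.1 + ij.2).factorial : ℝ) ≠ 0 := Nat.cast_ne_zero.2 (Nat.factorial_ne_zero _)
    rw [nsmul_eq_mul]
    field_simp
    rw [← hc]
    ring
  rw [← heval u, ← heval v, ← Polynomial.eval_mul, Polynomial.eval_eq_sum_range'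
    (Nat.lt_succ_of_le (Polynomial.natDegree_mul_le.trans (add_le_add (hdeg u) (hdeg v))))]
  simp only [one_pow, mul_one, h1]
  rw [Finset.sum_congr rfl fun n _ => by rw [coeff_unshuffle, Finset.mul_sum], Finset.sum_comm]
  refine Finset.sum_congr rfl fun w hw => ?_
  rw [expEntry, mem_wordsOfLength.1 hw, Finset.mul_sum]
  refine Finset.sum_congr rfl fun n _ => ?_
  ring

end GroupLike

end

noncomputable section

attribute [local instance] LieRing.ofAssociativeRing

/-! ### The entries of the exponential as polynomials -/

section Entries

variable {d : ℕ} {ι : Type*}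

/-- The functions on `ℝ^ι` given by polynomials of weighted degree `k`. -/
def weightedFunctions (l : ι → ℕ) (k : ℕ) : Submodule ℝ ((ι → ℝ) → ℝ) :=
  (MvPolynomial.weightedHomogeneousSubmodule ℝ l k).map
    (MvPolynomial.aeval (R := ℝ) fun (i : ι) (a : ι → ℝ) => a i).toLinearMap

theorem aeval_coordinates_apply (p : MvPolynomial ι ℝ) (a : ι → ℝ) :
    MvPolynomial.aeval (R := ℝ) (fun (i : ι) (a : ι → ℝ) => a i) p a = MvPolynomial.eval a p := by
  induction p using MvPolynomial.induction_on with
  | C r => simp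
  | add p q hp hq => simp [hp, hq]
  | mul_X p i hp => simp [hp]

theorem mul_mem_weightedFunctions {l : ι → ℕ} {i j : ℕ} {f g : (ι → ℝ) → ℝ}
    (hf : f ∈ weightedFunctions l i) (hg : g ∈ weightedFunctions l j) :
    f * g ∈ weightedFunctions l (i + j) := by
  obtain ⟨p, hp, rfl⟩ := hf
  obtain ⟨q, hq, rfl⟩ := hg
  exact ⟨p * q, MvPolynomial.IsWeightedHomogeneous.mul hp hq, by simp⟩

theorem one_mem_weightedFunctions (l : ι → ℕ) : (1 : (ι → ℝ) → ℝ) ∈ weightedFunctions l 0 :=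
  ⟨1, MvPolynomial.isWeightedHomogeneous_one ℝ l, by simp⟩

theorem coordinate_mem_weightedFunctions (l : ι → ℕ) (i : ι) :
    (fun a : ι → ℝ => a i) ∈ weightedFunctions l (l i) :=
  ⟨MvPolynomial.X i, MvPolynomial.isWeightedHomogeneous_X ℝ l i, by simp⟩

/-- The linear combination `∑ aᵢ bᵢ`. -/
def lieComb [Fintype ι] (b : ι → TensorPoly d) (a : ι → ℝ) : TensorPoly d := ∑ i, a i • b i

variable [Fintype ι]

theorem lieComb_mem_freeLie {b : ι → TensorPoly d} (hb : ∀ i, b i ∈ freeLie d) (a : ι → ℝ) :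
    lieComb b a ∈ freeLie d :=
  sum_mem fun i _ => (freeLie d).smul_mem (a i) (hb i)

theorem coeff_lieComb (b : ι → TensorPoly d) (a : ι → ℝ) (w : FreeMonoid (Fin d)) :
    (lieComb b a).coeff w = ∑ i, a i * (b i).coeff w := by
  simp [lieComb, MonoidAlgebra.coeff_sum]

variable {b : ι → TensorPoly d} {l : ι → ℕ}

theorem coeff_lieComb_mem_weightedFunctions (hl : ∀ i, IsTensorOfOrder (l i) (b i))
    (w : FreeMonoid (Fin d)) :
    (fun a => (lieComb b a).coeff w) ∈ weightedFunctions l w.length := by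
  have h : (fun a => (lieComb b a).coeff w) =
      ∑ i, (b i).coeff w • fun a : ι → ℝ => a i := by
    ext a
    simp [coeff_lieComb, mul_comm]
  rw [h]
  refine sum_mem fun i _ => ?_
  by_cases h0 : (b i).coeff w = 0
  · rw [h0, zero_smul]; exact zero_mem _
  · rw [hl i w h0]
    exact Submodule.smul_mem _ _ (coordinate_mem_weightedFunctions l i)

theorem coeff_lieComb_pow_mem_weightedFunctions (hl : ∀ i, IsTensorOfOrder (l i) (b i)) (n : ℕ)
    (w : FreeMonoid (Fin d)) :
    (fun a => (lieComb b a ^ n).coeff w) ∈ weightedFunctions l w.length := by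
  classical
  induction n generalizing w with
  | zero =>
    simp only [pow_zero, MonoidAlgebra.one_def, MonoidAlgebra.coeff_single, Finsupp.single_apply]
    split_ifs with h
    · subst h; exact one_mem_weightedFunctions l
    · exact zero_mem _
  | succ n ih =>
    have h : (fun a => (lieComb b a ^ (n + 1)).coeff w) = ∑ p ∈ wordSplits w,
        (fun a => (lieComb b a ^ n).coeff p.1) * fun a => (lieComb b a).coeff p.2 := by
      ext a
      simp [pow_succ, coeff_mul_wordSplits]
    rw [h]
    refine sum_mem fun p hp => ?_
    rw [← mem_wordSplits.1 hp, FreeMonoid.length_mul]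
    exact mul_mem_weightedFunctions (ih p.1) (coeff_lieComb_mem_weightedFunctions hl p.2)

theorem expEntry_mem_weightedFunctions (hl : ∀ i, IsTensorOfOrder (l i) (b i))
    (w : FreeMonoid (Fin d)) :
    (fun a => expEntry (lieComb b a) w) ∈ weightedFunctions l w.length := by
  have h : (fun a => expEntry (lieComb b a) w) = ∑ n ∈ Finset.range (w.length + 1),
      ((n.factorial : ℝ))⁻¹ • fun a => (lieComb b a ^ n).coeff w := by
    ext a
    simp [expEntry]
  rw [h]
  exact sum_mem fun n _ =>
    Submodule.smul_mem _ _ (coeff_lieComb_pow_mem_weightedFunctions hl n w)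

/-- The span of the order `k` entries of `exp(∑ aᵢ bᵢ)`, as functions of `a`. -/
def entrySpan (b : ι → TensorPoly d) (k : ℕ) : Submodule ℝ ((ι → ℝ) → ℝ) :=
  Submodule.span ℝ ((fun w a => expEntry (lieComb b a) w) ''
    {w : FreeMonoid (Fin d) | w.length = k})

theorem expEntry_mem_entrySpan (b : ι → TensorPoly d) (w : FreeMonoid (Fin d)) :
    (fun a => expEntry (lieComb b a) w) ∈ entrySpan b w.length :=
  Submodule.subset_span ⟨w, rfl, rfl⟩

theorem mul_mem_entrySpan (hb : ∀ i, b i ∈ freeLie d) {i j : ℕ} {f g : (ι → ℝ) → ℝ}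
    (hf : f ∈ entrySpan b i) (hg : g ∈ entrySpan b j) : f * g ∈ entrySpan b (i + j) := by
  have h := Submodule.mul_mem_mul hf hg
  rw [entrySpan, entrySpan, Submodule.span_mul_span] at h
  refine Submodule.span_le.2 ?_ h
  rintro _ ⟨_, ⟨u, rfl, rfl⟩, _, ⟨v, rfl, rfl⟩, rfl⟩
  have h : ((fun a => expEntry (lieComb b a) u) * fun a => expEntry (lieComb b a) v) =
      ∑ w ∈ wordsOfLength d (u.length + v.length),
        (unshuffle d (MonoidAlgebra.single w 1)).coeff (u, v) •
          fun a => expEntry (lieComb b a) w := by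
    ext a
    simp [expEntry_mul (lieComb_mem_freeLie hb a)]
  change _ * _ ∈ _
  rw [h]
  refine sum_mem fun w hw => Submodule.smul_mem _ _ ?_
  rw [← mem_wordsOfLength.1 hw]
  exact expEntry_mem_entrySpan b w

theorem one_mem_entrySpan (b : ι → TensorPoly d) : (1 : (ι → ℝ) → ℝ) ∈ entrySpan b 0 := by
  have h : (1 : (ι → ℝ) → ℝ) = fun a => expEntry (lieComb b a) 1 := by
    ext a
    simp [expEntry]
  rw [h]
  exact expEntry_mem_entrySpan b 1

/-- The linear part of an entry of the exponential: the rest is a sum of products of entries of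
smaller order. -/
theorem coeff_lieComb_mem_entrySpan (hb : ∀ i, b i ∈ freeLie d)
    (hl : ∀ i, IsTensorOfOrder (l i) (b i)) (v : FreeMonoid (Fin d))
    (ih : ∀ j < v.length, weightedFunctions l j ≤ entrySpan b j) :
    (fun a => (lieComb b a).coeff v) ∈ entrySpan b v.length := by
  classical
  have hL0 : ∀ a, (lieComb b a).coeff 1 = 0 := fun a =>
    coeff_one_of_mem_freeLie (lieComb_mem_freeLie hb a)
  by_cases hv : v = 1
  · subst hv
    rw [show (fun a => (lieComb b a).coeff 1) = 0 from funext hL0]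
    exact zero_mem _
  have hvl : 0 < v.length := Nat.pos_of_ne_zero fun h => hv (FreeMonoid.length_eq_zero.1 h)
  have h : (fun a => (lieComb b a).coeff v) = (fun a => expEntry (lieComb b a) v) -
      ∑ n ∈ (Finset.range (v.length + 1)).erase 1,
        ((n.factorial : ℝ))⁻¹ • fun a => (lieComb b a ^ n).coeff v := by
    ext a
    have h1 : 1 ∈ Finset.range (v.length + 1) := by simpa using hvl
    simp [expEntry, ← Finset.add_sum_erase _ _ h1]
  rw [h]
  refine sub_mem (expEntry_mem_entrySpan b v) (sum_mem fun n hn => Submodule.smul_mem _ _ ?_)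
  match n, hn with
  | 0, _ =>
    have h0 : (fun a => (lieComb b a ^ 0).coeff v) = 0 := by
      ext a
      simp [MonoidAlgebra.one_def, MonoidAlgebra.coeff_single, Ne.symm hv]
    rw [h0]
    exact zero_mem _
  | 1, hn => exact absurd hn (Finset.notMem_erase _ _)
  | n + 2, _ =>
    have h : (fun a => (lieComb b a ^ (n + 2)).coeff v) = ∑ p ∈ wordSplits v,
        (fun a => (lieComb b a ^ (n + 1)).coeff p.1) * fun a => (lieComb b a).coeff p.2 := by
      ext a
      simp [pow_succ _ (n + 1), coeff_mul_wordSplits]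
    rw [h]
    refine sum_mem fun p hp => ?_
    have hlen : p.1.length + p.2.length = v.length := by
      rw [← FreeMonoid.length_mul, mem_wordSplits.1 hp]
    by_cases h1 : p.1.length = 0
    · have : (fun a => (lieComb b a ^ (n + 1)).coeff p.1) = 0 := by
        ext a
        exact coeff_pow_eq_zero _ (hL0 a) _ _ (by omega)
      rw [this, zero_mul]
      exact zero_mem _
    by_cases h2 : p.2.length = 0
    · have : (fun a => (lieComb b a).coeff p.2) = 0 := by
        ext a
        rw [FreeMonoid.length_eq_zero.1 h2]
        exact hL0 a
      rw [this, mul_zero]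
      exact zero_mem _
    rw [← hlen]
    exact mul_mem_entrySpan hb
      (ih _ (by omega) (coeff_lieComb_pow_mem_weightedFunctions hl _ _))
      (ih _ (by omega) (coeff_lieComb_mem_weightedFunctions hl _))

/-- A coordinate is a linear combination of the linear parts of the entries. -/
theorem coordinate_mem_entrySpan (hb : ∀ i, b i ∈ freeLie d)
    (hl : ∀ i, IsTensorOfOrder (l i) (b i)) (hind : LinearIndependent ℝ b) (i : ι)
    (ih : ∀ j < l i, weightedFunctions l j ≤ entrySpan b j) :
    (fun a : ι → ℝ => a i) ∈ entrySpan b (l i) := by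
  classical
  -- a linear form that is dual to `b i`
  obtain ⟨f, hf⟩ := LinearMap.exists_extend (Finsupp.lapply (R := ℝ) i ∘ₗ hind.repr)
  have hfb : ∀ j, f (b j) = if j = i then 1 else 0 := by
    intro j
    have h1 := LinearMap.congr_fun hf ⟨b j, Submodule.subset_span ⟨j, rfl⟩⟩
    simp only [LinearMap.comp_apply, Submodule.subtype_apply] at h1
    rw [h1]
    change hind.repr _ i = _
    rw [hind.repr_eq_single j _ rfl, Finsupp.single_apply]
  -- the form is applied to the component of order `l i`
  have h : (fun a : ι → ℝ => a i) = ∑ v ∈ wordsOfLength d (l i),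
      f (MonoidAlgebra.single v 1) • fun a => (lieComb b a).coeff v := by
    have h2 : ∀ j, ∑ v ∈ wordsOfLength d (l i), (b j).coeff v * f (MonoidAlgebra.single v 1) =
        if j = i then 1 else 0 := by
      intro j
      by_cases hj : l j = l i
      · rw [← hfb j]
        conv_rhs => rw [← MonoidAlgebra.sum_coeff_single (b j)]
        rw [Finsupp.sum, map_sum]
        refine (Finset.sum_subset_zero_on_sdiff (fun v hv => ?_) (fun v hv => ?_)
          fun v hv => ?_).symm
        · exact mem_wordsOfLength.2 (hj ▸ hl j v (Finsupp.mem_support_iff.1 hv))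
        · rw [Finsupp.notMem_support_iff.1 (Finset.mem_sdiff.1 hv).2, zero_mul]
        · rw [← smul_eq_mul, ← map_smul, MonoidAlgebra.smul_single, smul_eq_mul, mul_one]
      · rw [if_neg (by rintro rfl; exact hj rfl)]
        refine Finset.sum_eq_zero fun v hv => ?_
        rw [not_not.1 fun h0 => hj ((hl j v h0).symm.trans (mem_wordsOfLength.1 hv)), zero_mul]
    ext a
    simp only [Finset.sum_apply, Pi.smul_apply, smul_eq_mul, coeff_lieComb, Finset.mul_sum]
    rw [Finset.sum_comm]
    have h3 : ∀ j, ∑ v ∈ wordsOfLength d (l i),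
        f (MonoidAlgebra.single v 1) * (a j * (b j).coeff v) = a j * if j = i then 1 else 0 := by
      intro j
      rw [← h2 j, Finset.mul_sum]
      exact Finset.sum_congr rfl fun v _ => by ring
    simp [h3]
  rw [h]
  refine sum_mem fun v hv => Submodule.smul_mem _ _ ?_
  rw [← mem_wordsOfLength.1 hv] at ih ⊢
  exact coeff_lieComb_mem_entrySpan hb hl v ih

/-- The order `k` entries of `exp(∑ aᵢ bᵢ)` span the polynomial functions of weighted degree `k`. -/
theorem weightedFunctions_le_entrySpan (hb : ∀ i, b i ∈ freeLie d)
    (hl : ∀ i, IsTensorOfOrder (l i) (b i)) (hpos : ∀ i, 0 < l i)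
    (hind : LinearIndependent ℝ b) (k : ℕ) : weightedFunctions l k ≤ entrySpan b k := by
  classical
  induction k using Nat.strong_induction_on with
  | _ k ih =>
  have key : ∀ α : ι →₀ ℕ, Finsupp.weight l α = k →
      MvPolynomial.aeval (R := ℝ) (fun (i : ι) (a : ι → ℝ) => a i)
        (MvPolynomial.monomial α (1 : ℝ)) ∈ entrySpan b k := by
    intro α hα
    by_cases h0 : α = 0
    · subst h0
      obtain rfl : 0 = k := by simpa using hα
      simpa using one_mem_entrySpan b
    · obtain ⟨i, hi⟩ := Finsupp.ne_iff.1 h0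
      have h1 := Finsupp.weight_sub_single_add (w := l) hi
      have hα' : α = Finsupp.single i 1 + (α - Finsupp.single i 1) := by
        rw [add_tsub_cancel_of_le]
        exact Finsupp.single_le_iff.2 (Nat.one_le_iff_ne_zero.2 hi)
      set β := α - Finsupp.single i 1 with hβ
      have hmono : MvPolynomial.aeval (R := ℝ) (fun (i : ι) (a : ι → ℝ) => a i)
          (MvPolynomial.monomial α (1 : ℝ)) = (fun a : ι → ℝ => a i) *
            MvPolynomial.aeval (R := ℝ) (fun (i : ι) (a : ι → ℝ) => a i)
              (MvPolynomial.monomial β (1 : ℝ)) := by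
        rw [hα', ← one_mul (1 : ℝ), ← MvPolynomial.monomial_mul, map_mul, one_mul]
        congr 1
        exact MvPolynomial.aeval_X _ i
      have hX : (fun a : ι → ℝ => a i) ∈ entrySpan b (l i) :=
        coordinate_mem_entrySpan hb hl hind i fun j hj => ih j (by omega)
      have hβE : MvPolynomial.aeval (R := ℝ) (fun (i : ι) (a : ι → ℝ) => a i)
          (MvPolynomial.monomial β (1 : ℝ)) ∈ entrySpan b (Finsupp.weight l β) :=
        ih _ (by have := hpos i; omega)
          ⟨_, MvPolynomial.isWeightedHomogeneous_monomial l β 1 rfl, rfl⟩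
      rw [hmono, ← hα, ← h1, add_comm]
      exact mul_mem_entrySpan hb hX hβE
  rintro _ ⟨p, hp, rfl⟩
  rw [AlgHom.toLinearMap_apply, p.as_sum, map_sum]
  refine sum_mem fun α hα => ?_
  have h1 : Finsupp.weight l α = k := hp (MvPolynomial.mem_support_iff.1 hα)
  rw [← mul_one (p.coeff α), ← smul_eq_mul, ← MvPolynomial.smul_monomial, map_smul]
  exact Submodule.smul_mem _ _ (key α h1)

theorem entrySpan_eq_weightedFunctions (hb : ∀ i, b i ∈ freeLie d)
    (hl : ∀ i, IsTensorOfOrder (l i) (b i)) (hpos : ∀ i, 0 < l i)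
    (hind : LinearIndependent ℝ b) (k : ℕ) : entrySpan b k = weightedFunctions l k := by
  refine le_antisymm (Submodule.span_le.2 ?_) (weightedFunctions_le_entrySpan hb hl hpos hind k)
  rintro _ ⟨w, rfl, rfl⟩
  exact expEntry_mem_weightedFunctions hl w

theorem aeval_coordinates_injective (ι : Type*) : Function.Injective
    (MvPolynomial.aeval (R := ℝ) fun (i : ι) (a : ι → ℝ) => a i) := by
  intro p q h
  refine MvPolynomial.funext fun a => ?_
  rw [← aeval_coordinates_apply, h, aeval_coordinates_apply]

/-- The monomials of weighted degree `k` are independent and lie in the span of the `d ^ k` entries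
of order `k`. -/
theorem card_weight_le_pow (hb : ∀ i, b i ∈ freeLie d)
    (hl : ∀ i, IsTensorOfOrder (l i) (b i)) (hpos : ∀ i, 0 < l i)
    (hind : LinearIndependent ℝ b) (k : ℕ) :
    Nat.card {α : ι →₀ ℕ // Finsupp.weight l α = k} ≤ d ^ k := by
  classical
  have := finite_weight_eq hpos k
  have := Fintype.ofFinite {α : ι →₀ ℕ // Finsupp.weight l α = k}
  have hspan : entrySpan b k = Submodule.span ℝ
      (((wordsOfLength d k).image fun w a => expEntry (lieComb b a) w : Finset _) :
        Set ((ι → ℝ) → ℝ)) := by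
    rw [entrySpan, Finset.coe_image]
    congr 2
    ext w
    exact mem_wordsOfLength.symm
  have hfin : FiniteDimensional ℝ (entrySpan b k) := by
    rw [hspan]; infer_instance
  have hcard : Module.finrank ℝ (entrySpan b k) ≤ d ^ k := by
    rw [hspan]
    refine (finrank_span_finset_le_card _).trans (Finset.card_image_le.trans ?_)
    refine Finset.card_image_le.trans ?_
    simp
  have hli : LinearIndependent ℝ
      (fun α : {α : ι →₀ ℕ // Finsupp.weight l α = k} =>
        (⟨MvPolynomial.aeval (R := ℝ) (fun (i : ι) (a : ι → ℝ) => a i)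
          (MvPolynomial.monomial α.1 (1 : ℝ)), weightedFunctions_le_entrySpan hb hl hpos hind k
            ⟨_, MvPolynomial.isWeightedHomogeneous_monomial l α.1 1 α.2, rfl⟩⟩ :
          entrySpan b k)) := by
    refine LinearIndependent.of_comp (entrySpan b k).subtype ?_
    have h1 : LinearIndependent ℝ (fun α : {α : ι →₀ ℕ // Finsupp.weight l α = k} =>
        MvPolynomial.monomial α.1 (1 : ℝ)) := by
      have := (MvPolynomial.basisMonomials ι ℝ).linearIndependent.comp
        (fun α : {α : ι →₀ ℕ // Finsupp.weight l α = k} => α.1) Subtype.val_injective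
      simpa [Function.comp_def] using this
    exact h1.map' (MvPolynomial.aeval (R := ℝ) fun (i : ι) (a : ι → ℝ) => a i).toLinearMap
      (LinearMap.ker_eq_bot.2 (aeval_coordinates_injective ι))
  rw [Nat.card_eq_fintype_card]
  exact hli.fintype_card_le_finrank.trans hcard

end Entries

/-! ### The brackets of Lyndon words form a basis of the free Lie algebra -/

section LieBasis

variable {d : ℕ}

/-- If a Lie polynomial of order `k` were independent of the brackets, then the entries of order `k`
of the exponential would span too many functions. -/
theorem mem_span_lyndonBracket_of_isTensorOfOrder {k : ℕ} {x : TensorPoly d} (hx : x ∈ freeLie d)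
    (hk : IsTensorOfOrder k x) :
    x ∈ Submodule.span ℝ (Set.range (lyndonBracket : LyndonWord d k → TensorPoly d)) := by
  classical
  rcases Nat.eq_zero_or_pos k with rfl | hk0
  · have : x = 0 := by
      ext w
      by_contra h
      refine h ?_
      rw [FreeMonoid.length_eq_zero.1 (hk w h)]
      exact coeff_one_of_mem_freeLie hx
    rw [this]
    exact zero_mem _
  by_contra hcon
  let b : Option (LyndonWord d k) → TensorPoly d := fun o => o.elim x lyndonBracket
  let l : Option (LyndonWord d k) → ℕ := fun o => o.elim k LyndonWord.length
  have hpos : ∀ o, 0 < l o := by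
    rintro (_ | w)
    · exact hk0
    · exact w.length_pos
  have hind : LinearIndependent ℝ b :=
    linearIndependent_option.2 ⟨linearIndependent_lyndonBracket d k, hcon⟩
  have h1 := card_weight_le_pow (b := b) (l := l)
    (by rintro (_ | w); exacts [hx, lyndonBracket_mem w])
    (by rintro (_ | w); exacts [hk, isTensorOfOrder_lyndonBracket w]) hpos hind k
  have h2 := pow_le_card_lyndon_weight d k
  have := finite_weight_eq hpos k
  have := finite_weight_eq (l := LyndonWord.length (d := d) (m := k)) LyndonWord.length_pos k
  let F : Option {α : LyndonWord d k →₀ ℕ // Finsupp.weight LyndonWord.length α = k} →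
      {α : Option (LyndonWord d k) →₀ ℕ // Finsupp.weight l α = k} := fun o => o.elim
    ⟨Finsupp.single none 1, by simp [Finsupp.weight_single, l]⟩
    fun α => ⟨α.1.mapDomain some, by
      refine Eq.trans ?_ α.2
      rw [Finsupp.weight_apply, Finsupp.weight_apply, Finsupp.sum_mapDomain_index]
      · rfl
      · simp
      · intros; simp [add_mul]⟩
  have hF : Function.Injective F := by
    have hne : ∀ α : LyndonWord d k →₀ ℕ,
        Finsupp.single none 1 ≠ α.mapDomain (some : LyndonWord d k → _) := by
      intro α h
      have := DFunLike.congr_fun h none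
      rw [Finsupp.mapDomain_of_notMem_range _ _ (by simp)] at this
      simp at this
    rintro (_ | α) (_ | β) h
    · rfl
    · exact absurd (Subtype.ext_iff.1 h) (hne _)
    · exact absurd (Subtype.ext_iff.1 h).symm (hne _)
    · exact congrArg some (Subtype.ext
        (Finsupp.mapDomain_injective (Option.some_injective _) (Subtype.ext_iff.1 h)))
  have h3 := Nat.card_le_card_of_injective F hF
  rw [Finite.card_option] at h3
  omega

theorem freeLie_le_span_homogeneous {x : TensorPoly d} (hx : x ∈ freeLie d) :
    x ∈ Submodule.span ℝ {y : TensorPoly d | y ∈ freeLie d ∧ ∃ k, IsTensorOfOrder k y} := by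
  classical
  induction hx using LieSubalgebra.lieSpan_induction with
  | mem x hx =>
    obtain ⟨i, rfl⟩ := hx
    refine Submodule.subset_span ⟨letter_mem_freeLie i, 1, fun w hw => ?_⟩
    rw [coeff_letter] at hw
    split_ifs at hw with h
    · rw [← h]; rfl
    · exact absurd rfl hw
  | zero => exact zero_mem _
  | add x y _ _ hx hy => exact add_mem hx hy
  | smul a x _ hx => exact Submodule.smul_mem _ a hx
  | lie x y hx' hy' hx hy =>
    clear hx' hy'
    induction hx using Submodule.span_induction with
    | mem x hx =>
      induction hy using Submodule.span_induction with
      | mem y hy =>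
        obtain ⟨hx, i, hi⟩ := hx
        obtain ⟨hy, j, hj⟩ := hy
        exact Submodule.subset_span ⟨LieSubalgebra.lie_mem _ hx hy, i + j, hi.lie hj⟩
      | zero => rw [lie_zero]; exact zero_mem _
      | add y y' _ _ h h' => rw [lie_add]; exact add_mem h h'
      | smul a y _ h => rw [lie_smul]; exact Submodule.smul_mem _ a h
    | zero => rw [zero_lie]; exact zero_mem _
    | add x x' _ _ h h' => rw [add_lie]; exact add_mem h h'
    | smul a x _ h => rw [smul_lie]; exact Submodule.smul_mem _ a h

/-- The Lyndon brackets of order at most `m` give linear coordinates on `Lie^m(ℝ^d)`. -/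
theorem mem_truncatedLie_iff {m : ℕ} {L : TensorPoly d} :
    L ∈ truncatedLie d m ↔
      ∃ a : LyndonWord d m → ℝ, L = lieComb lyndonBracket a := by
  classical
  constructor
  · rintro ⟨hL, hLm⟩
    -- a combination of brackets with the same components of order at most `m`
    have key : ∃ y ∈ Submodule.span ℝ (Set.range (lyndonBracket : LyndonWord d m → TensorPoly d)),
        (∀ w : FreeMonoid (Fin d), w.length ≤ m → y.coeff w = L.coeff w) ∧
        ∀ w : FreeMonoid (Fin d), m < w.length → y.coeff w = 0 := by
      have h := freeLie_le_span_homogeneous hL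
      clear hLm hL
      induction h using Submodule.span_induction with
      | mem x hx =>
        obtain ⟨hx, k, hk⟩ := hx
        by_cases hkm : k ≤ m
        · refine ⟨x, ?_, fun _ _ => rfl, fun w hw => ?_⟩
          · refine Submodule.span_mono ?_ (mem_span_lyndonBracket_of_isTensorOfOrder hx hk)
            rintro _ ⟨w, rfl⟩
            exact ⟨⟨w.1, w.2.1, w.2.2.trans hkm⟩, rfl⟩
          · by_contra h
            have := hk w h
            omega
        · refine ⟨0, zero_mem _, fun w hw => ?_, fun _ _ => rfl⟩
          by_contra h
          have := hk w (Ne.symm h)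
          omega
      | zero => exact ⟨0, zero_mem _, fun _ _ => rfl, fun _ _ => rfl⟩
      | add x x' _ _ h h' =>
        obtain ⟨y, h1, h2, h3⟩ := h
        obtain ⟨y', h1', h2', h3'⟩ := h'
        exact ⟨y + y', add_mem h1 h1', fun w hw => by simp [h2 w hw, h2' w hw],
          fun w hw => by simp [h3 w hw, h3' w hw]⟩
      | smul a x _ h =>
        obtain ⟨y, h1, h2, h3⟩ := h
        exact ⟨a • y, Submodule.smul_mem _ a h1, fun w hw => by simp [h2 w hw],
          fun w hw => by simp [h3 w hw]⟩
    obtain ⟨y, hy, h1, h2⟩ := key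
    obtain ⟨a, ha⟩ := (Submodule.mem_span_range_iff_exists_fun ℝ).1 hy
    refine ⟨a, ?_⟩
    rw [lieComb, ha]
    ext w
    rcases le_or_gt w.length m with h | h
    · exact (h1 w h).symm
    · rw [hLm w h, h2 w h]
  · rintro ⟨a, rfl⟩
    refine ⟨lieComb_mem_freeLie lyndonBracket_mem a, fun w hw => ?_⟩
    rw [coeff_lieComb]
    refine Finset.sum_eq_zero fun v _ => ?_
    by_contra h
    have h1 := isTensorOfOrder_lyndonBracket v w (right_ne_zero_of_mul h)
    have h2 := v.length_le
    omega

end LieBasis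

end

noncomputable section

/-! ### The Zariski topology and Hilbert functions -/

section Zariski

variable {κ : Type*}

theorem eval_smul_of_isHomogeneous {f : MvPolynomial κ ℂ} {t : ℕ} (hf : f.IsHomogeneous t) (c : ℂ)
    (v : κ → ℂ) : MvPolynomial.eval (c • v) f = c ^ t * MvPolynomial.eval v f := by
  rw [MvPolynomial.eval_eq, MvPolynomial.eval_eq, Finset.mul_sum]
  refine Finset.sum_congr rfl fun e he => ?_
  simp only [Pi.smul_apply, smul_eq_mul, mul_pow, Finset.prod_mul_distrib,
    Finset.prod_pow_eq_pow_sum]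
  rw [show ∑ i ∈ e.support, e i = t from (hf.degree_eq_sum_deg_support he).symm]
  ring

theorem eval_rep_mk_eq_zero_iff {f : MvPolynomial κ ℂ} {t : ℕ} (hf : f.IsHomogeneous t)
    (v : κ → ℂ) (hv : v ≠ 0) :
    MvPolynomial.eval (Projectivization.mk ℂ v hv).rep f = 0 ↔ MvPolynomial.eval v f = 0 := by
  obtain ⟨a, ha⟩ := Projectivization.exists_smul_eq_mk_rep ℂ v hv
  rw [← ha, Units.smul_def, eval_smul_of_isHomogeneous hf]
  simp

theorem isOpen_projBasicOpen {f : MvPolynomial κ ℂ} {t : ℕ} (hf : f.IsHomogeneous t) :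
    IsOpen (projBasicOpen f) :=
  TopologicalSpace.isOpen_generateFrom_of_mem ⟨f, t, hf, rfl⟩

theorem isClosed_eval_rep_eq_zero {f : MvPolynomial κ ℂ} {t : ℕ} (hf : f.IsHomogeneous t) :
    IsClosed {p : ℙ ℂ (κ → ℂ) | MvPolynomial.eval p.rep f = 0} :=
  ⟨by convert isOpen_projBasicOpen hf using 1; ext p; simp [projBasicOpen]⟩

theorem exists_form_of_mem_isOpen {U : Set (ℙ ℂ (κ → ℂ))} (hU : IsOpen U) {p : ℙ ℂ (κ → ℂ)}
    (hp : p ∈ U) : ∃ (f : MvPolynomial κ ℂ) (t : ℕ), f.IsHomogeneous t ∧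
      MvPolynomial.eval p.rep f ≠ 0 ∧ ∀ q, MvPolynomial.eval q.rep f ≠ 0 → q ∈ U := by
  induction hU generalizing p with
  | basic U hU =>
    obtain ⟨f, t, hf, rfl⟩ := hU
    exact ⟨f, t, hf, hp, fun q hq => hq⟩
  | univ => exact ⟨1, 0, MvPolynomial.isHomogeneous_one _ _, by simp, fun _ _ => trivial⟩
  | inter U V _ _ hU hV =>
    obtain ⟨f, t, hf, hfp, hfU⟩ := hU hp.1
    obtain ⟨g, s, hg, hgp, hgV⟩ := hV hp.2
    refine ⟨f * g, t + s, hf.mul hg, by simp [hfp, hgp], fun q hq => ?_⟩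
    rw [map_mul] at hq
    exact ⟨hfU q (left_ne_zero_of_mul hq), hgV q (right_ne_zero_of_mul hq)⟩
  | sUnion S _ ih =>
    obtain ⟨U, hU, hpU⟩ := hp
    obtain ⟨f, t, hf, hfp, hfU⟩ := ih U hU hpU
    exact ⟨f, t, hf, hfp, fun q hq => ⟨U, hU, hfU q hq⟩⟩

theorem exists_form_of_notMem_isClosed {Z : Set (ℙ ℂ (κ → ℂ))} (hZ : IsClosed Z)
    {p : ℙ ℂ (κ → ℂ)} (hp : p ∉ Z) : ∃ (f : MvPolynomial κ ℂ) (t : ℕ), f.IsHomogeneous t ∧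
      MvPolynomial.eval p.rep f ≠ 0 ∧ ∀ q ∈ Z, MvPolynomial.eval q.rep f = 0 := by
  obtain ⟨f, t, hf, hfp, hfU⟩ := exists_form_of_mem_isOpen hZ.isOpen_compl hp
  exact ⟨f, t, hf, hfp, fun q hq => not_not.1 fun h => hfU q h hq⟩

theorem vanishingForms_closure (X : Set (ℙ ℂ (κ → ℂ))) (t : ℕ) :
    vanishingForms (closure X) t = vanishingForms X t := by
  ext f
  refine ⟨fun h p hp => h p (subset_closure hp), fun h => ?_⟩
  exact (closure_minimal h (isClosed_eval_rep_eq_zero f.2) :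
    closure X ⊆ {p | MvPolynomial.eval p.rep (f : MvPolynomial κ ℂ) = 0})

theorem hilbertFunction_closure (X : Set (ℙ ℂ (κ → ℂ))) (t : ℕ) :
    hilbertFunction (closure X) t = hilbertFunction X t := by
  rw [hilbertFunction, hilbertFunction, vanishingForms_closure]

theorem hilbertFunction_eq_finrank_range {X : Set (ℙ ℂ (κ → ℂ))} {t : ℕ} {V : Type*}
    [AddCommGroup V] [Module ℂ V] (T : MvPolynomial.homogeneousSubmodule κ ℂ t →ₗ[ℂ] V)
    (hT : LinearMap.ker T = vanishingForms X t) :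
    hilbertFunction X t = Module.finrank ℂ (LinearMap.range T) := by
  rw [hilbertFunction, ← hT]
  exact T.quotKerEquivRange.finrank_eq

/-- The evaluation of forms of degree `t` at chosen representatives of the points of `X`. -/
def evalForms (X : Set (ℙ ℂ (κ → ℂ))) (t : ℕ) :
    MvPolynomial.homogeneousSubmodule κ ℂ t →ₗ[ℂ] (X → ℂ) where
  toFun f p := MvPolynomial.eval p.1.rep f.1
  map_add' f g := by ext p; simp
  map_smul' c f := by ext p; simp [MvPolynomial.smul_eval]

theorem ker_evalForms (X : Set (ℙ ℂ (κ → ℂ))) (t : ℕ) :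
    LinearMap.ker (evalForms X t) = vanishingForms X t := by
  ext f
  rw [LinearMap.mem_ker]
  exact ⟨fun h p hp => congrFun h ⟨p, hp⟩, fun h => funext fun p => h p.1 p.2⟩

theorem hilbertFunction_eq (X : Set (ℙ ℂ (κ → ℂ))) (t : ℕ) :
    hilbertFunction X t = Module.finrank ℂ (LinearMap.range (evalForms X t)) :=
  hilbertFunction_eq_finrank_range _ (ker_evalForms X t)

variable [Finite κ]

instance finite_homogeneousSubmodule (t : ℕ) :
    Module.Finite ℂ (MvPolynomial.homogeneousSubmodule κ ℂ t) :=
  Module.Finite.iff_fg.2 (MvPolynomial.homogeneousSubmodule_fg κ ℂ t)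

theorem hilbertFunction_mono {X Y : Set (ℙ ℂ (κ → ℂ))} (h : X ⊆ Y) (t : ℕ) :
    hilbertFunction X t ≤ hilbertFunction Y t :=
  LinearMap.finrank_le_finrank_of_surjective
    (f := Submodule.factor (fun _ hf p hp => hf p (h hp) : vanishingForms Y t ≤ vanishingForms X t))
    (Submodule.factor_surjective _)

/-- A form of degree `e` that vanishes on `Z` but not on an irreducible set `Y ⊇ Z` is a nonzero
divisor on the coordinate ring of `Y`, and kills the coordinate ring of `Z`. -/
theorem hilbertFunction_add_le {Y Z : Set (ℙ ℂ (κ → ℂ))} (hZY : Z ⊆ Y) (hY : IsPreirreducible Y)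
    {f : MvPolynomial κ ℂ} {e : ℕ} (hf : f.IsHomogeneous e)
    (hfZ : ∀ p ∈ Z, MvPolynomial.eval p.rep f = 0)
    (hfY : ∃ p ∈ Y, MvPolynomial.eval p.rep f ≠ 0) (t : ℕ) :
    hilbertFunction Y t + hilbertFunction Z (t + e) ≤ hilbertFunction Y (t + e) := by
  simp only [hilbertFunction_eq]
  let res : (Y → ℂ) →ₗ[ℂ] (Z → ℂ) := LinearMap.funLeft ℂ ℂ (Set.inclusion hZY)
  let g := res.domRestrict (LinearMap.range (evalForms Y (t + e)))
  have hg : LinearMap.range g = LinearMap.range (evalForms Z (t + e)) := by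
    ext v
    constructor
    · rintro ⟨⟨_, q, rfl⟩, rfl⟩
      exact ⟨q, rfl⟩
    · rintro ⟨q, rfl⟩
      exact ⟨⟨_, q, rfl⟩, rfl⟩
  have hmem : ∀ v : LinearMap.range (evalForms Y t),
      (fun p : Y => MvPolynomial.eval p.1.rep f) * v.1 ∈
        LinearMap.range (evalForms Y (t + e)) := by
    rintro ⟨_, q, rfl⟩
    refine ⟨⟨f * q.1, by rw [add_comm]; exact hf.mul q.2⟩, ?_⟩
    ext p
    simp [evalForms]
  let μ : LinearMap.range (evalForms Y t) →ₗ[ℂ] LinearMap.ker g :=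
    { toFun := fun v => ⟨⟨_, hmem v⟩, by
        rw [LinearMap.mem_ker]
        ext p
        simp [g, res, LinearMap.funLeft, hfZ p.1 p.2]⟩
      map_add' := fun v w => by ext; simp [mul_add]
      map_smul' := fun c v => by ext; simp [mul_left_comm] }
  have hμ : Function.Injective μ := by
    refine (injective_iff_map_eq_zero μ).2 ?_
    rintro ⟨_, q, rfl⟩ h
    have h1 : ∀ p : Y, MvPolynomial.eval p.1.rep f * MvPolynomial.eval p.1.rep q.1 = 0 :=
      fun p => congrFun (congrArg (fun x => x.1.1) h) p
    ext p
    by_contra hp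
    obtain ⟨x, hxY, hx⟩ := hfY
    obtain ⟨y, hy, hy1, hy2⟩ := hY _ _ (isOpen_projBasicOpen hf) (isOpen_projBasicOpen q.2)
      ⟨x, hxY, hx⟩ ⟨p.1, p.2, hp⟩
    exact mul_ne_zero hy1 hy2 (h1 ⟨y, hy⟩)
  have h1 := LinearMap.finrank_range_add_finrank_ker g
  have h2 := LinearMap.finrank_le_finrank_of_injective hμ
  rw [hg] at h1
  omega

theorem hilbertFunction_zero_pos {Z : Set (ℙ ℂ (κ → ℂ))} (hZ : Z.Nonempty) :
    0 < hilbertFunction Z 0 := by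
  rw [hilbertFunction_eq]
  have : Nontrivial (LinearMap.range (evalForms Z 0)) := by
    obtain ⟨p, hp⟩ := hZ
    refine ⟨⟨⟨_, ⟨1, MvPolynomial.isHomogeneous_one _ _⟩, rfl⟩, 0, fun h => ?_⟩⟩
    have := congrFun (congrArg Subtype.val h) ⟨p, hp⟩
    simp [evalForms] at this
  exact Module.finrank_pos

theorem hilbertFunction_le_succ {Z : Set (ℙ ℂ (κ → ℂ))} (hZ : IsIrreducible Z) (t : ℕ) :
    hilbertFunction Z t ≤ hilbertFunction Z (t + 1) := by
  obtain ⟨p, hp⟩ := hZ.nonempty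
  obtain ⟨j, hj⟩ := Function.ne_iff.1 p.rep_nonzero
  exact le_of_add_le_left (hilbertFunction_add_le (Set.empty_subset Z) hZ.isPreirreducible
    (MvPolynomial.isHomogeneous_X ℂ j) (by simp) ⟨p, hp, by simpa using hj⟩ t)

/-- The order of growth of the Hilbert function drops by at least one from an irreducible closed set
to a smaller one. -/
theorem hilbertFunction_growth {Y Z : Set (ℙ ℂ (κ → ℂ))} (hZ : IsIrreducible Z) (hZc : IsClosed Z)
    (hY : IsIrreducible Y) (h : Z ⊂ Y) {C s : ℕ}
    (hC : ∀ t, hilbertFunction Y t ≤ C * (t + 1) ^ s) :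
    ∃ C' s', s = s' + 1 ∧ ∀ t, hilbertFunction Z t ≤ C' * (t + 1) ^ s' := by
  obtain ⟨hZY, p, hpY, hpZ⟩ := Set.ssubset_iff_exists.1 h
  obtain ⟨f, e, hf, hfp, hfZ⟩ := exists_form_of_notMem_isClosed hZc hpZ
  have hmono : Monotone (hilbertFunction Z) := monotone_nat_of_le_succ (hilbertFunction_le_succ hZ)
  have hsum : ∀ t J, J * hilbertFunction Z t ≤ hilbertFunction Y (t + J * e) := by
    intro t J
    induction J with
    | zero => simp
    | succ J ih =>
      have h1 := hilbertFunction_add_le hZY hY.isPreirreducible hf hfZ ⟨p, hpY, hfp⟩ (t + J * e)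
      have h2 : hilbertFunction Z t ≤ hilbertFunction Z (t + J * e + e) := hmono (by omega)
      rw [show t + (J + 1) * e = t + J * e + e by ring]
      calc (J + 1) * hilbertFunction Z t = J * hilbertFunction Z t + hilbertFunction Z t := by ring
        _ ≤ _ := (add_le_add ih h2).trans h1
  have hpos := hilbertFunction_zero_pos hZ.nonempty
  cases s with
  | zero =>
    have h1 := (hsum 0 (C + 1)).trans (hC _)
    have h2 : C + 1 ≤ (C + 1) * hilbertFunction Z 0 := Nat.le_mul_of_pos_right _ hpos
    simp at h1
    omega
  | succ s =>
    refine ⟨C * (e + 1) ^ (s + 1), s, rfl, fun t => ?_⟩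
    have h1 := (hsum t (t + 1)).trans (hC _)
    rw [show t + (t + 1) * e + 1 = (t + 1) * (e + 1) by ring, mul_pow] at h1
    refine Nat.le_of_mul_le_mul_left (h1.trans (le_of_eq ?_)) (Nat.succ_pos t)
    ring

/-- A closed set whose Hilbert function grows at most like `t ^ n` has dimension at most `n`. -/
theorem topologicalKrullDim_le_of_hilbertFunction_le {X : Set (ℙ ℂ (κ → ℂ))} (hX : IsClosed X)
    {C n : ℕ} (hC : ∀ t, hilbertFunction X t ≤ C * (t + 1) ^ n) :
    topologicalKrullDim X ≤ n := by
  have key : ∀ (s : ℕ) (Y : TopologicalSpace.IrreducibleCloseds X) (C : ℕ),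
      (∀ t, hilbertFunction (Subtype.val '' (Y : Set X)) t ≤ C * (t + 1) ^ s) →
      Order.height Y ≤ s := by
    intro s
    induction s with
    | zero =>
      intro Y C hY
      refine Order.height_le_coe_iff.2 fun Z hZ => ?_
      obtain ⟨_, s', hs, _⟩ := hilbertFunction_growth
        (Z.isIrreducible.image _ continuous_subtype_val.continuousOn)
        (hX.isClosedEmbedding_subtypeVal.isClosedMap _ Z.isClosed)
        (Y.isIrreducible.image _ continuous_subtype_val.continuousOn)
        (Subtype.val_injective.image_strictMono (SetLike.coe_ssubset_coe.2 hZ)) hY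
      omega
    | succ s ih =>
      intro Y C hY
      refine Order.height_le_coe_iff.2 fun Z hZ => ?_
      obtain ⟨C', s', hs, h⟩ := hilbertFunction_growth
        (Z.isIrreducible.image _ continuous_subtype_val.continuousOn)
        (hX.isClosedEmbedding_subtypeVal.isClosedMap _ Z.isClosed)
        (Y.isIrreducible.image _ continuous_subtype_val.continuousOn)
        (Subtype.val_injective.image_strictMono (SetLike.coe_ssubset_coe.2 hZ)) hY
      obtain rfl : s = s' := by omega
      exact (ih Z C' h).trans_lt (by exact_mod_cast Nat.lt_succ_self s)
  rw [topologicalKrullDim, Order.krullDim_eq_iSup_height]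
  refine iSup_le fun Y => ?_
  have := key n Y C fun t => (hilbertFunction_mono (by simp) t).trans (hC t)
  exact_mod_cast this

end Zariski

/-! ### Sets parametrized by polynomials in real variables -/

section Parametrized

variable {κ σ : Type*}

/-- The points with homogeneous coordinates `φ_j(a)`, for real parameters `a`. -/
def realParamSet (φ : κ → MvPolynomial σ ℂ) : Set (ℙ ℂ (κ → ℂ)) :=
  {p | ∃ (a : σ → ℝ) (h : (fun j => MvPolynomial.eval (fun i => (a i : ℂ)) (φ j)) ≠ 0),
    p = Projectivization.mk ℂ _ h}

theorem eval_aeval_family (φ : κ → MvPolynomial σ ℂ) (x : σ → ℂ) (f : MvPolynomial κ ℂ) :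
    MvPolynomial.eval x (MvPolynomial.aeval φ f) =
      MvPolynomial.eval (fun j => MvPolynomial.eval x (φ j)) f := by
  induction f using MvPolynomial.induction_on with
  | C r => simp
  | add p q hp hq => simp only [map_add, hp, hq]
  | mul_X p i hp => simp only [map_mul, hp, MvPolynomial.aeval_X, MvPolynomial.eval_X]

/-- A complex polynomial that vanishes at the real points vanishes. -/
theorem exists_real_eval_ne_zero {f : MvPolynomial σ ℂ} (hf : f ≠ 0) :
    ∃ a : σ → ℝ, MvPolynomial.eval (fun i => (a i : ℂ)) f ≠ 0 := by
  by_contra! h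
  refine hf (MvPolynomial.funext_set (fun _ => Set.range ((↑) : ℝ → ℂ))
    (fun _ => Set.infinite_range_of_injective Complex.ofReal_injective) fun x hx => ?_)
  choose a ha using fun i => hx i (Set.mem_univ i)
  obtain rfl : (fun i => (a i : ℂ)) = x := funext ha
  rw [h a, map_zero]

theorem vanishes_on_realParamSet_iff {φ : κ → MvPolynomial σ ℂ} {f : MvPolynomial κ ℂ} {t : ℕ}
    (hf : f.IsHomogeneous t) (ht : t ≠ 0) :
    (∀ p ∈ realParamSet φ, MvPolynomial.eval p.rep f = 0) ↔ MvPolynomial.aeval φ f = 0 := by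
  constructor
  · intro h
    by_contra hne
    obtain ⟨a, ha⟩ := exists_real_eval_ne_zero hne
    rw [eval_aeval_family] at ha
    have h0 : (fun j => MvPolynomial.eval (fun i => (a i : ℂ)) (φ j)) ≠ 0 := by
      intro h0
      rw [h0, ← zero_smul ℂ (0 : κ → ℂ), eval_smul_of_isHomogeneous hf, zero_pow ht,
        zero_mul] at ha
      exact ha rfl
    exact ha ((eval_rep_mk_eq_zero_iff hf _ h0).1 (h _ ⟨a, h0, rfl⟩))
  · rintro h _ ⟨a, h0, rfl⟩
    rw [eval_rep_mk_eq_zero_iff hf, ← eval_aeval_family, h, map_zero]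

theorem isIrreducible_realParamSet {φ : κ → MvPolynomial σ ℂ} (hφ : ∃ j, φ j ≠ 0) :
    IsIrreducible (realParamSet φ) := by
  obtain ⟨j, hj⟩ := hφ
  have hne : ∀ a : σ → ℝ, MvPolynomial.eval (fun i => (a i : ℂ)) (φ j) ≠ 0 →
      (fun j => MvPolynomial.eval (fun i => (a i : ℂ)) (φ j)) ≠ 0 :=
    fun a ha h => ha (congrFun h j)
  constructor
  · obtain ⟨a, ha⟩ := exists_real_eval_ne_zero hj
    exact ⟨_, a, hne a ha, rfl⟩
  · rintro U V hU hV ⟨_, ⟨a, ha, rfl⟩, haU⟩ ⟨_, ⟨b, hb, rfl⟩, hbV⟩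
    obtain ⟨f, s, hf, hfa, hfU⟩ := exists_form_of_mem_isOpen hU haU
    obtain ⟨g, t, hg, hgb, hgV⟩ := exists_form_of_mem_isOpen hV hbV
    rw [Ne, eval_rep_mk_eq_zero_iff hf, ← eval_aeval_family] at hfa
    rw [Ne, eval_rep_mk_eq_zero_iff hg, ← eval_aeval_family] at hgb
    have hf0 : MvPolynomial.aeval φ f ≠ 0 := fun h => hfa (by rw [h, map_zero])
    have hg0 : MvPolynomial.aeval φ g ≠ 0 := fun h => hgb (by rw [h, map_zero])
    obtain ⟨c, hc⟩ := exists_real_eval_ne_zero (mul_ne_zero (mul_ne_zero hf0 hg0) hj)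
    rw [map_mul, map_mul] at hc
    refine ⟨_, ⟨c, hne c (right_ne_zero_of_mul hc), rfl⟩, hfU _ ?_, hgV _ ?_⟩
    · rw [Ne, eval_rep_mk_eq_zero_iff hf, ← eval_aeval_family]
      exact left_ne_zero_of_mul (left_ne_zero_of_mul hc)
    · rw [Ne, eval_rep_mk_eq_zero_iff hg, ← eval_aeval_family]
      exact right_ne_zero_of_mul (left_ne_zero_of_mul hc)

/-- The degree `t` part of the coordinate ring of a parametrized set is spanned by the `t`-fold
products of the parametrizing polynomials. Degree `0` is excluded because all `φ_j` may be `0`,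
when the set is empty. -/
theorem hilbertFunction_realParamSet (φ : κ → MvPolynomial σ ℂ) {t : ℕ} (ht : t ≠ 0) :
    hilbertFunction (realParamSet φ) t =
      Module.finrank ℂ ↥(Submodule.span ℂ (Set.range φ) ^ t) := by
  let T := (MvPolynomial.aeval (R := ℂ) φ).toLinearMap.domRestrict
    (MvPolynomial.homogeneousSubmodule κ ℂ t)
  have hT : LinearMap.ker T = vanishingForms (realParamSet φ) t := by
    ext f
    rw [LinearMap.mem_ker]
    exact (vanishes_on_realParamSet_iff f.2 ht).symm
  rw [hilbertFunction_eq_finrank_range T hT]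
  have hr : LinearMap.range T = Submodule.span ℂ (Set.range φ) ^ t := by
    rw [LinearMap.range_domRestrict, ← MvPolynomial.homogeneousSubmodule_one_pow,
      Submodule.map_pow, MvPolynomial.homogeneousSubmodule_one_eq_span_X, Submodule.map_span,
      ← Set.range_comp]
    congr 3
    ext j
    simp
  rw [hr]

end Parametrized

end

noncomputable section

/-! ### Iterated sumsets -/

section Sumset

variable {M N : Type*} [AddCommMonoid M] [AddCommMonoid N]

/-- The set of sums of `t` elements of `A`. -/
def iterSum (A : Set M) : ℕ → Set M
  | 0 => {0}
  | t + 1 => iterSum A t + A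

theorem finite_iterSum {A : Set M} (hA : A.Finite) (t : ℕ) : (iterSum A t).Finite := by
  induction t with
  | zero => exact Set.finite_singleton 0
  | succ t ih => exact ih.add hA

theorem iterSum_mono {A B : Set M} (h : A ⊆ B) (t : ℕ) : iterSum A t ⊆ iterSum B t := by
  induction t with
  | zero => exact subset_rfl
  | succ t ih => exact Set.add_subset_add ih h

theorem add_mem_iterSum {A : Set M} {s t : ℕ} {x y : M} (hx : x ∈ iterSum A s)
    (hy : y ∈ iterSum A t) : x + y ∈ iterSum A (s + t) := by
  induction t generalizing y with
  | zero =>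
    obtain rfl : y = 0 := hy
    simpa using hx
  | succ t ih =>
    obtain ⟨z, hz, a, ha, rfl⟩ := hy
    exact ⟨x + z, ih hz, a, ha, add_assoc x z a⟩

theorem mem_iterSum_one {A : Set M} {x : M} (hx : x ∈ A) : x ∈ iterSum A 1 :=
  ⟨0, rfl, x, hx, zero_add x⟩

theorem nsmul_mem_iterSum {A : Set M} {x : M} (hx : x ∈ A) (t : ℕ) : t • x ∈ iterSum A t := by
  induction t with
  | zero => simp [iterSum]
  | succ t ih => exact ⟨t • x, ih, x, hx, (succ_nsmul x t).symm⟩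

theorem sum_mem_iterSum {A : Set M} {ι : Type*} (s : Finset ι) (x : ι → M) (n : ι → ℕ)
    (hx : ∀ i ∈ s, x i ∈ iterSum A (n i)) : ∑ i ∈ s, x i ∈ iterSum A (∑ i ∈ s, n i) := by
  classical
  induction s using Finset.induction_on with
  | empty => simp [iterSum]
  | insert i s hi ih =>
    rw [Finset.sum_insert hi, Finset.sum_insert hi]
    exact add_mem_iterSum (hx i (Finset.mem_insert_self i s))
      (ih fun j hj => hx j (Finset.mem_insert_of_mem hj))

theorem iterSum_subset_of_zero_mem {A : Set M} (h0 : (0 : M) ∈ A) {s t : ℕ} (h : s ≤ t) :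
    iterSum A s ⊆ iterSum A t := by
  intro x hx
  obtain ⟨r, rfl⟩ := Nat.exists_eq_add_of_le h
  simpa using add_mem_iterSum hx (nsmul_mem_iterSum h0 r)

theorem image_iterSum (f : M →+ N) (A : Set M) (t : ℕ) :
    f '' iterSum A t = iterSum (f '' A) t := by
  induction t with
  | zero => simp [iterSum]
  | succ t ih => rw [iterSum, iterSum, Set.image_add, ih]

theorem addHom_eq_of_mem_iterSum (f : M →+ ℕ) {A : Set M} {k : ℕ} (hA : ∀ x ∈ A, f x = k) (t : ℕ) :
    ∀ x ∈ iterSum A t, f x = t * k := by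
  induction t with
  | zero => rintro _ rfl; simp
  | succ t ih =>
    rintro _ ⟨x, hx, y, hy, rfl⟩
    simp only [map_add, ih x hx, hA y hy]
    ring

theorem addHom_le_of_mem_iterSum (f : M →+ ℕ) {A : Set M} {k : ℕ} (hA : ∀ x ∈ A, f x ≤ k) (t : ℕ) :
    ∀ x ∈ iterSum A t, f x ≤ t * k := by
  induction t with
  | zero => rintro _ rfl; simp
  | succ t ih =>
    rintro _ ⟨x, hx, y, hy, rfl⟩
    simp only [map_add, add_mul, one_mul]
    exact add_le_add (ih x hx) (hA y hy)

end Sumset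

/-! ### Dropping a variable of weight one -/

section Weights

variable {σ : Type*}

/-- The exponents of weighted degree at most `s`. -/
def weightLE (l : σ → ℕ) (s : ℕ) : Set (σ →₀ ℕ) := {β | Finsupp.weight l β ≤ s}

theorem finite_weightLE [Finite σ] {l : σ → ℕ} (hl : ∀ i, 0 < l i) (s : ℕ) :
    (weightLE l s).Finite :=
  Finsupp.finite_of_nat_weight_le l (fun i => (hl i).ne') s

theorem zero_mem_weightLE (l : σ → ℕ) (s : ℕ) : (0 : σ →₀ ℕ) ∈ weightLE l s := by
  simp [weightLE]

variable [Fintype σ]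

theorem ncard_weightLE_le {l : σ → ℕ} (hl : ∀ i, 0 < l i) (s : ℕ) :
    (weightLE l s).ncard ≤ (s + 1) ^ Fintype.card σ := by
  classical
  have h : ∀ β : weightLE l s, ∀ i, β.1 i < s + 1 := fun β i =>
    Nat.lt_succ_of_le ((Finsupp.le_weight l (hl i).ne' β.1).trans β.2)
  have := Nat.card_le_card_of_injective
    (fun (β : weightLE l s) (i : σ) => (⟨β.1 i, h β i⟩ : Fin (s + 1))) (by
      intro β γ hβγ
      refine Subtype.ext (Finsupp.ext fun i => ?_)
      exact congrArg Fin.val (congrFun hβγ i))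
  simpa [Nat.card_eq_fintype_card, Set.ncard_eq_toFinset_card'] using this

variable [DecidableEq σ] (w₀ : σ)

theorem weight_eq_add_weight_subtypeDomain (l : σ → ℕ) (α : σ →₀ ℕ) :
    Finsupp.weight l α = α w₀ * l w₀ +
      Finsupp.weight (fun i : {i // i ≠ w₀} => l i) (α.subtypeDomain (· ≠ w₀)) := by
  rw [Finsupp.weight_eq_sum, Finsupp.weight_eq_sum, Fintype.sum_eq_add_sum_subtype_ne _ w₀]
  simp

/-- Forgetting the exponent of a variable of weight `1` loses no information about sums of `t`
exponents of weighted degree `k`. -/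
theorem ncard_iterSum_weight_eq {l : σ → ℕ} (h₀ : l w₀ = 1) (k t : ℕ) :
    (iterSum {α : σ →₀ ℕ | Finsupp.weight l α = k} t).ncard =
      (iterSum (weightLE (fun i : {i // i ≠ w₀} => l i) k) t).ncard := by
  let π : (σ →₀ ℕ) →+ ({i // i ≠ w₀} →₀ ℕ) := Finsupp.subtypeDomainAddMonoidHom
  have hπ : ∀ α, Finsupp.weight l α = α w₀ +
      Finsupp.weight (fun i : {i // i ≠ w₀} => l i) (π α) := by
    intro α
    rw [weight_eq_add_weight_subtypeDomain w₀, h₀, mul_one]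
    rfl
  have himg : π '' {α : σ →₀ ℕ | Finsupp.weight l α = k} =
      weightLE (fun i : {i // i ≠ w₀} => l i) k := by
    ext β
    constructor
    · rintro ⟨α, hα, rfl⟩
      rw [Set.mem_ofPred_eq, hπ] at hα
      exact (Nat.le_add_left _ _).trans hα.le
    · intro hβ
      have hβ : Finsupp.weight (fun i : {i // i ≠ w₀} => l i) β ≤ k := hβ
      let α : σ →₀ ℕ := Finsupp.equivFunOnFinite.symm fun i =>
        if h : i = w₀ then k - Finsupp.weight (fun i : {i // i ≠ w₀} => l i) β else β ⟨i, h⟩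
      have hαβ : π α = β := by
        ext ⟨i, hi⟩
        change α i = _
        simp [α, hi]
      refine ⟨α, ?_, hαβ⟩
      rw [Set.mem_ofPred_eq, hπ, hαβ]
      simp [α, hβ]
  rw [← himg, ← image_iterSum, Set.InjOn.ncard_image]
  intro α hα β hβ hαβ
  have h1 := addHom_eq_of_mem_iterSum (Finsupp.weight l) (fun _ h => h) t α hα
  have h2 := addHom_eq_of_mem_iterSum (Finsupp.weight l) (fun _ h => h) t β hβ
  rw [hπ] at h1 h2
  rw [← hαβ] at h2
  ext i
  by_cases hi : i = w₀
  · subst hi; omega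
  · exact DFunLike.congr_fun hαβ ⟨i, hi⟩

end Weights

/-! ### Coordinate rings spanned by monomials -/

section Monomials

variable {σ : Type*}

/-- The span of the monomials with exponents in `A`. -/
def monomialSpan (A : Set (σ →₀ ℕ)) : Submodule ℂ (MvPolynomial σ ℂ) :=
  Submodule.span ℂ ((fun α => MvPolynomial.monomial α (1 : ℂ)) '' A)

theorem monomialSpan_mul (A B : Set (σ →₀ ℕ)) :
    monomialSpan A * monomialSpan B = monomialSpan (A + B) := by
  rw [monomialSpan, monomialSpan, Submodule.span_mul_span, monomialSpan]
  congr 1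
  ext p
  constructor
  · rintro ⟨_, ⟨α, hα, rfl⟩, _, ⟨β, hβ, rfl⟩, rfl⟩
    exact ⟨α + β, ⟨α, hα, β, hβ, rfl⟩, by simp [MvPolynomial.monomial_mul]⟩
  · rintro ⟨_, ⟨α, hα, β, hβ, rfl⟩, rfl⟩
    exact ⟨_, ⟨α, hα, rfl⟩, _, ⟨β, hβ, rfl⟩, by simp [MvPolynomial.monomial_mul]⟩

theorem monomialSpan_pow (A : Set (σ →₀ ℕ)) (t : ℕ) :
    monomialSpan A ^ t = monomialSpan (iterSum A t) := by
  induction t with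
  | zero =>
    rw [pow_zero, iterSum, monomialSpan, Set.image_singleton, Submodule.one_eq_span,
      MvPolynomial.monomial_zero', map_one]
  | succ t ih => rw [pow_succ, ih, monomialSpan_mul, iterSum]

theorem finrank_monomialSpan {A : Set (σ →₀ ℕ)} (hA : A.Finite) :
    Module.finrank ℂ (monomialSpan A) = A.ncard := by
  have := hA.fintype
  have h1 : LinearIndependent ℂ (fun α : A => MvPolynomial.monomial α.1 (1 : ℂ)) := by
    have := (MvPolynomial.basisMonomials σ ℂ).linearIndependent.comp
      (fun α : A => α.1) Subtype.val_injective
    simpa [Function.comp_def] using this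
  have h2 : monomialSpan A =
      Submodule.span ℂ (Set.range fun α : A => MvPolynomial.monomial α.1 (1 : ℂ)) := by
    rw [monomialSpan, Set.image_eq_range]
  rw [h2, finrank_span_eq_card h1, Set.ncard_eq_toFinset_card', Set.toFinset_card]

theorem weightedHomogeneousSubmodule_eq_monomialSpan (l : σ → ℕ) (k : ℕ) :
    MvPolynomial.weightedHomogeneousSubmodule ℂ l k =
      monomialSpan {α | Finsupp.weight l α = k} := by
  refine le_antisymm (fun p hp => ?_) (Submodule.span_le.2 ?_)
  · rw [p.as_sum]
    refine sum_mem fun α hα => ?_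
    rw [← mul_one (p.coeff α), ← smul_eq_mul, ← MvPolynomial.smul_monomial]
    exact Submodule.smul_mem _ _
      (Submodule.subset_span ⟨α, hp (MvPolynomial.mem_support_iff.1 hα), rfl⟩)
  · rintro _ ⟨α, hα, rfl⟩
    exact MvPolynomial.isWeightedHomogeneous_monomial l α 1 hα

variable {κ : Type*} [Fintype σ] {φ : κ → MvPolynomial σ ℂ} {l : σ → ℕ} {k : ℕ}

/-- The degree `t` part of the coordinate ring has a basis of monomials, namely those whose exponent
is a sum of `t` exponents of weighted degree `k`. -/
theorem hilbertFunction_eq_ncard_iterSum (hl : ∀ i, 0 < l i)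
    (hφ : Submodule.span ℂ (Set.range φ) = MvPolynomial.weightedHomogeneousSubmodule ℂ l k)
    {t : ℕ} (ht : t ≠ 0) :
    hilbertFunction (closure (realParamSet φ)) t =
      (iterSum {α : σ →₀ ℕ | Finsupp.weight l α = k} t).ncard := by
  have hfin : {α : σ →₀ ℕ | Finsupp.weight l α = k}.Finite :=
    Finsupp.finite_of_nat_weight_eq l (fun i => (hl i).ne') k
  rw [hilbertFunction_closure, hilbertFunction_realParamSet φ ht, hφ,
    weightedHomogeneousSubmodule_eq_monomialSpan, monomialSpan_pow,
    finrank_monomialSpan (finite_iterSum hfin t)]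

end Monomials

/-! ### The dimension -/

section Dimension

variable {κ σ : Type*}

theorem isIrreducible_preimage_val {X : Type*} [TopologicalSpace X] {s t : Set X}
    (ht : IsIrreducible t) (hts : t ⊆ s) : IsIrreducible (Subtype.val ⁻¹' t : Set s) := by
  obtain ⟨x, hx⟩ := ht.nonempty
  refine ⟨⟨⟨x, hts hx⟩, hx⟩, ?_⟩
  rintro _ _ ⟨U, hU, rfl⟩ ⟨V, hV, rfl⟩ ⟨y, hy, hyU⟩ ⟨z, hz, hzV⟩
  obtain ⟨a, ha, haU, haV⟩ := ht.isPreirreducible U V hU hV ⟨y, hy, hyU⟩ ⟨z, hz, hzV⟩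
  exact ⟨⟨a, hts ha⟩, ha, haU, haV⟩

open Classical in
/-- The substitution of `0` for the variables outside `S`. -/
def restrictVars (S : Set σ) : MvPolynomial σ ℂ →ₐ[ℂ] MvPolynomial σ ℂ :=
  MvPolynomial.aeval fun i => if i ∈ S then MvPolynomial.X i else 0

theorem aeval_restrictVars (S : Set σ) (φ : κ → MvPolynomial σ ℂ) (f : MvPolynomial κ ℂ) :
    MvPolynomial.aeval (fun j => restrictVars S (φ j)) f =
      restrictVars S (MvPolynomial.aeval φ f) := by
  have h := MvPolynomial.comp_aeval φ (restrictVars S)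
  exact (AlgHom.congr_fun h f).symm

theorem realParamSet_restrictVars_subset {S T : Set σ} (hST : S ⊆ T) (φ : κ → MvPolynomial σ ℂ) :
    realParamSet (fun j => restrictVars S (φ j)) ⊆
      realParamSet (fun j => restrictVars T (φ j)) := by
  classical
  rintro _ ⟨a, ha, rfl⟩
  have h : ∀ p : MvPolynomial σ ℂ, MvPolynomial.eval (fun i => (a i : ℂ)) (restrictVars S p) =
      MvPolynomial.eval (fun i => ((if i ∈ S then a i else 0 : ℝ) : ℂ)) (restrictVars T p) := by
    intro p
    rw [restrictVars, restrictVars, eval_aeval_family, eval_aeval_family]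
    congr 2
    ext i
    by_cases hS : i ∈ S
    · simp [hS, hST hS]
    · by_cases hT : i ∈ T <;> simp [hS, hT]
  have h2 : (fun j => MvPolynomial.eval (fun i => (a i : ℂ)) (restrictVars S (φ j))) =
      fun j => MvPolynomial.eval (fun i => ((if i ∈ S then a i else 0 : ℝ) : ℂ))
        (restrictVars T (φ j)) := funext fun j => h (φ j)
  refine ⟨fun i => if i ∈ S then a i else 0, ?_, ?_⟩
  · rw [← h2]; exact ha
  · congr 1

theorem restrictVars_univ (p : MvPolynomial σ ℂ) : restrictVars Set.univ p = p := by
  simp [restrictVars]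

theorem exists_linear_form {φ : κ → MvPolynomial σ ℂ} {p : MvPolynomial σ ℂ}
    (hp : p ∈ Submodule.span ℂ (Set.range φ)) :
    ∃ f : MvPolynomial κ ℂ, f.IsHomogeneous 1 ∧ MvPolynomial.aeval φ f = p := by
  have h : Submodule.span ℂ (Set.range φ) ≤ (MvPolynomial.homogeneousSubmodule κ ℂ 1).map
      (MvPolynomial.aeval (R := ℂ) φ).toLinearMap := by
    rw [Submodule.span_le]
    rintro _ ⟨j, rfl⟩
    exact ⟨MvPolynomial.X j, MvPolynomial.isHomogeneous_X ℂ j, by simp⟩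
  obtain ⟨f, hf, rfl⟩ := h hp
  exact ⟨f, hf, rfl⟩

variable [Finite κ] [Fintype σ] {φ : κ → MvPolynomial σ ℂ} {l : σ → ℕ} {k : ℕ}

/-- A variety parametrized by all monomials of weighted degree `k` has the dimension of the weighted
projective space: the images of the coordinate subspaces that contain the axis of a variable of
weight one form a maximal chain. -/
theorem topologicalKrullDim_closure_realParamSet {w₀ : σ} (h₀ : l w₀ = 1) (hl : ∀ i, 0 < l i)
    (hlk : ∀ i, l i ≤ k)
    (hφ : Submodule.span ℂ (Set.range φ) = MvPolynomial.weightedHomogeneousSubmodule ℂ l k) :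
    topologicalKrullDim (closure (realParamSet φ)) = ((Fintype.card σ - 1 : ℕ) : WithBot ℕ∞) := by
  classical
  have hk : 1 ≤ k := h₀ ▸ hlk w₀
  have hcard : Fintype.card {i // i ≠ w₀} = Fintype.card σ - 1 := by
    rw [Fintype.card_subtype_compl, Fintype.card_subtype_eq]
  refine le_antisymm ?_ ?_
  · refine topologicalKrullDim_le_of_hilbertFunction_le isClosed_closure
      (C := hilbertFunction (closure (realParamSet φ)) 0 + (k + 1) ^ (Fintype.card σ - 1))
      fun t => ?_
    rcases Nat.eq_zero_or_pos t with rfl | ht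
    · simp
    · rw [hilbertFunction_eq_ncard_iterSum hl hφ ht.ne', ncard_iterSum_weight_eq w₀ h₀]
      have hsub : iterSum (weightLE (fun i : {i // i ≠ w₀} => l i) k) t ⊆
          weightLE (fun i : {i // i ≠ w₀} => l i) (t * k) :=
        addHom_le_of_mem_iterSum (Finsupp.weight _) (fun _ h => h) t
      have hfin : (weightLE (fun i : {i // i ≠ w₀} => l i) (t * k)).Finite :=
        finite_weightLE (l := fun i : {i // i ≠ w₀} => l i) (fun i => hl i.1) _
      have hb : t * k + 1 ≤ (k + 1) * (t + 1) := by nlinarith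
      calc _ ≤ (weightLE (fun i : {i // i ≠ w₀} => l i) (t * k)).ncard :=
            Set.ncard_le_ncard hsub hfin
        _ ≤ (t * k + 1) ^ (Fintype.card σ - 1) := by
            rw [← hcard]
            exact ncard_weightLE_le (l := fun i : {i // i ≠ w₀} => l i) (fun i => hl i.1) (t * k)
        _ ≤ ((k + 1) * (t + 1)) ^ (Fintype.card σ - 1) :=
            pow_le_pow_left₀ (Nat.zero_le _) hb (Fintype.card σ - 1)
        _ ≤ _ := by
            rw [mul_pow]
            exact Nat.mul_le_mul_right _ (Nat.le_add_left _ _)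
  · -- an enumeration of the variables that starts with `w₀`
    obtain ⟨n, hn⟩ : ∃ n, Fintype.card σ = n + 1 :=
      ⟨Fintype.card σ - 1, (Nat.sub_add_cancel (Fintype.card_pos_iff.2 ⟨w₀⟩)).symm⟩
    obtain ⟨e, he⟩ : ∃ e : σ ≃ Fin (n + 1), e w₀ = 0 := by
      let e := Fintype.equivFinOfCardEq hn
      exact ⟨e.trans (Equiv.swap (e w₀) 0), by simp⟩
    let S : Fin (n + 1) → Set σ := fun j => {i | e i ≤ j}
    have hS0 : ∀ j, w₀ ∈ S j := fun j => by simp [S, he]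
    let ψ : Fin (n + 1) → κ → MvPolynomial σ ℂ := fun j i => restrictVars (S j) (φ i)
    have hmonoform : ∀ i, ∃ f : MvPolynomial κ ℂ, f.IsHomogeneous 1 ∧
        MvPolynomial.aeval φ f = MvPolynomial.X w₀ ^ (k - l i) * MvPolynomial.X i := by
      intro i
      refine exists_linear_form ?_
      rw [hφ]
      have h1 := ((MvPolynomial.isWeightedHomogeneous_X ℂ l w₀).pow (k - l i)).mul
        (MvPolynomial.isWeightedHomogeneous_X ℂ l i)
      have h2 : (k - l i) • l w₀ + l i = k := by
        rw [h₀, smul_eq_mul, mul_one, Nat.sub_add_cancel (hlk i)]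
      rw [h2] at h1
      exact h1
    choose f hf1 hf2 using hmonoform
    have hres : ∀ j i, MvPolynomial.aeval (ψ j) (f i) =
        if i ∈ S j then MvPolynomial.X w₀ ^ (k - l i) * MvPolynomial.X i else 0 := by
      intro j i
      rw [aeval_restrictVars, hf2, map_mul, map_pow]
      by_cases hi : i ∈ S j <;> simp [restrictVars, hi, hS0 j]
    have hne : ∀ j i, i ∈ S j → MvPolynomial.aeval (ψ j) (f i) ≠ 0 := by
      intro j i hi
      rw [hres, if_pos hi]
      exact mul_ne_zero (pow_ne_zero _ (MvPolynomial.X_ne_zero _)) (MvPolynomial.X_ne_zero _)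
    have hirr : ∀ j, IsIrreducible (realParamSet (ψ j)) := by
      intro j
      refine isIrreducible_realParamSet ?_
      by_contra! h
      refine hne j w₀ (hS0 j) ?_
      have hψ : ψ j = 0 := funext h
      rw [hψ]
      refine (vanishes_on_realParamSet_iff (hf1 w₀) one_ne_zero).1 ?_
      rintro _ ⟨a, ha, rfl⟩
      exact absurd (by ext; simp) ha
    have hsub : ∀ j, closure (realParamSet (ψ j)) ⊆ closure (realParamSet φ) := by
      intro j
      have h := realParamSet_restrictVars_subset (Set.subset_univ (S j)) φ
      simp only [restrictVars_univ] at h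
      exact closure_mono h
    let Z : Fin (n + 1) → TopologicalSpace.IrreducibleCloseds (closure (realParamSet φ)) :=
      fun j => ⟨Subtype.val ⁻¹' closure (realParamSet (ψ j)),
        isIrreducible_preimage_val (hirr j).closure (hsub j),
        isClosed_closure.preimage continuous_subtype_val⟩
    have hle : ∀ {i j}, i ≤ j → Z i ≤ Z j := by
      intro i j hij p hp
      exact closure_mono (realParamSet_restrictVars_subset
        (fun x hx => le_trans hx hij) φ) hp
    have hZ : StrictMono Z := by
      intro i j hij
      refine lt_of_le_of_ne (hle hij.le) fun heq => ?_
      -- the monomial of the `j`-th variable vanishes on the `i`-th set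
      refine hne j (e.symm j) (by simp [S]) ?_
      refine (vanishes_on_realParamSet_iff (hf1 _) one_ne_zero).1 fun p hp => ?_
      have h1 : ∀ p ∈ realParamSet (ψ i), MvPolynomial.eval p.rep (f (e.symm j)) = 0 := by
        refine (vanishes_on_realParamSet_iff (hf1 _) one_ne_zero).2 ?_
        rw [hres, if_neg (by simpa [S] using hij)]
      have h2 : p ∈ closure (realParamSet (ψ i)) := by
        have h3 : (⟨p, hsub j (subset_closure hp)⟩ : closure (realParamSet φ)) ∈ Z j :=
          subset_closure hp
        rw [← heq] at h3
        exact h3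
      exact (closure_minimal h1 (isClosed_eval_rep_eq_zero (hf1 _)) :
        closure (realParamSet (ψ i)) ⊆ _) h2
    rw [hn, Nat.add_sub_cancel]
    exact Order.LTSeries.length_le_krullDim (LTSeries.mk n Z hZ)

end Dimension

end

noncomputable section

/-! ### Sumset counts are eventually polynomial -/

section Khovanskii

/-- `f` agrees with a polynomial at all large arguments. -/
def EventuallyPolynomial (f : ℕ → ℚ) : Prop :=
  ∃ P : Polynomial ℚ, ∀ᶠ t : ℕ in Filter.atTop, P.eval (t : ℚ) = f t

theorem EventuallyPolynomial.sub {f g : ℕ → ℚ} (hf : EventuallyPolynomial f)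
    (hg : EventuallyPolynomial g) : EventuallyPolynomial fun t => f t - g t := by
  obtain ⟨P, hP⟩ := hf
  obtain ⟨Q, hQ⟩ := hg
  refine ⟨P - Q, ?_⟩
  filter_upwards [hP, hQ] with t h1 h2
  rw [Polynomial.eval_sub, h1, h2]

theorem EventuallyPolynomial.shift {f g : ℕ → ℚ} (hf : EventuallyPolynomial f) (c : ℕ)
    (h : ∀ t, c ≤ t → g t = f (t - c)) : EventuallyPolynomial g := by
  obtain ⟨P, hP⟩ := hf
  refine ⟨P.comp (Polynomial.X - Polynomial.C (c : ℚ)), ?_⟩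
  filter_upwards [(Filter.tendsto_sub_atTop_nat c).eventually hP, Filter.eventually_ge_atTop c]
    with t h1 h2
  rw [h t h2, ← h1, Nat.cast_sub h2]
  simp

variable {σ : Type*} [Fintype σ]

theorem finite_degree_eq_and (t : ℕ) (p : (σ →₀ ℕ) → Prop) :
    {u : σ →₀ ℕ | u.degree = t ∧ p u}.Finite :=
  (Finsupp.finite_of_degree_eq t).subset fun _ h => h.1

theorem eventuallyPolynomial_ncard_degree :
    EventuallyPolynomial fun t => ({u : σ →₀ ℕ | u.degree = t}.ncard : ℚ) := by
  classical
  have h : ∀ t, {u : σ →₀ ℕ | u.degree = t}.ncard = (Fintype.card σ + t - 1).choose t := by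
    intro t
    rw [← Finset.card_univ, ← Finset.card_finsuppAntidiag_nat_eq_choose, ← Set.ncard_coe_finset]
    congr 1
    ext u
    simp [Finset.mem_finsuppAntidiag, Finsupp.degree_eq_sum]
  simp only [h]
  rcases Nat.eq_zero_or_pos (Fintype.card σ) with h0 | h0
  · refine ⟨0, ?_⟩
    filter_upwards [Filter.eventually_ge_atTop 1] with t ht
    rw [h0, Nat.choose_eq_zero_of_lt (by omega)]
    simp
  · refine ⟨Polynomial.preHilbertPoly ℚ (Fintype.card σ - 1) 0, Filter.Eventually.of_forall ?_⟩
    intro t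
    rw [Polynomial.preHilbertPoly_eq_choose_sub_add ℚ _ (Nat.zero_le t), Nat.sub_zero,
      ← Nat.choose_symm_add]
    congr 2
    omega

/-- The number of vectors of degree `t` that are not above any of finitely many given vectors:
inclusion-exclusion, one vector at a time. -/
theorem eventuallyPolynomial_ncard_forall_not_le (G : List (σ →₀ ℕ)) :
    EventuallyPolynomial fun t =>
      ({u : σ →₀ ℕ | u.degree = t ∧ ∀ g ∈ G, ¬ g ≤ u}.ncard : ℚ) := by
  induction hn : G.length generalizing G with
  | zero =>
    obtain rfl := List.length_eq_zero_iff.1 hn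
    simpa using eventuallyPolynomial_ncard_degree
  | succ n ih =>
    match G, hn with
    | g :: G, hn =>
    have hn : G.length = n := by simpa using hn
    have h1 : EventuallyPolynomial fun t =>
        ({u : σ →₀ ℕ | u.degree = t ∧ g ≤ u ∧ ∀ g' ∈ G, ¬ g' ≤ u}.ncard : ℚ) := by
      refine (ih (G.map fun g' => g' - g) (by simpa using hn)).shift g.degree fun t ht => ?_
      congr 1
      have himg : {u : σ →₀ ℕ | u.degree = t ∧ g ≤ u ∧ ∀ g' ∈ G, ¬ g' ≤ u} = (g + ·) ''
          {u | u.degree = t - g.degree ∧ ∀ g_1 ∈ G.map fun g' => g' - g, ¬ g_1 ≤ u} := by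
        ext u
        constructor
        · rintro ⟨h1, h2, h3⟩
          refine ⟨u - g, ⟨?_, ?_⟩, add_tsub_cancel_of_le h2⟩
          · have h4 := congrArg Finsupp.degree (add_tsub_cancel_of_le h2)
            rw [map_add] at h4
            omega
          · simp only [List.mem_map, forall_exists_index, and_imp, forall_apply_eq_imp_iff₂]
            intro g' hg' hle
            refine h3 g' hg' ((tsub_le_iff_left.1 hle).trans ?_)
            rw [add_tsub_cancel_of_le h2]
        · rintro ⟨w, ⟨h1, h2⟩, rfl⟩
          refine ⟨?_, le_self_add, fun g' hg' hle => h2 (g' - g) (List.mem_map.2 ⟨g', hg', rfl⟩)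
            (tsub_le_iff_left.2 hle)⟩
          change (g + w).degree = t
          rw [map_add, h1]
          omega
      rw [himg, Set.ncard_image_of_injective _ (add_right_injective g)]
    convert (ih G hn).sub h1 using 2 with t
    rw [eq_sub_iff_add_eq, ← Nat.cast_add, ← Set.ncard_union_eq _
      (finite_degree_eq_and t _) (finite_degree_eq_and t _)]
    · congr 2
      ext u
      by_cases hg : g ≤ u <;> simp [hg]
    · rw [Set.disjoint_left]
      rintro u ⟨_, h2⟩ ⟨_, h3, _⟩
      exact h2 g (by simp) h3

/-- The vectors of degree `t` outside an up-closed set: the set has finitely many minimal elements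
by Dickson's lemma. -/
theorem eventuallyPolynomial_ncard_notMem_isUpperSet {U : Set (σ →₀ ℕ)} (hU : IsUpperSet U) :
    EventuallyPolynomial fun t => ({u : σ →₀ ℕ | u.degree = t ∧ u ∉ U}.ncard : ℚ) := by
  have hfin : {u | Minimal (· ∈ U) u}.Finite :=
    WellQuasiOrderedLE.finite_of_isAntichain (setOfPred_minimal_antichain _)
  have h := eventuallyPolynomial_ncard_forall_not_le hfin.toFinset.toList
  convert h using 6 with t u
  refine and_congr_right fun _ => ?_
  simp only [Finset.mem_toList, Set.Finite.mem_toFinset, Set.mem_ofPred_eq]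
  constructor
  · exact fun hu g hg hle => hu (hU hle hg.prop)
  · intro h hu
    obtain ⟨g, hgu, hg⟩ := exists_minimal_le_of_wellFoundedLT (· ∈ U) u hu
    exact h g hg hgu

theorem mem_iterSum_iff_exists_finsupp {M : Type*} [AddCommMonoid M] {A : Set M} [Finite A]
    {t : ℕ} {x : M} :
    x ∈ iterSum A t ↔ ∃ u : A →₀ ℕ, u.degree = t ∧ u.sum (fun a n => n • (a : M)) = x := by
  classical
  constructor
  · induction t generalizing x with
    | zero =>
      rintro rfl
      exact ⟨0, by simp, by simp⟩
    | succ t ih =>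
      rintro ⟨y, hy, a, ha, rfl⟩
      obtain ⟨u, hu, rfl⟩ := ih hy
      refine ⟨u + Finsupp.single ⟨a, ha⟩ 1, by simp [hu], ?_⟩
      rw [Finsupp.sum_add_index' (by simp) (by intros; simp [add_smul])]
      simp
  · rintro ⟨u, rfl, rfl⟩
    exact sum_mem_iterSum _ _ _ fun a _ => nsmul_mem_iterSum a.2 _

/-- Khovanskii's theorem: the number of sums of `t` elements of a finite set is eventually
polynomial in `t`. Each sum is represented by its lexicographically smallest coefficient vector; the vectors
which are not smallest form an up-closed set. -/
theorem eventuallyPolynomial_ncard_iterSum {M : Type*} [AddCommMonoid M] {A : Set M}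
    (hA : A.Finite) : EventuallyPolynomial fun t => ((iterSum A t).ncard : ℚ) := by
  classical
  have := hA.fintype
  let e := Fintype.equivFin A
  let : LinearOrder A := LinearOrder.lift' e e.injective
  let ev : (A →₀ ℕ) →+ M := Finsupp.liftAddHom fun a => (multiplesHom M) (a : M)
  have hev : ∀ u : A →₀ ℕ, ev u = u.sum fun a n => n • (a : M) := fun u => by
    rw [Finsupp.liftAddHom_apply]
    rfl
  let U : Set (A →₀ ℕ) := {u | ∃ v : A →₀ ℕ, v.degree = u.degree ∧ ev v = ev u ∧ toLex v < toLex u}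
  have hU : IsUpperSet U := by
    rintro u w huw ⟨v, h1, h2, h3⟩
    obtain ⟨z, rfl⟩ := exists_add_of_le huw
    refine ⟨v + z, by rw [map_add, map_add, h1], by rw [map_add, map_add, h2], ?_⟩
    rw [toLex_add, toLex_add]
    exact add_lt_add_left h3 _
  convert eventuallyPolynomial_ncard_notMem_isUpperSet hU using 3 with t
  have himg : iterSum A t = ev '' {u : A →₀ ℕ | u.degree = t ∧ u ∉ U} := by
    ext x
    rw [mem_iterSum_iff_exists_finsupp]
    constructor
    · rintro ⟨u, hu, rfl⟩
      have hfin : {v : A →₀ ℕ | v.degree = t ∧ ev v = ev u}.Finite := finite_degree_eq_and t _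
      obtain ⟨v, hv, hmin⟩ := hfin.toFinset.exists_min_image toLex
        ⟨u, by simpa using hu⟩
      obtain ⟨hv1, hv2⟩ := hfin.mem_toFinset.1 hv
      refine ⟨v, ⟨hv1, ?_⟩, by rw [hv2, hev]⟩
      rintro ⟨w, h1, h2, h3⟩
      exact absurd (hmin w (hfin.mem_toFinset.2 ⟨h1.trans hv1, h2.trans hv2⟩)) (not_le.2 h3)
    · rintro ⟨u, ⟨hu, -⟩, rfl⟩
      exact ⟨u, hu, (hev u).symm⟩
  rw [himg, Set.InjOn.ncard_image]
  rintro u ⟨hu, hu'⟩ v ⟨hv, hv'⟩ huv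
  rcases lt_trichotomy (toLex u) (toLex v) with h | h | h
  · exact absurd ⟨u, hu.trans hv.symm, huv, h⟩ hv'
  · exact toLex.injective h
  · exact absurd ⟨v, hv.trans hu.symm, huv.symm, h⟩ hu'

end Khovanskii

end

noncomputable section

/-! ### Lattice points and volume of a weighted simplex -/

section Volume

open MeasureTheory

variable {κ : Type*} [Fintype κ]

/-- The simplex `{x ≥ 0, ∑ lᵢ xᵢ ≤ r}`. -/
def weightSimplex (l : κ → ℕ) (r : ℝ) : Set (κ → ℝ) :=
  {x | (∀ i, 0 ≤ x i) ∧ ∑ i, (l i : ℝ) * x i ≤ r}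

theorem volume_weightSimplex_lt_top {l : κ → ℕ} (hl : ∀ i, 0 < l i) (r : ℝ) :
    volume (weightSimplex l r) < ⊤ := by
  refine (measure_mono (fun x hx => ?_ : weightSimplex l r ⊆
    Set.univ.pi fun _ => Set.Icc 0 r)).trans_lt ?_
  · intro i _
    refine ⟨hx.1 i, le_trans ?_ hx.2⟩
    have h1 : (1 : ℝ) ≤ l i := by exact_mod_cast hl i
    calc x i ≤ l i * x i := le_mul_of_one_le_left (hx.1 i) h1
      _ ≤ ∑ i, (l i : ℝ) * x i := Finset.single_le_sum
        (f := fun i => (l i : ℝ) * x i)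
        (fun j _ => mul_nonneg (Nat.cast_nonneg _) (hx.1 j)) (Finset.mem_univ i)
  · exact (isCompact_univ_pi fun _ => isCompact_Icc).measure_lt_top

/-- The volume of the simplex `{x ≥ 0, ∑ lᵢ xᵢ ≤ 1}`. -/
def simplexVolume (l : κ → ℕ) : ℝ := volume.real (weightSimplex l 1)

theorem volume_real_weightSimplex (l : κ → ℕ) {r : ℝ} (hr : 0 < r) :
    volume.real (weightSimplex l r) = simplexVolume l * r ^ Fintype.card κ := by
  have h : weightSimplex l r = r • weightSimplex l 1 := by
    ext x
    rw [Set.mem_smul_set_iff_inv_smul_mem₀ hr.ne']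
    simp only [weightSimplex, Set.mem_ofPred_eq, Pi.smul_apply, smul_eq_mul]
    refine and_congr (forall_congr' fun i => ?_) ?_
    · rw [mul_nonneg_iff_of_pos_left (inv_pos.2 hr)]
    · simp only [mul_left_comm _ r⁻¹]
      rw [← Finset.mul_sum, inv_mul_le_iff₀ hr, mul_one]
  rw [h, simplexVolume, Measure.real, Measure.addHaar_smul, ENNReal.toReal_mul,
    Module.finrank_fintype_fun_eq_card, abs_of_pos (by positivity),
    ENNReal.toReal_ofReal (by positivity), mul_comm]
  rfl

theorem simplexVolume_pos {l : κ → ℕ} (hl : ∀ i, 0 < l i) : 0 < simplexVolume l := by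
  let δ : ℝ := (∑ i, (l i : ℝ) + 1)⁻¹
  have hS : 0 ≤ ∑ i, (l i : ℝ) := Finset.sum_nonneg fun i _ => Nat.cast_nonneg _
  have hδ : 0 < δ := by positivity
  have hsub : (Set.univ.pi fun _ => Set.Ioo 0 δ) ⊆ weightSimplex l 1 := by
    intro x hx
    refine ⟨fun i => (hx i trivial).1.le, ?_⟩
    calc ∑ i, (l i : ℝ) * x i ≤ ∑ i, (l i : ℝ) * δ := Finset.sum_le_sum fun i _ =>
          mul_le_mul_of_nonneg_left (hx i trivial).2.le (Nat.cast_nonneg _)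
      _ = (∑ i, (l i : ℝ)) * δ := by rw [Finset.sum_mul]
      _ ≤ 1 := by
          rw [mul_inv_le_iff₀ (by positivity)]
          linarith
  have hpos : 0 < volume (Set.univ.pi fun _ : κ => Set.Ioo 0 δ) := by
    rw [Real.volume_pi_Ioo]
    rw [pos_iff_ne_zero, Finset.prod_ne_zero_iff]
    intro i _
    simpa using hδ
  exact ENNReal.toReal_pos (hpos.trans_le (measure_mono hsub)).ne'
    (volume_weightSimplex_lt_top hl 1).ne

/-- The half-open unit cube with smallest corner `β`. -/
def unitCube (β : κ →₀ ℕ) : Set (κ → ℝ) := Set.univ.pi fun i => Set.Ico (β i : ℝ) (β i + 1)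

theorem volume_unitCube (β : κ →₀ ℕ) : volume (unitCube β) = 1 := by
  rw [unitCube, Real.volume_pi_Ico]
  simp

theorem cast_weight (l : κ → ℕ) (β : κ →₀ ℕ) :
    ((Finsupp.weight l β : ℕ) : ℝ) = ∑ i, (l i : ℝ) * β i := by
  rw [Finsupp.weight_eq_sum]
  push_cast
  exact Finset.sum_congr rfl fun i _ => by rw [smul_eq_mul]; push_cast; ring

/-- The cubes at the lattice points of the simplex cover the simplex. -/
theorem simplexVolume_mul_le_ncard {l : κ → ℕ} (hl : ∀ i, 0 < l i) {s : ℕ} (hs : 0 < s) :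
    simplexVolume l * (s : ℝ) ^ Fintype.card κ ≤ (weightLE l s).ncard := by
  have hfin := finite_weightLE hl s
  have hsub : weightSimplex l (s : ℝ) ⊆ ⋃ β ∈ hfin.toFinset, unitCube β := by
    intro x hx
    refine Set.mem_iUnion₂.2 ⟨Finsupp.equivFunOnFinite.symm fun i => ⌊x i⌋₊, ?_, ?_⟩
    · rw [hfin.mem_toFinset]
      have h : ((Finsupp.weight l (Finsupp.equivFunOnFinite.symm fun i => ⌊x i⌋₊) : ℕ) : ℝ) ≤
          s := by
        rw [cast_weight]
        refine le_trans (Finset.sum_le_sum fun i _ => ?_) hx.2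
        exact mul_le_mul_of_nonneg_left (Nat.floor_le (hx.1 i)) (Nat.cast_nonneg _)
      exact Nat.cast_le.1 h
    · intro i _
      exact ⟨Nat.floor_le (hx.1 i), Nat.lt_floor_add_one _⟩
  have h1 : volume (weightSimplex l (s : ℝ)) ≤ (weightLE l s).ncard := by
    refine (measure_mono hsub).trans ((measure_biUnion_finset_le _ _).trans ?_)
    simp only [volume_unitCube, Finset.sum_const, nsmul_eq_mul, mul_one]
    rw [Set.ncard_eq_toFinset_card _ hfin]
  rw [← volume_real_weightSimplex l (Nat.cast_pos.2 hs), Measure.real]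
  exact ENNReal.toReal_le_of_le_ofReal (Nat.cast_nonneg _) (by simpa using h1)

/-- The cubes at the lattice points of the simplex are disjoint and lie in a slightly larger
simplex. -/
theorem ncard_le_simplexVolume_mul {l : κ → ℕ} (hl : ∀ i, 0 < l i) {s : ℕ} (hs : 0 < s) :
    ((weightLE l s).ncard : ℝ) ≤ simplexVolume l * ((s : ℝ) + ∑ i, (l i : ℝ)) ^ Fintype.card κ := by
  have hfin := finite_weightLE hl s
  have hS : 0 ≤ ∑ i, (l i : ℝ) := Finset.sum_nonneg fun i _ => Nat.cast_nonneg _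
  have hs' : (0 : ℝ) < s := Nat.cast_pos.2 hs
  have hsub : (⋃ β ∈ hfin.toFinset, unitCube β) ⊆ weightSimplex l ((s : ℝ) + ∑ i, (l i : ℝ)) := by
    intro x hx
    obtain ⟨β, hβ, hx⟩ := Set.mem_iUnion₂.1 hx
    refine ⟨fun i => (Nat.cast_nonneg _).trans (hx i trivial).1, ?_⟩
    have h : ((Finsupp.weight l β : ℕ) : ℝ) ≤ s := Nat.cast_le.2 (hfin.mem_toFinset.1 hβ)
    rw [cast_weight] at h
    calc ∑ i, (l i : ℝ) * x i ≤ ∑ i, ((l i : ℝ) * β i + l i) := Finset.sum_le_sum fun i _ => by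
          have := mul_le_mul_of_nonneg_left (hx i trivial).2.le (Nat.cast_nonneg (α := ℝ) (l i))
          linarith
      _ ≤ _ := by rw [Finset.sum_add_distrib]; linarith
  have hdisj : Set.PairwiseDisjoint (hfin.toFinset : Set (κ →₀ ℕ)) unitCube := by
    intro β _ γ _ hne
    refine Set.disjoint_left.2 fun x hβ hγ => hne (Finsupp.ext fun i => ?_)
    have h1 := hβ i trivial
    have h2 := hγ i trivial
    have h3 : (β i : ℝ) < γ i + 1 := h1.1.trans_lt h2.2
    have h4 : (γ i : ℝ) < β i + 1 := h2.1.trans_lt h1.2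
    norm_cast at h3 h4
    omega
  have hmeas : ∀ β ∈ hfin.toFinset, MeasurableSet (unitCube β) := fun β _ =>
    MeasurableSet.univ_pi fun i => measurableSet_Ico
  have h1 : ((weightLE l s).ncard : ENNReal) ≤
      volume (weightSimplex l ((s : ℝ) + ∑ i, (l i : ℝ))) := by
    refine le_trans (le_of_eq ?_) (measure_mono hsub)
    rw [measure_biUnion_finset hdisj hmeas]
    simp only [volume_unitCube, Finset.sum_const, nsmul_eq_mul, mul_one]
    rw [Set.ncard_eq_toFinset_card _ hfin]
  rw [← volume_real_weightSimplex l (by positivity), Measure.real]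
  have := ENNReal.toReal_mono (volume_weightSimplex_lt_top hl _).ne h1
  simpa using this

end Volume

/-! ### The leading coefficient of a counting polynomial -/

section Growth

open Filter

theorem tendsto_affine_pow_div_pow (a b : ℝ) (n : ℕ) :
    Tendsto (fun t : ℕ => (a * t + b) ^ n / (t : ℝ) ^ n) atTop (𝓝 (a ^ n)) := by
  have h1 : Tendsto (fun t : ℕ => a + b / (t : ℝ)) atTop (𝓝 (a + 0)) :=
    tendsto_const_nhds.add (tendsto_const_div_atTop_nhds_zero_nat b)
  rw [add_zero] at h1
  refine (h1.pow n).congr' ?_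
  filter_upwards [eventually_gt_atTop 0] with t ht
  have : (t : ℝ) ≠ 0 := by positivity
  rw [← div_pow]
  congr 1
  field_simp

/-- A polynomial between two positive multiples of `t ^ n` has degree `n`. -/
theorem natDegree_eq_and_tendsto_of_growth {P : Polynomial ℚ} {f : ℕ → ℕ}
    (hP : ∀ᶠ t : ℕ in atTop, P.eval (t : ℚ) = f t) {n : ℕ} {a b : ℝ} (ha : 0 < a)
    (h1 : ∀ᶠ t : ℕ in atTop, a * (t : ℝ) ^ n ≤ f t)
    (h2 : ∀ᶠ t : ℕ in atTop, (f t : ℝ) ≤ b * (t : ℝ) ^ n) :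
    P.natDegree = n ∧
      Tendsto (fun t : ℕ => (f t : ℝ) / (t : ℝ) ^ n) atTop (𝓝 (P.leadingCoeff : ℝ)) := by
  let Q := P.map (algebraMap ℚ ℝ)
  have hQ : ∀ᶠ t : ℕ in atTop, Q.eval (t : ℝ) / (Polynomial.X ^ n : Polynomial ℝ).eval (t : ℝ) =
      f t / (t : ℝ) ^ n := by
    filter_upwards [hP] with t ht
    have h := Polynomial.eval_map_apply (f := algebraMap ℚ ℝ) (p := P) (t : ℚ)
    rw [ht] at h
    simp only [eq_ratCast, Rat.cast_natCast] at h
    rw [h]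
    simp
  have hlow : ∀ᶠ t : ℕ in atTop, a ≤ f t / (t : ℝ) ^ n := by
    filter_upwards [h1, eventually_gt_atTop 0] with t ht h0
    have : (0 : ℝ) < (t : ℝ) ^ n := by positivity
    rwa [le_div_iff₀ this]
  have hup : ∀ᶠ t : ℕ in atTop, (f t : ℝ) / (t : ℝ) ^ n ≤ b := by
    filter_upwards [h2, eventually_gt_atTop 0] with t ht h0
    have : (0 : ℝ) < (t : ℝ) ^ n := by positivity
    rwa [div_le_iff₀ this]
  have hX : (Polynomial.X ^ n : Polynomial ℝ) ≠ 0 := pow_ne_zero _ Polynomial.X_ne_zero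
  have hcast := tendsto_natCast_atTop_atTop (R := ℝ)
  have hdeg : Q.degree = (Polynomial.X ^ n : Polynomial ℝ).degree := by
    rcases lt_trichotomy Q.degree (Polynomial.X ^ n : Polynomial ℝ).degree with h | h | h
    · have h3 := ((Polynomial.div_tendsto_atTop_zero_of_degree_lt _ _ h).comp hcast).congr' hQ
      exact absurd (ge_of_tendsto h3 hlow) (not_le.2 ha)
    · exact h
    · have h3 := (Polynomial.abs_div_tendsto_atTop_atTop_of_degree_gt _ _ h hX).comp hcast
      have h4 : ∀ᶠ t : ℕ in atTop, |Q.eval (t : ℝ) /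
          (Polynomial.X ^ n : Polynomial ℝ).eval (t : ℝ)| ≤ b := by
        filter_upwards [hQ, hup] with t ht h5
        rw [ht, abs_of_nonneg (by positivity)]
        exact h5
      obtain ⟨t, ht1, ht2⟩ := (h4.and (h3.eventually_gt_atTop b)).exists
      exact absurd ht2 (not_lt.2 ht1)
  have hlim := ((Polynomial.div_tendsto_atTop_leadingCoeff_div_of_degree_eq _ _ hdeg).comp
    hcast).congr' hQ
  rw [Polynomial.leadingCoeff_map, Polynomial.leadingCoeff_X_pow, div_one] at hlim
  refine ⟨?_, hlim⟩
  rw [Polynomial.degree_map, Polynomial.degree_X_pow] at hdeg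
  exact Polynomial.natDegree_eq_of_degree_eq_some hdeg

theorem single_mem_weightLE {κ : Type*} {l : κ → ℕ} {k : ℕ} {i : κ} {n : ℕ} (h : n * l i ≤ k) :
    Finsupp.single i n ∈ weightLE l k := by
  simpa [weightLE, Finsupp.weight_single] using h

variable {κ : Type*} [Fintype κ] {l : κ → ℕ}

theorem weightLE_one_subset_iterSum {k : ℕ} (hlk : ∀ i, l i ≤ k) (t : ℕ) :
    weightLE (fun _ : κ => 1) t ⊆ iterSum (weightLE l k) t := by
  intro β hβ
  have h1 : β ∈ iterSum (weightLE l k) (∑ i, β i) := by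
    suffices h : ∑ i, Finsupp.single i (β i) ∈ iterSum (weightLE l k) (∑ i, β i) by
      rwa [Finsupp.univ_sum_single] at h
    refine sum_mem_iterSum _ (fun i => Finsupp.single i (β i)) _ fun i _ => ?_
    have := nsmul_mem_iterSum (single_mem_weightLE (l := l) (n := 1) (by simpa using hlk i)) (β i)
    simpa using this
  refine iterSum_subset_of_zero_mem (zero_mem_weightLE l k) ?_ h1
  have h2 : Finsupp.weight (fun _ : κ => 1) β ≤ t := hβ
  simpa [Finsupp.weight_eq_sum] using h2

/-- If all weights divide `k`, then every exponent of weighted degree at most `(t - n) k` is a sum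
of `t` exponents of weighted degree at most `k`: divide the `i`-th entry by `k / lᵢ`. -/
theorem weightLE_subset_iterSum {k t : ℕ} (hk : 0 < k) (hdvd : ∀ i, l i ∣ k)
    (ht : Fintype.card κ ≤ t) :
    weightLE l ((t - Fintype.card κ) * k) ⊆ iterSum (weightLE l k) t := by
  intro β hβ
  choose c hc using hdvd
  have hc0 : ∀ i, 0 < c i := fun i => Nat.pos_of_ne_zero fun h => by
    have := hc i
    rw [h, mul_zero] at this
    omega
  have h1 : β ∈ iterSum (weightLE l k) (∑ i, (β i / c i + 1)) := by
    suffices h : ∑ i, Finsupp.single i (β i) ∈ iterSum (weightLE l k) (∑ i, (β i / c i + 1)) by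
      rwa [Finsupp.univ_sum_single] at h
    refine sum_mem_iterSum _ (fun i => Finsupp.single i (β i)) _ fun i _ => ?_
    have h2 : Finsupp.single i (β i) =
        (β i / c i) • Finsupp.single i (c i) + Finsupp.single i (β i % c i) := by
      rw [Finsupp.smul_single, smul_eq_mul, ← Finsupp.single_add, mul_comm, Nat.div_add_mod]
    rw [h2]
    refine add_mem_iterSum (nsmul_mem_iterSum (single_mem_weightLE ?_) _)
      (mem_iterSum_one (single_mem_weightLE ?_))
    · rw [hc i, mul_comm]
    · rw [hc i, mul_comm]
      exact Nat.mul_le_mul_left _ (Nat.mod_lt _ (hc0 i)).le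
  refine iterSum_subset_of_zero_mem (zero_mem_weightLE l k) ?_ h1
  have h3 : (∑ i, β i / c i) * k ≤ (t - Fintype.card κ) * k := by
    refine le_trans ?_ (hβ : Finsupp.weight l β ≤ _)
    rw [Finsupp.weight_eq_sum, Finset.sum_mul]
    refine Finset.sum_le_sum fun i _ => ?_
    calc β i / c i * k = (β i / c i * c i) * l i := by rw [hc i]; ring
      _ ≤ β i * l i := Nat.mul_le_mul_right _ (Nat.div_mul_le_self _ _)
  have h4 := Nat.le_of_mul_le_mul_right h3 hk
  rw [Finset.sum_add_distrib, Finset.sum_const, smul_eq_mul, mul_one, Finset.card_univ]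
  omega

/-- If `lᵢ` does not divide `k`, then the `i`-th entries of sums of `t` exponents stay away from
the vertex of the simplex; the missed corner contains a smaller simplex. -/
theorem ncard_iterSum_add_le (hl : ∀ i, 0 < l i) {k t : ℕ} {i : κ} (hi : ¬ l i ∣ k)
    (ht : l i ≤ t) :
    (iterSum (weightLE l k) t).ncard + (weightLE l (t - l i)).ncard ≤
      (weightLE l (t * k)).ncard := by
  let e : κ →₀ ℕ := Finsupp.single i (t * (k / l i) + 1)
  have h1 : ∀ β ∈ iterSum (weightLE l k) t, β i ≤ t * (k / l i) := by
    refine addHom_le_of_mem_iterSum (Finsupp.applyAddHom i) (fun β hβ => ?_) t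
    rw [Finsupp.applyAddHom_apply, Nat.le_div_iff_mul_le (hl i)]
    have h2 : β i * l i ≤ ∑ j, β j * l j :=
      Finset.single_le_sum (f := fun j => β j * l j) (fun _ _ => Nat.zero_le _) (Finset.mem_univ i)
    have h3 : Finsupp.weight l β ≤ k := hβ
    rw [Finsupp.weight_eq_sum] at h3
    exact h2.trans h3
  have h4 : l i * (k / l i) + 1 ≤ k := by
    have := Nat.div_add_mod k (l i)
    have : k % l i ≠ 0 := fun h => hi (Nat.dvd_of_mod_eq_zero h)
    omega
  rw [← Set.ncard_image_of_injective (weightLE l (t - l i)) (add_right_injective e),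
    ← Set.ncard_union_eq _ (finite_iterSum (finite_weightLE hl k) t)
      ((finite_weightLE hl _).image _)]
  · refine Set.ncard_le_ncard ?_ (finite_weightLE hl _)
    rintro _ (hβ | ⟨γ, hγ, rfl⟩)
    · exact addHom_le_of_mem_iterSum (Finsupp.weight l) (fun _ h => h) t _ hβ
    · have h5 : Finsupp.weight l γ ≤ t - l i := hγ
      change Finsupp.weight l (e + γ) ≤ t * k
      rw [map_add, Finsupp.weight_single, smul_eq_mul]
      have h6 := Nat.mul_le_mul_left t h4
      have h7 : (t * (k / l i) + 1) * l i = t * (l i * (k / l i)) + l i := by ring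
      rw [mul_add, mul_one] at h6
      omega
  · refine Set.disjoint_left.2 ?_
    rintro _ hβ ⟨γ, _, rfl⟩
    have := h1 _ hβ
    simp only [e, Finsupp.add_apply, Finsupp.single_eq_same] at this
    omega

/-- The leading coefficient of the polynomial that counts sums of `t` exponents of weighted degree
at most `k`, compared with the volume of the simplex. -/
theorem leadingCoeff_of_ncard_iterSum (hl : ∀ i, 0 < l i) {k : ℕ} (hk : 0 < k)
    (hlk : ∀ i, l i ≤ k) {P : Polynomial ℚ}
    (hP : ∀ᶠ t : ℕ in atTop, P.eval (t : ℚ) = (iterSum (weightLE l k) t).ncard) :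
    P.natDegree = Fintype.card κ ∧
    (P.leadingCoeff : ℝ) ≤ simplexVolume l * (k : ℝ) ^ Fintype.card κ ∧
    (∀ k' : ℕ, 0 < k' → k' ≤ k → (∀ i, l i ∣ k') →
      simplexVolume l * (k' : ℝ) ^ Fintype.card κ ≤ P.leadingCoeff) ∧
    ((∃ i, ¬ l i ∣ k) → (P.leadingCoeff : ℝ) < simplexVolume l * (k : ℝ) ^ Fintype.card κ) := by
  set n := Fintype.card κ with hn
  have hv := simplexVolume_pos hl
  have hS : 0 ≤ ∑ i, (l i : ℝ) := Finset.sum_nonneg fun i _ => Nat.cast_nonneg _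
  have hfin := fun t => finite_iterSum (finite_weightLE hl k) t
  have hupper : ∀ t : ℕ, 0 < t → ((iterSum (weightLE l k) t).ncard : ℝ) ≤
      simplexVolume l * ((k : ℝ) * t + ∑ i, (l i : ℝ)) ^ n := by
    intro t ht
    have h1 : (iterSum (weightLE l k) t).ncard ≤ (weightLE l (t * k)).ncard :=
      Set.ncard_le_ncard (addHom_le_of_mem_iterSum (Finsupp.weight l) (fun _ h => h) t)
        (finite_weightLE hl _)
    refine (Nat.cast_le.2 h1).trans ((ncard_le_simplexVolume_mul hl (Nat.mul_pos ht hk)).trans ?_)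
    rw [Nat.cast_mul, mul_comm (t : ℝ)]
  have hlower : ∀ᶠ t : ℕ in atTop, simplexVolume (fun _ : κ => 1) * (t : ℝ) ^ n ≤
      (iterSum (weightLE l k) t).ncard := by
    filter_upwards [eventually_gt_atTop 0] with t ht
    exact (simplexVolume_mul_le_ncard (fun _ => one_pos) ht).trans
      (Nat.cast_le.2 (Set.ncard_le_ncard (weightLE_one_subset_iterSum hlk t) (hfin t)))
  have hbound : ∀ᶠ t : ℕ in atTop, ((iterSum (weightLE l k) t).ncard : ℝ) ≤
      (simplexVolume l * ((k : ℝ) + ∑ i, (l i : ℝ)) ^ n) * (t : ℝ) ^ n := by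
    filter_upwards [eventually_gt_atTop 0] with t ht
    refine (hupper t ht).trans ?_
    rw [mul_assoc, ← mul_pow]
    have ht1 : (1 : ℝ) ≤ t := by exact_mod_cast ht
    refine mul_le_mul_of_nonneg_left (pow_le_pow_left₀ (by positivity) ?_ _) hv.le
    nlinarith
  obtain ⟨hdeg, hlim⟩ := natDegree_eq_and_tendsto_of_growth hP
    (simplexVolume_pos (l := fun _ : κ => 1) fun _ => one_pos) hlower hbound
  have hle : (P.leadingCoeff : ℝ) ≤ simplexVolume l * (k : ℝ) ^ n := by
    refine le_of_tendsto_of_tendsto hlim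
      ((tendsto_affine_pow_div_pow (k : ℝ) (∑ i, (l i : ℝ)) n).const_mul (simplexVolume l)) ?_
    filter_upwards [eventually_gt_atTop 0] with t ht
    rw [← mul_div_assoc]
    gcongr
    exact hupper t ht
  refine ⟨hdeg, hle, fun k' hk'0 hk' hdvd => ?_, fun ⟨i, hi⟩ => ?_⟩
  · refine le_of_tendsto_of_tendsto
      ((tendsto_affine_pow_div_pow (k' : ℝ) (-(n * k' : ℝ)) n).const_mul (simplexVolume l)) hlim ?_
    filter_upwards [eventually_gt_atTop n] with t ht
    have h1 : weightLE l ((t - n) * k') ⊆ iterSum (weightLE l k) t :=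
      (weightLE_subset_iterSum hk'0 hdvd ht.le).trans
        (iterSum_mono (fun β (hβ : Finsupp.weight l β ≤ k') => hβ.trans hk') t)
    have h2 := simplexVolume_mul_le_ncard hl (Nat.mul_pos (Nat.sub_pos_of_lt ht) hk'0)
    have h3 := h2.trans (Nat.cast_le.2 (Set.ncard_le_ncard h1 (hfin t)))
    rw [← mul_div_assoc]
    gcongr
    convert h3 using 3
    rw [Nat.cast_mul, Nat.cast_sub ht.le]
    ring
  · -- the missed corner contains the lattice points of a simplex dilated by `t - lᵢ`, which
    -- lowers the limit by `simplexVolume l`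
    have hlim2 := (tendsto_affine_pow_div_pow (1 : ℝ) (-(l i : ℝ)) n).const_mul (simplexVolume l)
    have h1 : (P.leadingCoeff : ℝ) + simplexVolume l * 1 ^ n ≤ simplexVolume l * (k : ℝ) ^ n := by
      refine le_of_tendsto_of_tendsto (hlim.add hlim2)
        ((tendsto_affine_pow_div_pow (k : ℝ) (∑ i, (l i : ℝ)) n).const_mul (simplexVolume l)) ?_
      filter_upwards [eventually_gt_atTop (l i)] with t ht
      have h2 := ncard_iterSum_add_le hl hi ht.le
      have h3 := simplexVolume_mul_le_ncard hl (Nat.sub_pos_of_lt ht)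
      have h4 := ncard_le_simplexVolume_mul hl (Nat.mul_pos (Nat.zero_lt_of_lt ht) hk)
      rw [Nat.cast_sub ht.le] at h3
      have h5 : ((iterSum (weightLE l k) t).ncard : ℝ) + (weightLE l (t - l i)).ncard ≤
          (weightLE l (t * k)).ncard := by exact_mod_cast h2
      rw [← mul_div_assoc, ← mul_div_assoc, ← add_div]
      gcongr
      rw [Nat.cast_mul, mul_comm (t : ℝ)] at h4
      rw [one_mul, ← sub_eq_add_neg]
      linarith
    rw [one_pow, mul_one] at h1
    linarith

end Growth

end

noncomputable section

/-! ### Normalized volume of a weighted simplex -/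

section NormalizedVolume

open MeasureTheory Module

/-- The measure of a set in units of the covolume of a lattice is the Lebesgue measure of the set in
coordinates with respect to a basis of the lattice. -/
theorem addHaar_div_covolume {ι κ : Type*} [Fintype ι] [Fintype κ] {V : Submodule ℝ (ι → ℝ)}
    (b : Basis κ ℝ V) (hb : integralPoints V = Submodule.span ℤ (Set.range b)) (T : Set (κ → ℝ)) :
    (Measure.addHaar (b.equivFun ⁻¹' T)).toReal /
      ZLattice.covolume (integralPoints V) Measure.addHaar = volume.real T := by
  let e : V ≃L[ℝ] (κ → ℝ) := b.equivFunL
  let μ : Measure (κ → ℝ) := (Measure.addHaar : Measure V).map e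
  have hμ : ∀ s : Set (κ → ℝ), μ s = Measure.addHaar (b.equivFun ⁻¹' s) := fun s =>
    e.toHomeomorph.toMeasurableEquiv.map_apply s
  have : μ.IsAddHaarMeasure := e.isAddHaarMeasure_map _
  let c := μ.addHaarScalarFactor volume
  have hc : 0 < c := Measure.addHaarScalarFactor_pos_of_isAddHaarMeasure _ _
  have hμc : ∀ s : Set (κ → ℝ), (μ s).toReal = c * volume.real s := by
    intro s
    rw [Measure.isAddLeftInvariant_eq_smul μ volume]
    simp [Measure.real, c]
  have hF : ZSpan.fundamentalDomain b = b.equivFun ⁻¹' Set.univ.pi fun _ => Set.Ico 0 1 := by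
    ext x
    simp [ZSpan.mem_fundamentalDomain, Set.mem_pi]
  have hcov : ZLattice.covolume (integralPoints V) Measure.addHaar = c := by
    rw [hb, ZLattice.covolume_eq_measure_fundamentalDomain _ _
      (ZSpan.isAddFundamentalDomain b Measure.addHaar), hF, Measure.real, ← hμ, hμc, Measure.real,
      Real.volume_pi_Ico]
    simp
  rw [hcov, ← hμ, hμc, mul_comm, mul_div_assoc, div_self (by exact_mod_cast hc.ne'), mul_one]

variable {σ : Type*} [Fintype σ]

/-- The simplex `{x ≥ 0, ∑ lᵢ xᵢ = r}`. -/
def weightFace (l : σ → ℕ) (r : ℝ) : Set (σ → ℝ) :=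
  {x | (∀ i, 0 ≤ x i) ∧ ∑ i, (l i : ℝ) * x i = r}

theorem convexHull_range_single [DecidableEq σ] {l : σ → ℕ} (hl : ∀ i, 0 < l i) {r : ℝ}
    (hr : 0 < r) :
    convexHull ℝ (Set.range fun i => Pi.single (M := fun _ : σ => ℝ) i (r / l i)) =
      weightFace l r := by
  have hl' : ∀ i, (l i : ℝ) ≠ 0 := fun i => by exact_mod_cast (hl i).ne'
  apply subset_antisymm
  · refine convexHull_min ?_ ?_
    · rintro _ ⟨i, rfl⟩
      refine ⟨fun j => ?_, ?_⟩
      · by_cases h : j = i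
        · subst h
          simp only [Pi.single_eq_same]
          positivity
        · simp [h]
      · simp only [Pi.single_apply, mul_ite, mul_zero, Finset.sum_ite_eq', Finset.mem_univ, if_true]
        rw [mul_div_cancel₀ _ (hl' i)]
    · intro x hx y hy a b ha hb hab
      refine ⟨fun i => ?_, ?_⟩
      · have := hx.1 i
        have := hy.1 i
        simp only [Pi.add_apply, Pi.smul_apply, smul_eq_mul]
        positivity
      · calc ∑ i, (l i : ℝ) * (a • x + b • y) i =
              a * ∑ i, (l i : ℝ) * x i + b * ∑ i, (l i : ℝ) * y i := by
              simp only [Pi.add_apply, Pi.smul_apply, smul_eq_mul, Finset.mul_sum,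
                ← Finset.sum_add_distrib]
              exact Finset.sum_congr rfl fun i _ => by ring
          _ = r := by rw [hx.2, hy.2, ← add_mul, hab, one_mul]
  · intro x hx
    have h : x = ∑ i, ((l i : ℝ) * x i / r) • Pi.single (M := fun _ : σ => ℝ) i (r / l i) := by
      ext j
      simp only [Finset.sum_apply, Pi.smul_apply, Pi.single_apply, smul_eq_mul, mul_ite, mul_zero,
        Finset.sum_ite_eq, Finset.mem_univ, if_true]
      have := hl' j
      field_simp
    rw [h]
    refine (convex_convexHull ℝ _).sum_mem (fun i _ => ?_) ?_
      fun i _ => subset_convexHull ℝ _ ⟨i, rfl⟩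
    · have := hx.1 i
      positivity
    · rw [← Finset.sum_div, hx.2, div_self hr.ne']

theorem mem_vectorSpan_weightFace {l : σ → ℕ} [Nonempty σ] (hl : ∀ i, 0 < l i) {r : ℝ} (hr : 0 < r)
    (x : σ → ℝ) : x ∈ vectorSpan ℝ (weightFace l r) ↔ ∑ i, (l i : ℝ) * x i = 0 := by
  constructor
  · intro hx
    let f : (σ → ℝ) →ₗ[ℝ] ℝ := ∑ i, (l i : ℝ) • LinearMap.proj i
    have hf : ∀ y, f y = ∑ i, (l i : ℝ) * y i := fun y => by simp [f]
    have h : vectorSpan ℝ (weightFace l r) ≤ LinearMap.ker f := by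
      refine Submodule.span_le.2 ?_
      rintro _ ⟨y, hy, z, hz, rfl⟩
      change f (y - z) = 0
      rw [map_sub, hf, hf, hy.2, hz.2, sub_self]
    rw [← hf]
    exact h hx
  · intro hx
    -- A small multiple of `x` is the difference of a nearby point and the point of the simplex
    -- all of whose entries are equal.
    have hS : 0 < ∑ i, (l i : ℝ) :=
      Finset.sum_pos (fun i _ => by exact_mod_cast hl i) Finset.univ_nonempty
    have hX : 0 ≤ ∑ i, |x i| := Finset.sum_nonneg fun i _ => abs_nonneg _
    let c : ℝ := r / ∑ i, (l i : ℝ)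
    let ε : ℝ := c / (1 + ∑ i, |x i|)
    have hc : 0 < c := by positivity
    have hε : 0 < ε := by positivity
    have hlc : ∑ i, (l i : ℝ) * c = r := by
      rw [← Finset.sum_mul]
      exact mul_div_cancel₀ _ hS.ne'
    have h1 : (fun _ => c) ∈ weightFace l r := ⟨fun _ => hc.le, hlc⟩
    have h2 : (fun i => ε * x i + c) ∈ weightFace l r := by
      refine ⟨fun i => ?_, ?_⟩
      · have h3 : |x i| ≤ ∑ i, |x i| :=
          Finset.single_le_sum (f := fun i => |x i|) (fun _ _ => abs_nonneg _) (Finset.mem_univ i)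
        have h4 : ε * |x i| ≤ c := by
          calc ε * |x i| ≤ ε * (1 + ∑ i, |x i|) := by gcongr; linarith
            _ = c := div_mul_cancel₀ _ (by positivity)
        have h5 := mul_le_mul_of_nonneg_left (neg_abs_le (x i)) hε.le
        linarith
      · simp only [mul_add, Finset.sum_add_distrib, hlc, mul_left_comm _ ε, ← Finset.mul_sum, hx]
        simp
    have h3 := vsub_mem_vectorSpan ℝ h2 h1
    have h4 : x = ε⁻¹ • ((fun i => ε * x i + c) -ᵥ fun _ => c) := by
      ext i
      simp [hε.ne']
    rw [h4]
    exact Submodule.smul_mem _ _ h3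

variable [DecidableEq σ] {l : σ → ℕ} {w₀ : σ}

/-- A hyperplane `∑ lᵢ xᵢ = 0` with `l_{w₀} = 1` is parametrized by the coordinates other than the
one at `w₀`. -/
def hyperplaneEquiv (h₀ : l w₀ = 1) (V : Submodule ℝ (σ → ℝ))
    (hV : ∀ x, x ∈ V ↔ ∑ i, (l i : ℝ) * x i = 0) : V ≃ₗ[ℝ] ({i // i ≠ w₀} → ℝ) where
  toFun v i := (v : σ → ℝ) i
  map_add' _ _ := rfl
  map_smul' _ _ := rfl
  invFun y := ⟨fun i => if h : i = w₀ then -∑ j : {i // i ≠ w₀}, (l j : ℝ) * y j else y ⟨i, h⟩, by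
    rw [hV, Fintype.sum_eq_add_sum_subtype_ne _ w₀]
    rw [dif_pos rfl, h₀, Nat.cast_one, one_mul, neg_add_eq_zero]
    exact Finset.sum_congr rfl fun i _ => by rw [dif_neg i.2]⟩
  left_inv v := by
    ext i
    by_cases h : i = w₀
    · subst h
      have h1 := (hV v).1 v.2
      rw [Fintype.sum_eq_add_sum_subtype_ne _ i, h₀, Nat.cast_one, one_mul] at h1
      simp only [dite_true]
      linarith
    · simp [h]
  right_inv y := by
    ext i
    simp [i.2]

theorem hyperplaneEquiv_apply (h₀ : l w₀ = 1) (V : Submodule ℝ (σ → ℝ))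
    (hV : ∀ x, x ∈ V ↔ ∑ i, (l i : ℝ) * x i = 0) (v : V) (i : {i // i ≠ w₀}) :
    hyperplaneEquiv h₀ V hV v i = (v : σ → ℝ) i := rfl

/-- The coordinates other than the one at `w₀` identify the integral points of the hyperplane with
all integral vectors. -/
theorem integralPoints_hyperplane (h₀ : l w₀ = 1) (V : Submodule ℝ (σ → ℝ))
    (hV : ∀ x, x ∈ V ↔ ∑ i, (l i : ℝ) * x i = 0) :
    integralPoints V =
      Submodule.span ℤ (Set.range (Basis.ofEquivFun (hyperplaneEquiv h₀ V hV))) := by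
  ext v
  rw [Basis.mem_span_iff_repr_mem]
  simp only [Basis.ofEquivFun_repr_apply, hyperplaneEquiv_apply, algebraMap_int_eq,
    eq_intCast, Set.mem_range]
  constructor
  · intro h i
    obtain ⟨n, hn⟩ := h i
    exact ⟨n, hn.symm⟩
  · intro h i
    by_cases hi : i = w₀
    · subst hi
      choose n hn using h
      refine ⟨-∑ j : {j // j ≠ i}, (l j : ℤ) * n j, ?_⟩
      have h1 := (hV v).1 v.2
      rw [Fintype.sum_eq_add_sum_subtype_ne _ i, h₀, Nat.cast_one, one_mul] at h1
      push_cast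
      simp only [hn]
      linarith
    · obtain ⟨n, hn⟩ := h ⟨i, hi⟩
      exact ⟨n, hn.symm⟩

theorem normalizedVolume_weightFace (h₀ : l w₀ = 1) (hl : ∀ i, 0 < l i) {r : ℝ} (hr : 0 < r) :
    normalizedVolume (weightFace l r) = ((Fintype.card {i // i ≠ w₀}).factorial : ℝ) *
      (simplexVolume (fun i : {i // i ≠ w₀} => l i) * r ^ Fintype.card {i // i ≠ w₀}) := by
  have : Nonempty σ := ⟨w₀⟩
  have hne : (weightFace l r).Nonempty := by
    rw [← convexHull_range_single hl hr, convexHull_nonempty_iff]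
    exact Set.range_nonempty _
  rw [normalizedVolume, dif_pos hne]
  have hV := mem_vectorSpan_weightFace hl hr
  let V := vectorSpan ℝ (weightFace l r)
  have hp := hne.some_mem
  generalize hne.some = p at hp ⊢
  let b := Basis.ofEquivFun (hyperplaneEquiv h₀ V hV)
  let q : {i // i ≠ w₀} → ℝ := fun i => p i
  have hS : {v : V | (v : σ → ℝ) + p ∈ weightFace l r} = b.equivFun ⁻¹'
      ((fun y => y + q) ⁻¹' weightSimplex (fun i : {i // i ≠ w₀} => l i) r) := by
    ext v
    have h1 := (hV v).1 v.2
    have h2 := hp.2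
    rw [Fintype.sum_eq_add_sum_subtype_ne _ w₀, h₀, Nat.cast_one, one_mul] at h1 h2
    have h3 : ∑ i, (l i : ℝ) * (v + p : σ → ℝ) i = r := by
      simp only [Pi.add_apply, mul_add, Finset.sum_add_distrib]
      rw [(hV v).1 v.2, hp.2, zero_add]
    have h4 : ∀ i, (b.equivFun v + q) i = (v + p : σ → ℝ) i := fun i => by
      simp [b, q, hyperplaneEquiv_apply]
    have h5 := h3
    rw [Fintype.sum_eq_add_sum_subtype_ne _ w₀, h₀, Nat.cast_one, one_mul] at h5
    simp only [weightFace, weightSimplex, Set.mem_ofPred_eq, Set.mem_preimage, h4, h3, and_true]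
    constructor
    · intro h
      refine ⟨fun i => h i, ?_⟩
      have := h w₀
      linarith
    · rintro ⟨h6, h7⟩ i
      by_cases hi : i = w₀
      · rw [hi]
        linarith
      · exact h6 ⟨i, hi⟩
  rw [hS, addHaar_div_covolume b (integralPoints_hyperplane h₀ V hV),
    Module.finrank_eq_card_basis b, measureReal_def, measure_preimage_add_right, ← measureReal_def, volume_real_weightSimplex _ hr]

theorem smul_lyndonSimplex (d m : ℕ) {k : ℕ} (hk : 0 < k) :
    ((k : ℝ) / (lcmUpTo m : ℝ)) • lyndonSimplex d m =
      weightFace (LyndonWord.length (d := d) (m := m)) k := by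
  have hL : (lcmUpTo m : ℝ) ≠ 0 := by
    rw [Nat.cast_ne_zero, lcmUpTo, Ne, Finset.lcm_eq_zero_iff]
    simp
  rw [lyndonSimplex, ← convexHull_smul, ← Set.range_smul,
    ← convexHull_range_single LyndonWord.length_pos (Nat.cast_pos.2 hk)]
  congr 2
  funext w
  rw [← Pi.single_smul, smul_eq_mul, ← mul_div_assoc, div_mul_cancel₀ _ hL]

end NormalizedVolume

end

noncomputable section

/-! ### The rough Veronese variety in Lyndon coordinates -/

section RoughVeronese

open MvPolynomial

variable {d m : ℕ}

theorem exists_entryPoly (m : ℕ) (w : FreeMonoid (Fin d)) :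
    ∃ p ∈ weightedHomogeneousSubmodule ℝ (LyndonWord.length (d := d) (m := m)) w.length,
      ∀ a, eval a p = expEntry (lieComb lyndonBracket a) w := by
  obtain ⟨p, hp, h⟩ := expEntry_mem_weightedFunctions
    (isTensorOfOrder_lyndonBracket (d := d) (m := m)) w
  refine ⟨p, hp, fun a => ?_⟩
  rw [← aeval_coordinates_apply]
  exact congrFun h a

/-- The entry at `w` of `exp(∑ aᵥ Bᵥ)`, the `Bᵥ` being the Lyndon brackets, as a polynomial in the
coefficients `aᵥ`. -/
def entryPoly (m : ℕ) (w : FreeMonoid (Fin d)) : MvPolynomial (LyndonWord d m) ℝ :=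
  (exists_entryPoly m w).choose

theorem entryPoly_mem (w : FreeMonoid (Fin d)) :
    entryPoly m w ∈ weightedHomogeneousSubmodule ℝ LyndonWord.length w.length :=
  (exists_entryPoly m w).choose_spec.1

theorem eval_entryPoly (w : FreeMonoid (Fin d)) (a : LyndonWord d m → ℝ) :
    eval a (entryPoly m w) = expEntry (lieComb lyndonBracket a) w :=
  (exists_entryPoly m w).choose_spec.2 a

theorem span_entryPoly (d k m : ℕ) :
    Submodule.span ℝ (entryPoly m '' {w : FreeMonoid (Fin d) | w.length = k}) =
      weightedHomogeneousSubmodule ℝ LyndonWord.length k := by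
  refine Submodule.map_injective_of_injective
    (f := (aeval fun (i : LyndonWord d m) (a : LyndonWord d m → ℝ) => a i).toLinearMap)
    (aeval_coordinates_injective _) ?_
  rw [Submodule.map_span, Set.image_image]
  refine Eq.trans ?_ (entrySpan_eq_weightedFunctions lyndonBracket_mem
    isTensorOfOrder_lyndonBracket LyndonWord.length_pos (linearIndependent_lyndonBracket d m) k)
  rw [entrySpan]
  congr 1
  refine Set.image_congr fun w _ => ?_
  ext a
  rw [← eval_entryPoly]
  exact aeval_coordinates_apply _ _

/-- The coordinates of the order `k` component of `exp`, as complex polynomials in the Lyndon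
coordinates. -/
def complexEntryPoly (d k m : ℕ) (w : Fin k → Fin d) : MvPolynomial (LyndonWord d m) ℂ :=
  map (algebraMap ℝ ℂ) (entryPoly m (FreeMonoid.ofList (List.ofFn w)))

theorem eval_complexEntryPoly {k : ℕ} (w : Fin k → Fin d) (a : LyndonWord d m → ℝ) :
    eval (fun i => (a i : ℂ)) (complexEntryPoly d k m w) =
      expTensor k (lieComb lyndonBracket a) w := by
  rw [expTensor, ← eval_entryPoly, complexEntryPoly, eval_map]
  exact (eval₂_comp_left (algebraMap ℝ ℂ) (RingHom.id ℝ) a _).symm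

theorem span_complexEntryPoly (d k m : ℕ) :
    Submodule.span ℂ (Set.range (complexEntryPoly d k m)) =
      weightedHomogeneousSubmodule ℂ LyndonWord.length k := by
  apply le_antisymm
  · refine Submodule.span_le.2 ?_
    rintro _ ⟨w, rfl⟩ α hα
    rw [complexEntryPoly, coeff_map] at hα
    have h := entryPoly_mem (m := m) (FreeMonoid.ofList (List.ofFn w))
      (fun h0 => hα (by rw [h0, map_zero]))
    rw [h]
    exact List.length_ofFn
  · rw [weightedHomogeneousSubmodule_eq_monomialSpan]
    refine Submodule.span_le.2 ?_
    rintro _ ⟨α, hα, rfl⟩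
    have h1 : monomial α (1 : ℝ) ∈
        Submodule.span ℝ (entryPoly m '' {w : FreeMonoid (Fin d) | w.length = k}) := by
      rw [span_entryPoly]
      exact isWeightedHomogeneous_monomial _ _ _ hα
    have h2 : ∀ p ∈ Submodule.span ℝ (entryPoly m '' {w : FreeMonoid (Fin d) | w.length = k}),
        map (algebraMap ℝ ℂ) p ∈ Submodule.span ℂ (Set.range (complexEntryPoly d k m)) := by
      intro p hp
      induction hp using Submodule.span_induction with
      | mem p hp =>
        obtain ⟨w, hw, rfl⟩ := hp
        refine Submodule.subset_span ⟨fun i => w.toList.get (i.cast hw.symm), ?_⟩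
        rw [complexEntryPoly]
        congr 2
        obtain rfl : w.length = k := hw
        exact List.ofFn_get w.toList
      | zero => simp
      | add p q _ _ hp hq => rw [map_add]; exact add_mem hp hq
      | smul c p _ hp =>
        rw [smul_eq_C_mul, map_mul, map_C, ← smul_eq_C_mul]
        exact Submodule.smul_mem _ _ hp
    simpa using h2 _ h1

theorem roughVeronese_eq (d k m : ℕ) :
    roughVeronese d k m = closure (realParamSet (complexEntryPoly d k m)) := by
  have h : ∀ a : LyndonWord d m → ℝ,
      (fun w => eval (fun i => (a i : ℂ)) (complexEntryPoly d k m w)) =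
        expTensor k (lieComb lyndonBracket a) := fun a =>
    funext fun w => eval_complexEntryPoly w a
  rw [roughVeronese]
  congr 1
  ext p
  simp only [realParamSet, Set.mem_ofPred_eq, h]
  constructor
  · rintro ⟨L, hL, h0, rfl⟩
    obtain ⟨a, rfl⟩ := mem_truncatedLie_iff.1 hL
    exact ⟨a, h0, rfl⟩
  · rintro ⟨a, h0, rfl⟩
    exact ⟨_, mem_truncatedLie_iff.2 ⟨a, rfl⟩, h0, rfl⟩

end RoughVeronese

/-! ### Dimension and degree -/

section Degree

open Filter

/-- The Lyndon word that consists of a single letter. -/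
def LyndonWord.single {d m : ℕ} (hm : 1 ≤ m) (i : Fin d) : LyndonWord d m :=
  ⟨[i], isLyndon_singleton i, hm⟩

theorem LyndonWord.length_single {d m : ℕ} (hm : 1 ≤ m) (i : Fin d) :
    (LyndonWord.single hm i).length = 1 := rfl

/-- There is a Lyndon word of every length from `1` to `m`, so a number is divisible by the lengths
of all Lyndon words as soon as it is divisible by `lcm(1, …, m)`, and conversely. -/
theorem lcmUpTo_dvd_iff {d m : ℕ} (hd : 2 ≤ d) {k : ℕ} :
    lcmUpTo m ∣ k ↔ ∀ w : LyndonWord d m, w.length ∣ k := by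
  rw [lcmUpTo, Finset.lcm_dvd_iff]
  constructor
  · exact fun h w => h _ (Finset.mem_Icc.2 ⟨w.length_pos, w.length_le⟩)
  · intro h j hj
    obtain ⟨h1, h2⟩ := Finset.mem_Icc.1 hj
    have h3 : (List.replicate (j - 1) (⟨0, by omega⟩ : Fin d) ++
        [(⟨1, by omega⟩ : Fin d)]).length = j := by
      simp
      omega
    have h4 := h ⟨_, isLyndon_replicate_append (by simp) (j - 1), h3.trans_le h2⟩
    exact h3 ▸ h4

theorem lcmUpTo_pos (m : ℕ) : 0 < lcmUpTo m := by
  rw [Nat.pos_iff_ne_zero, lcmUpTo, Ne, Finset.lcm_eq_zero_iff]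
  simp

theorem exists_isHilbertPolynomial_projDegree_eq {σ : Type*} {X : Set (ℙ ℂ (σ → ℂ))}
    (h : ∃ P, IsHilbertPolynomial X P) :
    ∃ P, IsHilbertPolynomial X P ∧ projDegree X = P.natDegree.factorial * P.leadingCoeff :=
  ⟨h.choose, h.choose_spec, dif_pos h⟩

variable {d m k : ℕ} {w₀ : LyndonWord d m}

theorem eventually_hilbertFunction_roughVeronese (h₀ : w₀.length = 1) :
    ∀ᶠ t : ℕ in atTop, hilbertFunction (roughVeronese d k m) t =
      (iterSum (weightLE (fun w : {w // w ≠ w₀} => w.1.length) k) t).ncard := by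
  filter_upwards [eventually_ne_atTop 0] with t ht
  rw [roughVeronese_eq, hilbertFunction_eq_ncard_iterSum LyndonWord.length_pos
    (span_complexEntryPoly d k m) ht, ncard_iterSum_weight_eq _ h₀]

theorem exists_isHilbertPolynomial_roughVeronese (h₀ : w₀.length = 1) :
    ∃ P, IsHilbertPolynomial (roughVeronese d k m) P := by
  obtain ⟨P, hP⟩ := eventuallyPolynomial_ncard_iterSum
    (finite_weightLE (fun w : {w // w ≠ w₀} => w.1.length_pos) k)
  refine ⟨P, ?_⟩
  filter_upwards [hP, eventually_hilbertFunction_roughVeronese h₀] with t h1 h2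
  rw [h1, h2]

/-- The normalized volume of `(k / lcm(1, …, m)) Δ` is a monomial in `k`. -/
theorem normalizedVolume_smul_lyndonSimplex (h₀ : w₀.length = 1) (hk : 0 < k) :
    normalizedVolume (((k : ℝ) / (lcmUpTo m : ℝ)) • lyndonSimplex d m) =
      ((Fintype.card {w // w ≠ w₀}).factorial : ℝ) *
        (simplexVolume (fun w : {w // w ≠ w₀} => w.1.length) *
          (k : ℝ) ^ Fintype.card {w // w ≠ w₀}) := by
  rw [smul_lyndonSimplex d m hk,
    normalizedVolume_weightFace h₀ LyndonWord.length_pos (Nat.cast_pos.2 hk)]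

theorem normalizedVolume_smul_lyndonSimplex_pos (h₀ : w₀.length = 1) (hk : 0 < k) :
    0 < normalizedVolume (((k : ℝ) / (lcmUpTo m : ℝ)) • lyndonSimplex d m) := by
  rw [normalizedVolume_smul_lyndonSimplex h₀ hk]
  have := simplexVolume_pos (fun w : {w // w ≠ w₀} => w.1.length_pos)
  positivity

/-- The degree lies below the normalized volume for `k`, strictly unless `lcm(1, …, m)` divides
`k`, and above the normalized volumes for the multiples of `lcm(1, …, m)` up to `k`. -/
theorem projDegree_roughVeronese_bounds (hd : 2 ≤ d) (h₀ : w₀.length = 1) (hk : 0 < k)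
    (hmk : m ≤ k) :
    (projDegree (roughVeronese d k m) : ℝ) ≤
        normalizedVolume (((k : ℝ) / (lcmUpTo m : ℝ)) • lyndonSimplex d m) ∧
    (∀ k' : ℕ, 0 < k' → k' ≤ k → lcmUpTo m ∣ k' →
      normalizedVolume (((k' : ℝ) / (lcmUpTo m : ℝ)) • lyndonSimplex d m) ≤
        projDegree (roughVeronese d k m)) ∧
    (¬ lcmUpTo m ∣ k → (projDegree (roughVeronese d k m) : ℝ) <
      normalizedVolume (((k : ℝ) / (lcmUpTo m : ℝ)) • lyndonSimplex d m)) := by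
  obtain ⟨P, hP, hdeg⟩ := exists_isHilbertPolynomial_projDegree_eq
    (exists_isHilbertPolynomial_roughVeronese (k := k) h₀)
  have hP' : ∀ᶠ t : ℕ in atTop, P.eval (t : ℚ) =
      (iterSum (weightLE (fun w : {w // w ≠ w₀} => w.1.length) k) t).ncard := by
    filter_upwards [hP, eventually_hilbertFunction_roughVeronese h₀] with t h1 h2
    rw [h1, h2]
  obtain ⟨hn, hle, hge, hlt⟩ := leadingCoeff_of_ncard_iterSum
    (fun w : {w // w ≠ w₀} => w.1.length_pos) hk (fun w => w.1.length_le.trans hmk) hP'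
  have hfac : (0 : ℝ) < (Fintype.card {w // w ≠ w₀}).factorial := by positivity
  rw [hdeg, hn, normalizedVolume_smul_lyndonSimplex h₀ hk]
  push_cast
  refine ⟨mul_le_mul_of_nonneg_left hle hfac.le, fun k' hk' hk'k hdvd => ?_, fun hdvd => ?_⟩
  · rw [normalizedVolume_smul_lyndonSimplex h₀ hk']
    exact mul_le_mul_of_nonneg_left
      (hge k' hk' hk'k fun w => (lcmUpTo_dvd_iff hd).1 hdvd w.1) hfac.le
  · refine mul_lt_mul_of_pos_left (hlt ?_) hfac
    by_contra! h
    refine hdvd ((lcmUpTo_dvd_iff hd).2 fun w => ?_)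
    by_cases hw : w = w₀
    · rw [hw, h₀]
      exact one_dvd k
    · exact h ⟨w, hw⟩

theorem tendsto_projDegree_div_normalizedVolume (hd : 2 ≤ d) (h₀ : w₀.length = 1) :
    Tendsto (fun k : ℕ => (projDegree (roughVeronese d k m) : ℝ) /
        normalizedVolume (((k : ℝ) / (lcmUpTo m : ℝ)) • lyndonSimplex d m)) atTop (𝓝 1) := by
  have hL := lcmUpTo_pos m
  set n := Fintype.card {w // w ≠ w₀} with hn
  have hlim := tendsto_affine_pow_div_pow 1 (-(lcmUpTo m : ℝ)) n
  rw [one_pow] at hlim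
  refine tendsto_of_tendsto_of_tendsto_of_le_of_le' hlim tendsto_const_nhds ?_ ?_
  · filter_upwards [eventually_ge_atTop m, eventually_ge_atTop (lcmUpTo m)] with k hmk hLk
    have hk := hL.trans_le hLk
    -- The largest multiple of `lcm(1, …, m)` up to `k`.
    let k' := lcmUpTo m * (k / lcmUpTo m)
    have hk'0 : 0 < k' := Nat.mul_pos hL (Nat.div_pos hLk hL)
    have hk'1 : k ≤ k' + lcmUpTo m := by
      have h1 := Nat.div_add_mod k (lcmUpTo m)
      have h2 := Nat.mod_lt k hL
      omega
    have hk'2 : (k : ℝ) ≤ k' + lcmUpTo m := by exact_mod_cast hk'1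
    have hLk' : (lcmUpTo m : ℝ) ≤ k := Nat.cast_le.2 hLk
    have h := (projDegree_roughVeronese_bounds hd h₀ hk hmk).2.1 k' hk'0 (Nat.mul_div_le _ _)
      (dvd_mul_right _ _)
    have hpos := normalizedVolume_smul_lyndonSimplex_pos h₀ hk
    have hv := simplexVolume_pos (fun w : {w // w ≠ w₀} => w.1.length_pos)
    have hk0 : (0 : ℝ) < k := Nat.cast_pos.2 hk
    rw [le_div_iff₀ hpos]
    refine le_trans ?_ h
    rw [normalizedVolume_smul_lyndonSimplex h₀ hk, normalizedVolume_smul_lyndonSimplex h₀ hk'0,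
      ← hn]
    calc (1 * (k : ℝ) + -(lcmUpTo m : ℝ)) ^ n / (k : ℝ) ^ n * ((n.factorial : ℝ) *
          (simplexVolume (fun w : {w // w ≠ w₀} => w.1.length) * (k : ℝ) ^ n)) =
        (n.factorial : ℝ) * (simplexVolume (fun w : {w // w ≠ w₀} => w.1.length) *
          (1 * (k : ℝ) + -(lcmUpTo m : ℝ)) ^ n) := by field_simp
      _ ≤ _ := by
        gcongr
        · linarith
        · linarith
  · filter_upwards [eventually_ge_atTop m, eventually_gt_atTop 0] with k hmk hk
    exact div_le_one_of_le₀ (projDegree_roughVeronese_bounds hd h₀ hk hmk).1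
      (normalizedVolume_smul_lyndonSimplex_pos h₀ hk).le

end Degree

end

theorem mainTheorem5 (d m : ℕ) (hd : 2 ≤ d) (hm : 1 ≤ m) :
    (∀ k : ℕ, m ≤ k →
      topologicalKrullDim (roughVeronese d k m) =
          ((Fintype.card (LyndonWord d m) - 1 : ℕ) : WithBot ℕ∞) ∧
      (∃ P : Polynomial ℚ, IsHilbertPolynomial (roughVeronese d k m) P) ∧
      (projDegree (roughVeronese d k m) : ℝ) ≤
          normalizedVolume (((k : ℝ) / (lcmUpTo m : ℝ)) • lyndonSimplex d m) ∧
      ((projDegree (roughVeronese d k m) : ℝ) =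
          normalizedVolume (((k : ℝ) / (lcmUpTo m : ℝ)) • lyndonSimplex d m) ↔
        lcmUpTo m ∣ k)) ∧
    Filter.Tendsto
      (fun k : ℕ => (projDegree (roughVeronese d k m) : ℝ) /
        normalizedVolume (((k : ℝ) / (lcmUpTo m : ℝ)) • lyndonSimplex d m))
      Filter.atTop (𝓝 1) := by
  let w₀ : LyndonWord d m := LyndonWord.single hm ⟨0, by omega⟩
  have h₀ : w₀.length = 1 := LyndonWord.length_single hm _
  refine ⟨fun k hmk => ?_, tendsto_projDegree_div_normalizedVolume hd h₀⟩
  have hk : 0 < k := hm.trans hmk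
  obtain ⟨hle, hge, hlt⟩ := projDegree_roughVeronese_bounds hd h₀ hk hmk
  refine ⟨?_, exists_isHilbertPolynomial_roughVeronese h₀, hle, fun h => ?_, fun h => ?_⟩
  · rw [roughVeronese_eq]
    exact topologicalKrullDim_closure_realParamSet h₀ LyndonWord.length_pos
      (fun w => w.length_le.trans hmk) (span_complexEntryPoly d k m)
  · by_contra hdvd
    exact (hlt hdvd).ne h
  · exact le_antisymm hle (hge k hk le_rfl h)
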